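/- Let $n\ge 1$, let $\Omega\subset\mathbb R^{n+1}$ be a domain (a nonempty connected open set), write $\delta(x)=\operatorname{dist}(x,\Omega^c)$, let $m$ be Lebesgue measure and let $\sigma=\mathcal H^n|_{\partial\Omega}$, where the Hausdorff measure $\mathcal H^n$ is normalized to agree with Lebesgue measure on $\mathbb R^n$. Assume that * (corkscrew condition) there is $\kappa>0$ such that for every $x\in\partial\Omega$ and $0<r<2\operatorname{diam}\Omega$ some ball of radius at least $\kappa r$ is contained in $B(x,r)\cap\Omega$; * ($n$-Ahlfors regular boundary) there is $C_0>0$ such that $C_0^{-1}r^n\le\sigma(B(x,r))\le C_0r^n$ for all $x\in\partial\Omega$ and all finite $r$ with $0<r\le\operatorname{diam}\partial\Omega$; * either $\Omega$ is bounded or $\partial\Omega$ is unbounded. Let $p,q\in(1,\infty)$ with Hölder conjugates $p',q'$, let $\alpha>0$ and $\hat c_1,\hat c_2\in(0,1/2]$. For $\xi\in\partial\Omega$ put $\gamma_\alpha(\xi)=\{x\in\Omega:|x-\xi|<(1+\alpha)\delta(x)\}$, and for real functions $u\in L^q_{\rm loc}(\Omega)$, $H\in L^{q'}_{\rm loc}(\Omega)$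 define $$\widetilde{\mathcal N}_q u(\xi)=\sup_{x\in\gamma_\alpha(\xi)}\Big(\frac1{m(B(x,\hat c_1\delta(x)))}\int_{B(x,\hat c_1\delta(x))}|u|^q\,dm\Big)^{1/q},$$ $$\mathcal C_{q'}H(\xi)=\sup_{r>0}\frac1{r^n}\int_{B(\xi,r)\cap\Omega}\Big(\frac1{m(B(x,\hat c_2\delta(x)))}\int_{B(x,\hat c_2\delta(x))}|H|^{q'}\,dm\Big)^{1/q'}dm(x).$$ Let $\mathbf N_{q,p}$ be the space of (a.e. classes of) $u\in L^q_{\rm loc}(\Omega)$ with $\|u\|_{\mathbf N_{q,p}}:=\|\widetilde{\mathcal N}_qu\|_{L^p(\partial\Omega,\sigma)}<\infty$, and $\mathbf C_{q',p'}$ the space of (a.e. classes of) $H\in L^{q'}_{\rm loc}(\Omega)$ with $\|H\|_{\mathbf C_{q',p'}}:=\|\mathcal C_{q'}H\|_{L^{p'}(\partial\Omega,\sigma)}<\infty$. Then $\mathbf N_{q,p}=(\mathbf C_{q',p'})^*$ in the following sense: for $u\in\mathbf N_{q,p}$ and $H\in\mathbf C_{q',p'}$ the function $uH$ is integrable on $\Omega$,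 and $u\mapsto\big(H\mapsto\int_\Omega uH\,dm\big)$ is a linear homeomorphism of $\mathbf N_{q,p}$ onto the dual space of $\mathbf C_{q',p'}$, with norms comparable up to a constant $A$. Moreover, with the same $A$, $$\|uH\|_{L^1(\Omega)}\le A\,\|\widetilde{\mathcal N}_qu\|_{L^p(\partial\Omega)}\|\mathcal C_{q'}H\|_{L^{p'}(\partial\Omega)},\qquad u\in L^q_{\rm loc}(\Omega),\ H\in L^{q'}_{\rm loc}(\Omega),$$ (with the convention $0\cdot\infty=0$ on the right-hand side), $$\|\widetilde{\mathcal N}_qu\|_{L^p(\partial\Omega)}\le A\sup_{H}\Big|\int_\Omega uH\,dm\Big|,\qquad u\in L^q_{\rm loc}(\Omega),$$ $$\|\mathcal C_{q'}H\|_{L^{p'}(\partial\Omega)}\le A\sup_{u}\Big|\int_\Omega uH\,dm\Big|,\qquad H\in L^{q'}_{\rm loc}(\Omega),$$ where the first supremum runs over all $H\in L^{q'}_{\rm loc}(\Omega)$ with $\|\mathcal C_{q'}H\|_{L^{p'}(\partial\Omega)}=1$ and $uH\in L^1(\Omega)$, the second over all $u\in L^q_{\rm loc}(\Omega)$ with $\|\widetilde{\mathcal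 N}_qu\|_{L^p(\partial\Omega)}=1$ and $uH\in L^1(\Omega)$, and both sides of each inequality may be infinite. The constant $A$ depends only on $n,p,q,\alpha,\hat c_1,\hat c_2,\kappa$ and $C_0$. -/

import Mathlib

open MeasureTheory Set Metric
open scoped ENNReal NNReal

noncomputable section

namespace NTCarleson

/-! ### Geometry -/

/-- The ambient Euclidean space `ℝⁿ⁺¹`. -/
abbrev E (n : ℕ) : Type := EuclideanSpace ℝ (Fin (n + 1))

variable {n : ℕ}

/-- The distance `δ_Ω(x) = dist(x, Ωᶜ)`. -/
def bdryDist (Ω : Set (E n)) (x : E n) : ℝ := infDist x Ωᶜ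

/-- The surface measure `σ`: the `n`-dimensional Hausdorff measure (normalized so as to agree with
Lebesgue measure on `ℝⁿ`) restricted to the boundary of `Ω`. -/
def surfaceMeasure (Ω : Set (E n)) : Measure (E n) := μHE[n].restrict (frontier Ω)

/-- The set `S` is `n`-Ahlfors regular with constant `C₀`. -/
def IsAhlforsRegular (C₀ : ℝ) (S : Set (E n)) : Prop :=
  ∀ x ∈ S, ∀ r : ℝ, 0 < r → ENNReal.ofReal r ≤ ediam S →
    ENNReal.ofReal (C₀⁻¹ * r ^ n) ≤ μHE[n] (S ∩ ball x r) ∧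
      μHE[n] (S ∩ ball x r) ≤ ENNReal.ofReal (C₀ * r ^ n)

/-- The corkscrew condition with constant `c`. -/
def IsCorkscrew (c : ℝ) (Ω : Set (E n)) : Prop :=
  ∀ x ∈ frontier Ω, ∀ r : ℝ, 0 < r → ENNReal.ofReal r < 2 * ediam Ω →
    ∃ (y : E n) (ρ : ℝ), c * r ≤ ρ ∧ ball y ρ ⊆ ball x r ∩ Ω

/-- The cone (nontangential approach region) with vertex `ξ` and aperture `α`. -/
def cone (α : ℝ) (Ω : Set (E n)) (ξ : E n) : Set (E n) :=
  {x | x ∈ Ω ∧ dist x ξ < (1 + α) * bdryDist Ω x}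

/-! ### The functionals -/

/-- Membership in `L^q_loc(Ω)`. -/
def MemLqLoc (q : ℝ) (Ω : Set (E n)) (u : E n → ℝ) : Prop :=
  ∀ K : Set (E n), K ⊆ Ω → IsCompact K → MemLp u (ENNReal.ofReal q) (volume.restrict K)

/-- The `L^q` mean of `u` over the ball `B(x, ĉ δ_Ω(x))`. -/
def localMean (c q : ℝ) (Ω : Set (E n)) (u : E n → ℝ) (x : E n) : ℝ≥0∞ :=
  (⨍⁻ y in ball x (c * bdryDist Ω x), ‖u y‖ₑ ^ q ∂volume) ^ (1 / q)

/-- The modified nontangential maximal function `Ñ_{α,ĉ,q}(u)`. -/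
def ntMax (α c q : ℝ) (Ω : Set (E n)) (u : E n → ℝ) (ξ : E n) : ℝ≥0∞ :=
  ⨆ x ∈ cone α Ω ξ, localMean c q Ω u x

/-- The `q`-Carleson functional `𝒞_{ĉ,q}(H)`. -/
def carleson (c q : ℝ) (Ω : Set (E n)) (H : E n → ℝ) (ξ : E n) : ℝ≥0∞ :=
  ⨆ (r : ℝ) (_ : 0 < r),
    (∫⁻ x in ball ξ r ∩ Ω, localMean c q Ω H x) / ENNReal.ofReal (r ^ n)

/-- The norm of `L^p(∂Ω, σ)` of a nonnegative function (`∞` if the function is not in `L^p`). -/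
def bdryNorm (p : ℝ) (Ω : Set (E n)) (f : E n → ℝ≥0∞) : ℝ≥0∞ :=
  (∫⁻ ξ, f ξ ^ p ∂(surfaceMeasure Ω)) ^ (1 / p)

/-! ### Elementary properties, needed to make the function spaces into seminormed spaces -/

lemma ball_subset (Ω : Set (E n)) {c : ℝ} (hc : c ∈ Ioc (0 : ℝ) (1 / 2)) (x : E n) :
    ball x (c * bdryDist Ω x) ⊆ Ω := by
  intro y hy
  by_contra hyΩ
  have h1 : bdryDist Ω x ≤ dist x y := infDist_le_dist_of_mem hyΩ
  have h2 : dist x y < c * bdryDist Ω x := by rw [dist_comm]; exact hy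
  have h3 : 0 ≤ bdryDist Ω x := infDist_nonneg
  nlinarith [hc.1, hc.2]

lemma localMean_eq (c q : ℝ) (Ω : Set (E n)) (u : E n → ℝ) (x : E n) :
    localMean c q Ω u x = eLpNorm' u q
      ((volume.restrict (ball x (c * bdryDist Ω x)) univ)⁻¹ •
        volume.restrict (ball x (c * bdryDist Ω x))) := rfl

lemma ae_ball {Ω : Set (E n)} {c : ℝ} (hc : c ∈ Ioc (0 : ℝ) (1 / 2)) {P : E n → Prop}
    (h : ∀ᵐ y ∂(volume.restrict Ω), P y) (x : E n) :
    ∀ᵐ y ∂((volume.restrict (ball x (c * bdryDist Ω x)) univ)⁻¹ •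
        volume.restrict (ball x (c * bdryDist Ω x))), P y :=
  Measure.ae_smul_measure (ae_restrict_of_ae_restrict_of_subset (ball_subset Ω hc x) h) _

lemma aesm_ball {Ω : Set (E n)} {c : ℝ} (hc : c ∈ Ioc (0 : ℝ) (1 / 2)) {u : E n → ℝ}
    (h : AEStronglyMeasurable u (volume.restrict Ω)) (x : E n) :
    AEStronglyMeasurable u ((volume.restrict (ball x (c * bdryDist Ω x)) univ)⁻¹ •
        volume.restrict (ball x (c * bdryDist Ω x))) :=
  (h.mono_measure (Measure.restrict_mono (ball_subset Ω hc x) le_rfl)).smul_measure _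

lemma localMean_congr {Ω : Set (E n)} {c : ℝ} (hc : c ∈ Ioc (0 : ℝ) (1 / 2)) (q : ℝ)
    {u v : E n → ℝ} (h : u =ᵐ[volume.restrict Ω] v) :
    localMean c q Ω u = localMean c q Ω v := by
  funext x
  rw [localMean_eq, localMean_eq]
  exact eLpNorm'_congr_ae (ae_ball hc h x)

lemma localMean_add_le {Ω : Set (E n)} {c q : ℝ} (hc : c ∈ Ioc (0 : ℝ) (1 / 2)) (hq : 1 ≤ q)
    {u v : E n → ℝ} (hu : AEStronglyMeasurable u (volume.restrict Ω))
    (hv : AEStronglyMeasurable v (volume.restrict Ω)) (x : E n) :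
    localMean c q Ω (u + v) x ≤ localMean c q Ω u x + localMean c q Ω v x := by
  simp only [localMean_eq]
  exact eLpNorm'_add_le (aesm_ball hc hu x) (aesm_ball hc hv x) hq

lemma localMean_smul {Ω : Set (E n)} {c q : ℝ} (hq : 1 ≤ q) (a : ℝ) (u : E n → ℝ) (x : E n) :
    localMean c q Ω (a • u) x = ‖a‖ₑ * localMean c q Ω u x := by
  simp only [localMean_eq]
  exact eLpNorm'_const_smul a (by linarith)

lemma localMean_zero {Ω : Set (E n)} {c q : ℝ} (hq : 1 ≤ q) (x : E n) :
    localMean c q Ω (0 : E n → ℝ) x = 0 := by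
  rw [localMean_eq]
  exact eLpNorm'_zero (by linarith)

lemma lowerSemicontinuous_measure_ball (ν : Measure (E n)) {ρ : E n → ℝ} (hρ : Continuous ρ) :
    LowerSemicontinuous fun x => ν (ball x (ρ x)) := by
  intro x a ha
  have hU : ball x (ρ x) = ⋃ k : ℕ, ball x (ρ x - 1 / ((k : ℝ) + 1)) := by
    ext y
    simp only [mem_ball, mem_iUnion]
    constructor
    · intro h
      obtain ⟨k, hk⟩ := exists_nat_one_div_lt (sub_pos.2 h)
      exact ⟨k, by linarith⟩
    · rintro ⟨k, hk⟩
      have : 0 < 1 / ((k : ℝ) + 1) := by positivity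
      linarith
  have hmono : Monotone fun k : ℕ => ball x (ρ x - 1 / ((k : ℝ) + 1)) := by
    intro k l hkl
    apply ball_subset_ball
    have := Nat.one_div_le_one_div (α := ℝ) hkl
    linarith
  have ha' : a < ν (ball x (ρ x)) := ha
  rw [hU, hmono.measure_iUnion] at ha'
  obtain ⟨k, hk⟩ := lt_iSup_iff.1 ha'
  have hpos : 0 < 1 / ((k : ℝ) + 1) := by positivity
  have hopen : ∀ᶠ y in nhds x, dist y x + ρ x - ρ y < 1 / ((k : ℝ) + 1) := by
    have hcont : Continuous fun y => dist y x + ρ x - ρ y := by fun_prop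
    exact hcont.continuousAt.eventually_lt continuousAt_const (by simpa using hpos)
  filter_upwards [hopen] with y hy
  refine hk.trans_le (measure_mono fun z hz => ?_)
  rw [mem_ball] at hz ⊢
  have := dist_triangle z x y
  rw [dist_comm x y] at this
  linarith

lemma measurable_localMean (c q : ℝ) (Ω : Set (E n)) (u : E n → ℝ) :
    Measurable (localMean c q Ω u) := by
  have hρ : Continuous fun x : E n => c * bdryDist Ω x :=
    continuous_const.mul (continuous_infDist_pt _)
  have h1 := (lowerSemicontinuous_measure_ball
    (volume.withDensity fun y => ‖u y‖ₑ ^ q) hρ).measurable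
  have h2 := (lowerSemicontinuous_measure_ball (volume : Measure (E n)) hρ).measurable
  have : localMean c q Ω u = fun x => ((volume.withDensity fun y => ‖u y‖ₑ ^ q)
      (ball x (c * bdryDist Ω x)) / volume (ball x (c * bdryDist Ω x))) ^ (1 / q) := by
    funext x
    rw [localMean, setLAverage_eq, withDensity_apply _ measurableSet_ball]
  rw [this]
  exact (h1.div h2).pow_const _

lemma measurable_ntMax (α c q : ℝ) (Ω : Set (E n)) (u : E n → ℝ) :
    Measurable (ntMax α c q Ω u) := by
  apply LowerSemicontinuous.measurable
  intro ξ a ha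
  simp only [ntMax, lt_iSup_iff] at ha
  obtain ⟨x, hx, hax⟩ := ha
  have : ∀ᶠ ζ in nhds ξ, dist x ζ < (1 + α) * bdryDist Ω x :=
    (continuous_const.dist continuous_id).continuousAt.eventually_lt continuousAt_const hx.2
  filter_upwards [this] with ζ hζ
  simp only [ntMax, lt_iSup_iff]
  exact ⟨x, ⟨hx.1, hζ⟩, hax⟩

lemma measurable_carleson (c q : ℝ) (Ω : Set (E n)) (H : E n → ℝ) :
    Measurable (carleson c q Ω H) := by
  apply LowerSemicontinuous.measurable
  refine lowerSemicontinuous_iSup fun r => lowerSemicontinuous_iSup fun hr => ?_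
  have h := lowerSemicontinuous_measure_ball
    ((volume.restrict Ω).withDensity (localMean c q Ω H)) (ρ := fun _ => r) continuous_const
  have h0 : ENNReal.ofReal (r ^ n) ≠ 0 := by
    rw [ne_eq, ENNReal.ofReal_eq_zero, not_le]; positivity
  intro ξ a ha
  have ha' : a * ENNReal.ofReal (r ^ n) < (volume.restrict Ω).withDensity
      (localMean c q Ω H) (ball ξ r) := by
    rw [withDensity_apply _ measurableSet_ball, Measure.restrict_restrict measurableSet_ball]
    exact (ENNReal.lt_div_iff_mul_lt (Or.inl h0) (Or.inl ENNReal.ofReal_ne_top)).1 ha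
  filter_upwards [h ξ _ ha'] with ζ hζ
  rw [withDensity_apply _ measurableSet_ball, Measure.restrict_restrict measurableSet_ball] at hζ
  exact (ENNReal.lt_div_iff_mul_lt (Or.inl h0) (Or.inl ENNReal.ofReal_ne_top)).2 hζ

lemma ntMax_congr {Ω : Set (E n)} {α c : ℝ} (hc : c ∈ Ioc (0 : ℝ) (1 / 2)) (q : ℝ)
    {u v : E n → ℝ} (h : u =ᵐ[volume.restrict Ω] v) : ntMax α c q Ω u = ntMax α c q Ω v := by
  unfold ntMax; rw [localMean_congr hc q h]

lemma carleson_congr {Ω : Set (E n)} {c : ℝ} (hc : c ∈ Ioc (0 : ℝ) (1 / 2)) (q : ℝ)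
    {u v : E n → ℝ} (h : u =ᵐ[volume.restrict Ω] v) : carleson c q Ω u = carleson c q Ω v := by
  unfold carleson; rw [localMean_congr hc q h]

lemma ntMax_add_le {Ω : Set (E n)} {α c q : ℝ} (hc : c ∈ Ioc (0 : ℝ) (1 / 2)) (hq : 1 ≤ q)
    {u v : E n → ℝ} (hu : AEStronglyMeasurable u (volume.restrict Ω))
    (hv : AEStronglyMeasurable v (volume.restrict Ω)) (ξ : E n) :
    ntMax α c q Ω (u + v) ξ ≤ ntMax α c q Ω u ξ + ntMax α c q Ω v ξ :=
  iSup₂_le fun x hx => (localMean_add_le hc hq hu hv x).trans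
    (add_le_add (le_iSup₂ (f := fun x (_ : x ∈ cone α Ω ξ) => localMean c q Ω u x) x hx)
      (le_iSup₂ (f := fun x (_ : x ∈ cone α Ω ξ) => localMean c q Ω v x) x hx))

lemma carleson_add_le {Ω : Set (E n)} {c q : ℝ} (hc : c ∈ Ioc (0 : ℝ) (1 / 2)) (hq : 1 ≤ q)
    {u v : E n → ℝ} (hu : AEStronglyMeasurable u (volume.restrict Ω))
    (hv : AEStronglyMeasurable v (volume.restrict Ω)) (ξ : E n) :
    carleson c q Ω (u + v) ξ ≤ carleson c q Ω u ξ + carleson c q Ω v ξ := by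
  refine iSup₂_le fun r hr => ?_
  refine le_trans ?_ (add_le_add
    (le_iSup₂ (f := fun (r : ℝ) (_ : 0 < r) => (∫⁻ x in ball ξ r ∩ Ω, localMean c q Ω u x) /
      ENNReal.ofReal (r ^ n)) r hr)
    (le_iSup₂ (f := fun (r : ℝ) (_ : 0 < r) => (∫⁻ x in ball ξ r ∩ Ω, localMean c q Ω v x) /
      ENNReal.ofReal (r ^ n)) r hr))
  rw [← ENNReal.add_div, ← lintegral_add_left (measurable_localMean c q Ω u)]
  gcongr with x
  exact localMean_add_le hc hq hu hv x

lemma ntMax_smul {Ω : Set (E n)} {α c q : ℝ} (hq : 1 ≤ q) (a : ℝ) (u : E n → ℝ) (ξ : E n) :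
    ntMax α c q Ω (a • u) ξ = ‖a‖ₑ * ntMax α c q Ω u ξ := by
  simp only [ntMax, localMean_smul hq, ENNReal.mul_iSup]

lemma carleson_smul {Ω : Set (E n)} {c q : ℝ} (hq : 1 ≤ q) (a : ℝ) (u : E n → ℝ) (ξ : E n) :
    carleson c q Ω (a • u) ξ = ‖a‖ₑ * carleson c q Ω u ξ := by
  simp only [carleson, localMean_smul hq, ENNReal.mul_iSup,
    lintegral_const_mul _ (measurable_localMean c q Ω u), mul_div_assoc]

lemma ntMax_zero {Ω : Set (E n)} {α c q : ℝ} (hq : 1 ≤ q) (ξ : E n) :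
    ntMax α c q Ω (0 : E n → ℝ) ξ = 0 := by
  simp [ntMax, localMean_zero hq]

lemma carleson_zero {Ω : Set (E n)} {c q : ℝ} (hq : 1 ≤ q) (ξ : E n) :
    carleson c q Ω (0 : E n → ℝ) ξ = 0 := by
  simp [carleson, localMean_zero hq]

lemma bdryNorm_mono {p : ℝ} (hp : 1 < p) (Ω : Set (E n)) {f g : E n → ℝ≥0∞}
    (h : ∀ ξ, f ξ ≤ g ξ) : bdryNorm p Ω f ≤ bdryNorm p Ω g := by
  unfold bdryNorm
  gcongr with ξ
  exact h ξ

lemma bdryNorm_add_le {p : ℝ} (hp : 1 < p) (Ω : Set (E n)) {f g : E n → ℝ≥0∞}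
    (hf : Measurable f) (hg : Measurable g) :
    bdryNorm p Ω (f + g) ≤ bdryNorm p Ω f + bdryNorm p Ω g :=
  ENNReal.lintegral_Lp_add_le hf.aemeasurable hg.aemeasurable hp.le

lemma bdryNorm_mul {p : ℝ} (hp : 1 < p) (Ω : Set (E n)) (a : ℝ) {f : E n → ℝ≥0∞}
    (hf : Measurable f) : bdryNorm p Ω (fun ξ => ‖a‖ₑ * f ξ) = ‖a‖ₑ * bdryNorm p Ω f := by
  have hp0 : 0 < p := by linarith
  unfold bdryNorm
  simp only [ENNReal.mul_rpow_of_nonneg _ _ hp0.le]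
  rw [lintegral_const_mul _ (hf.pow_const p), ENNReal.mul_rpow_of_nonneg _ _ (by positivity),
    ← ENNReal.rpow_mul, mul_one_div_cancel hp0.ne', ENNReal.rpow_one]

lemma bdryNorm_zero {p : ℝ} (hp : 1 < p) (Ω : Set (E n)) :
    bdryNorm p Ω (fun _ => 0) = 0 := by
  have hp0 : 0 < p := by linarith
  simp [bdryNorm, hp0]

lemma MemLqLoc.congr {q : ℝ} {Ω : Set (E n)} {u v : E n → ℝ} (h : u =ᵐ[volume.restrict Ω] v)
    (hu : MemLqLoc q Ω u) : MemLqLoc q Ω v := fun K hK hK' =>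
  (memLp_congr_ae (ae_restrict_of_ae_restrict_of_subset hK h)).1 (hu K hK hK')

lemma MemLqLoc.add {q : ℝ} {Ω : Set (E n)} {u v : E n → ℝ}
    (hu : MemLqLoc q Ω u) (hv : MemLqLoc q Ω v) : MemLqLoc q Ω (u + v) := fun K hK hK' =>
  (hu K hK hK').add (hv K hK hK')

lemma MemLqLoc.smul {q : ℝ} {Ω : Set (E n)} {u : E n → ℝ} (a : ℝ)
    (hu : MemLqLoc q Ω u) : MemLqLoc q Ω (a • u) := fun K hK hK' =>
  (hu K hK hK').const_smul a

lemma MemLqLoc.zero {q : ℝ} {Ω : Set (E n)} : MemLqLoc q Ω (0 : E n → ℝ) :=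
  fun _ _ _ => MemLp.zero

/-! ### The spaces `N_{q,p}` and `C_{q,p}`

Elements are classes of functions on `Ω` modulo equality almost everywhere. The values of
`ntMax` and `carleson` only depend on the class (`ntMax_congr`, `carleson_congr`) and are Borel
functions of the boundary point (`measurable_ntMax`, `measurable_carleson`). -/

/-- The space `N_{q,p}` of all `u ∈ L^q_loc(Ω)` with `Ñ_{α,ĉ,q}(u) ∈ L^p(∂Ω)`. -/
def NSpace (Ω : Set (E n)) (α : ℝ) {c q p : ℝ} (hc : c ∈ Ioc (0 : ℝ) (1 / 2)) (hq : 1 ≤ q)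
    (hp : 1 < p) : Submodule ℝ (E n →ₘ[volume.restrict Ω] ℝ) where
  carrier := {u | MemLqLoc q Ω u ∧ bdryNorm p Ω (ntMax α c q Ω u) < ∞}
  zero_mem' := by
    have h := AEEqFun.coeFn_zero (μ := volume.restrict Ω) (β := ℝ) (α := E n)
    refine ⟨MemLqLoc.zero.congr h.symm, ?_⟩
    rw [ntMax_congr hc q h, funext (ntMax_zero hq), bdryNorm_zero hp]
    exact ENNReal.zero_lt_top
  add_mem' := by
    rintro u v ⟨hu, hu'⟩ ⟨hv, hv'⟩
    have h := AEEqFun.coeFn_add u v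
    refine ⟨(hu.add hv).congr h.symm, ?_⟩
    rw [ntMax_congr hc q h]
    exact ((bdryNorm_mono hp Ω (ntMax_add_le hc hq u.aestronglyMeasurable
      v.aestronglyMeasurable)).trans (bdryNorm_add_le hp Ω (measurable_ntMax ..)
        (measurable_ntMax ..))).trans_lt (ENNReal.add_lt_top.2 ⟨hu', hv'⟩)
  smul_mem' := by
    rintro a u ⟨hu, hu'⟩
    have h := AEEqFun.coeFn_smul a u
    refine ⟨(hu.smul a).congr h.symm, ?_⟩
    rw [ntMax_congr hc q h, funext (ntMax_smul hq a u), bdryNorm_mul hp Ω a (measurable_ntMax ..)]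
    exact ENNReal.mul_lt_top enorm_lt_top hu'

/-- The space `C_{q,p}` of all `H ∈ L^q_loc(Ω)` with `𝒞_{ĉ,q}(H) ∈ L^p(∂Ω)`. -/
def CSpace (Ω : Set (E n)) {c q p : ℝ} (hc : c ∈ Ioc (0 : ℝ) (1 / 2)) (hq : 1 ≤ q)
    (hp : 1 < p) : Submodule ℝ (E n →ₘ[volume.restrict Ω] ℝ) where
  carrier := {H | MemLqLoc q Ω H ∧ bdryNorm p Ω (carleson c q Ω H) < ∞}
  zero_mem' := by
    have h := AEEqFun.coeFn_zero (μ := volume.restrict Ω) (β := ℝ) (α := E n)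
    refine ⟨MemLqLoc.zero.congr h.symm, ?_⟩
    rw [carleson_congr hc q h, funext (carleson_zero hq), bdryNorm_zero hp]
    exact ENNReal.zero_lt_top
  add_mem' := by
    rintro u v ⟨hu, hu'⟩ ⟨hv, hv'⟩
    have h := AEEqFun.coeFn_add u v
    refine ⟨(hu.add hv).congr h.symm, ?_⟩
    rw [carleson_congr hc q h]
    exact ((bdryNorm_mono hp Ω (carleson_add_le hc hq u.aestronglyMeasurable
      v.aestronglyMeasurable)).trans (bdryNorm_add_le hp Ω (measurable_carleson ..)
        (measurable_carleson ..))).trans_lt (ENNReal.add_lt_top.2 ⟨hu', hv'⟩)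
  smul_mem' := by
    rintro a u ⟨hu, hu'⟩
    have h := AEEqFun.coeFn_smul a u
    refine ⟨(hu.smul a).congr h.symm, ?_⟩
    rw [carleson_congr hc q h, funext (carleson_smul hq a u),
      bdryNorm_mul hp Ω a (measurable_carleson ..)]
    exact ENNReal.mul_lt_top enorm_lt_top hu'

section Norms

variable {Ω : Set (E n)} {α c q p : ℝ} {hc : c ∈ Ioc (0 : ℝ) (1 / 2)} {hq : 1 ≤ q} {hp : 1 < p}

/-- `‖u‖_{N_{q,p}} = ‖Ñ_{α,ĉ,q}(u)‖_{L^p(∂Ω)}`. -/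
instance NSpace.instNorm : Norm (NSpace Ω α hc hq hp) :=
  ⟨fun u => (bdryNorm p Ω (ntMax α c q Ω (u : E n →ₘ[volume.restrict Ω] ℝ))).toReal⟩

/-- `‖H‖_{C_{q,p}} = ‖𝒞_{ĉ,q}(H)‖_{L^p(∂Ω)}`. -/
instance CSpace.instNorm : Norm (CSpace Ω hc hq hp) :=
  ⟨fun H => (bdryNorm p Ω (carleson c q Ω (H : E n →ₘ[volume.restrict Ω] ℝ))).toReal⟩

lemma NSpace.norm_def (u : NSpace Ω α hc hq hp) :
    ‖u‖ = (bdryNorm p Ω (ntMax α c q Ω (u : E n →ₘ[volume.restrict Ω] ℝ))).toReal := rfl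

lemma CSpace.norm_def (H : CSpace Ω hc hq hp) :
    ‖H‖ = (bdryNorm p Ω (carleson c q Ω (H : E n →ₘ[volume.restrict Ω] ℝ))).toReal := rfl

lemma NSpace.norm_smul' (a : ℝ) (u : NSpace Ω α hc hq hp) : ‖a • u‖ = ‖a‖ * ‖u‖ := by
  rw [NSpace.norm_def, NSpace.norm_def, Submodule.coe_smul,
    ntMax_congr hc q (AEEqFun.coeFn_smul a u.1), funext (ntMax_smul hq a u.1),
    bdryNorm_mul hp Ω a (measurable_ntMax ..), ENNReal.toReal_mul, toReal_enorm]

lemma CSpace.norm_smul' (a : ℝ) (u : CSpace Ω hc hq hp) : ‖a • u‖ = ‖a‖ * ‖u‖ := by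
  rw [CSpace.norm_def, CSpace.norm_def, Submodule.coe_smul,
    carleson_congr hc q (AEEqFun.coeFn_smul a u.1), funext (carleson_smul hq a u.1),
    bdryNorm_mul hp Ω a (measurable_carleson ..), ENNReal.toReal_mul, toReal_enorm]

lemma NSpace.norm_add_le' (u v : NSpace Ω α hc hq hp) : ‖u + v‖ ≤ ‖u‖ + ‖v‖ := by
  rw [NSpace.norm_def, NSpace.norm_def, NSpace.norm_def, Submodule.coe_add,
    ntMax_congr hc q (AEEqFun.coeFn_add u.1 v.1), ← ENNReal.toReal_add u.2.2.ne v.2.2.ne]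
  exact ENNReal.toReal_mono (ENNReal.add_lt_top.2 ⟨u.2.2, v.2.2⟩).ne
    ((bdryNorm_mono hp Ω (ntMax_add_le hc hq u.1.aestronglyMeasurable
      v.1.aestronglyMeasurable)).trans (bdryNorm_add_le hp Ω (measurable_ntMax ..)
        (measurable_ntMax ..)))

lemma CSpace.norm_add_le' (u v : CSpace Ω hc hq hp) : ‖u + v‖ ≤ ‖u‖ + ‖v‖ := by
  rw [CSpace.norm_def, CSpace.norm_def, CSpace.norm_def, Submodule.coe_add,
    carleson_congr hc q (AEEqFun.coeFn_add u.1 v.1), ← ENNReal.toReal_add u.2.2.ne v.2.2.ne]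
  exact ENNReal.toReal_mono (ENNReal.add_lt_top.2 ⟨u.2.2, v.2.2⟩).ne
    ((bdryNorm_mono hp Ω (carleson_add_le hc hq u.1.aestronglyMeasurable
      v.1.aestronglyMeasurable)).trans (bdryNorm_add_le hp Ω (measurable_carleson ..)
        (measurable_carleson ..)))

instance NSpace.instSeminormedAddCommGroup : SeminormedAddCommGroup (NSpace Ω α hc hq hp) :=
  SeminormedAddCommGroup.ofCore (𝕜 := ℝ)
    { norm_nonneg := fun _ => ENNReal.toReal_nonneg
      norm_smul := NSpace.norm_smul'
      norm_triangle := NSpace.norm_add_le' }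

instance CSpace.instSeminormedAddCommGroup : SeminormedAddCommGroup (CSpace Ω hc hq hp) :=
  SeminormedAddCommGroup.ofCore (𝕜 := ℝ)
    { norm_nonneg := fun _ => ENNReal.toReal_nonneg
      norm_smul := CSpace.norm_smul'
      norm_triangle := CSpace.norm_add_le' }

instance NSpace.instNormedSpace : NormedSpace ℝ (NSpace Ω α hc hq hp) where
  norm_smul_le a u := (NSpace.norm_smul' a u).le

instance CSpace.instNormedSpace : NormedSpace ℝ (CSpace Ω hc hq hp) where
  norm_smul_le a u := (CSpace.norm_smul' a u).le

end Norms

end NTCarleson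

end

open NTCarleson

/-!
Ahlfors regularity of the boundary, together with the alternative on boundedness, is used only
through `IsRegular`: boundary balls of radius `r` have measure at most a multiple of `rⁿ`, and at
least a multiple of `rⁿ` if `r ≤ δ(x)` for some `x` in the domain. The upper bound gives the Hardy–Littlewood maximal theorem on the boundary
(`exists_bdryNorm_maximal_le`); the lower bound makes the set of boundary points whose cone contains
a given point `x` carry a fixed proportion of `δ(x)ⁿ`. The Carleson functional of `H` is the
`n`-dimensional maximal function of the measure `h · m` on `Ω`, where `h` is the local mean of `H`.

*The pairing.* Averaging over Whitney balls and Hölder's inequality bound `∫ |u H|` by the integral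
of the local mean of `u` against the measure `h · m`. The Carleson embedding `∫ w dν ≲ ∫_{∂Ω} N(w)
M(ν) dσ` (`exists_lintegral_le_ntSup_mul_maximal`), a consequence of a Vitali covering of superlevel
sets, and Hölder's inequality on the boundary give the bound (`exists_setLIntegral_mul_le`).

*Norming for `N`.* The nontangential maximal function is a supremum over countably many points. For
finitely many of them, each boundary point is assigned to one that realizes the maximum, and the
functions dual to the local means there are superposed with coefficients `∫_V N^{p-1} dσ`, where `V`
is the set of boundary points so assigned. The Carleson functional of the superposition is at most a
multiple of the boundary maximal function of `N^{p-1}` (`exists_bdryNorm_ntMax_le`).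

*Norming for `C`.* The area functional, the integral of `h / δⁿ` over cones, dominates the Carleson
functional in `L^{p'}` (`exists_bdryNorm_maximal_le_area`) and, unlike it, is linear in `h`, with
the boundary averages as adjoint. To test it against a boundary function `g` is therefore to test
`h` against averages of `g`, which is achieved by a superposition over Whitney balls whose
nontangential maximal function is at most a multiple of the boundary maximal function of `g`
(`exists_bdryNorm_area_le`).

*Representation.* With the bound for the pairing this makes the Carleson and area functionals
comparable in `L^{p'}`, and dominated convergence holds for the latter, hence in the Carleson norm
(`tendsto_bdryNorm_carleson_zero`). Thus a bounded functional on the Carleson space is countably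
additive on indicators of subsets of a compact set, and by the Radon–Nikodym theorem it is
integration against a locally integrable function `u` (`IsBoundedFunctional.exists_density`). The
norming inequality for the truncations of `|u|` puts `u` into `N` (`exists_representation`). So the
pairing maps `N` onto the dual of `C`, and the norming inequality bounds its inverse
(`exists_duality_equiv`).
-/

open NTCarleson

namespace NTCarleson

open Filter Topology

variable {n : ℕ}

/-! ### Geometry of the distance to the boundary -/

lemma continuous_bdryDist (Ω : Set (E n)) : Continuous (bdryDist Ω) :=
  continuous_infDist_pt _

lemma bdryDist_nonneg (Ω : Set (E n)) (x : E n) : 0 ≤ bdryDist Ω x := infDist_nonneg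

lemma bdryDist_le_add_dist (Ω : Set (E n)) (x y : E n) :
    bdryDist Ω x ≤ bdryDist Ω y + dist x y := infDist_le_infDist_add_dist

lemma bdryDist_le_dist_of_notMem {Ω : Set (E n)} {x y : E n} (hy : y ∉ Ω) :
    bdryDist Ω x ≤ dist x y := infDist_le_dist_of_mem hy

lemma bdryDist_pos_iff {Ω : Set (E n)} (hΩ : IsOpen Ω) (hne : Ω ≠ univ) {x : E n} :
    0 < bdryDist Ω x ↔ x ∈ Ω := by
  have h := hΩ.isClosed_compl.notMem_iff_infDist_pos (x := x) (nonempty_compl.2 hne)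
  rw [notMem_compl_iff] at h
  exact h.symm

lemma mem_of_dist_lt_bdryDist {Ω : Set (E n)} {x y : E n} (h : dist x y < bdryDist Ω x) :
    y ∈ Ω := by
  by_contra hy
  exact h.not_ge (bdryDist_le_dist_of_notMem hy)

lemma exists_mem_frontier_dist_eq {Ω : Set (E n)} (hΩ : IsOpen Ω) (hne : Ω ≠ univ) {x : E n}
    (hx : x ∈ Ω) : ∃ ξ ∈ frontier Ω, dist x ξ = bdryDist Ω x := by
  obtain ⟨ξ, hξ, h⟩ := hΩ.isClosed_compl.exists_infDist_eq_dist (nonempty_compl.2 hne) x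
  refine ⟨ξ, ?_, h.symm⟩
  rw [hΩ.frontier_eq]
  refine ⟨?_, hξ⟩
  have hpos : bdryDist Ω x ≠ 0 := ((bdryDist_pos_iff hΩ hne).2 hx).ne'
  have hcl : ξ ∈ closure (ball x (bdryDist Ω x)) := by
    rw [closure_ball x hpos, mem_closedBall, dist_comm]
    exact h.symm.le
  exact closure_mono (fun y hy => mem_of_dist_lt_bdryDist (by rwa [dist_comm])) hcl

lemma bdryDist_le_dist_of_mem_frontier {Ω : Set (E n)} (hΩ : IsOpen Ω) {x ξ : E n}
    (hξ : ξ ∈ frontier Ω) : bdryDist Ω x ≤ dist x ξ :=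
  bdryDist_le_dist_of_notMem (by rw [hΩ.frontier_eq] at hξ; exact hξ.2)

/-- A half-line that starts in `Ω` and reaches the complement meets the boundary, at distance at
least `δ(x)` from its starting point `x`. -/
lemma exists_frontier_on_segment {Ω : Set (E n)} (hΩ : IsOpen Ω) {x v : E n}
    (hx : x ∈ Ω) (hv : ‖v‖ = 1) {T : ℝ} (hT : 0 ≤ T) (hT' : x + T • v ∉ Ω) :
    ∃ t : ℝ, bdryDist Ω x ≤ t ∧ x + t • v ∈ frontier Ω := by
  have hpre : IsPreconnected ((fun t : ℝ => x + t • v) '' Icc 0 T) :=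
    isPreconnected_Icc.image _ (by fun_prop)
  have h1 : (((fun t : ℝ => x + t • v) '' Icc 0 T) ∩ Ω).Nonempty :=
    ⟨x, ⟨0, ⟨le_rfl, hT⟩, by simp⟩, hx⟩
  have h2 : (((fun t : ℝ => x + t • v) '' Icc 0 T) ∩ Ωᶜ).Nonempty :=
    ⟨_, ⟨T, ⟨hT, le_rfl⟩, rfl⟩, hT'⟩
  obtain ⟨_, ⟨t, ht, rfl⟩, hz⟩ :
      (((fun t : ℝ => x + t • v) '' Icc 0 T) ∩ frontier Ω).Nonempty := by
    by_contra hemp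
    have hcl : ∀ z ∈ (fun t : ℝ => x + t • v) '' Icc 0 T, z ∈ closure Ω → z ∈ Ω := by
      intro z hz hzc
      by_contra hzΩ
      exact hemp ⟨z, hz, by rw [hΩ.frontier_eq]; exact ⟨hzc, hzΩ⟩⟩
    obtain ⟨z, -, hz1, hz2⟩ := hpre Ω (closure Ω)ᶜ hΩ isClosed_closure.isOpen_compl
      (fun z hz => by
        by_cases hzc : z ∈ closure Ω
        · exact Or.inl (hcl z hz hzc)
        · exact Or.inr hzc) h1
      (h2.imp fun z hz => ⟨hz.1, fun hzc => hz.2 (hcl z hz.1 hzc)⟩)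
    exact hz2 (subset_closure hz1)
  refine ⟨t, ?_, hz⟩
  have := bdryDist_le_dist_of_mem_frontier hΩ (x := x) hz
  simpa [dist_eq_norm, norm_smul, hv, abs_of_nonneg ht.1] using this

/-- The distance to the boundary is at most the diameter of the boundary: in a bounded domain, two
opposite half-lines from a point both meet the boundary. -/
lemma bdryDist_le_ediam_frontier {Ω : Set (E n)} (hΩ : IsOpen Ω)
    (h : Bornology.IsBounded Ω ∨ ¬ Bornology.IsBounded (frontier Ω)) {x : E n} (hx : x ∈ Ω) :
    ENNReal.ofReal (bdryDist Ω x) ≤ ediam (frontier Ω) := by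
  rcases h with h | h
  · obtain ⟨v, hv⟩ : ∃ v : E n, ‖v‖ = 1 :=
      ⟨EuclideanSpace.single 0 1, by simp⟩
    obtain ⟨R, hR⟩ := h.subset_ball x
    have hRpos : 0 < R := by
      by_contra hR0
      have := hR hx
      rw [ball_eq_empty.2 (not_lt.1 hR0)] at this
      exact this
    have key : ∀ w : E n, ‖w‖ = 1 → x + R • w ∉ Ω := by
      intro w hw hmem
      have := hR hmem
      simp [dist_eq_norm, norm_smul, hw, abs_of_pos hRpos] at this
    obtain ⟨t, ht, htf⟩ := exists_frontier_on_segment hΩ hx hv hRpos.le (key v hv)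
    obtain ⟨s, hs, hsf⟩ := exists_frontier_on_segment hΩ hx (v := -v) (by simpa) hRpos.le
      (key (-v) (by simpa))
    refine le_trans ?_ (edist_le_ediam_of_mem htf hsf)
    rw [edist_dist]
    apply ENNReal.ofReal_le_ofReal
    have h0 := bdryDist_nonneg Ω x
    have : dist (x + t • v) (x + s • -v) = t + s := by
      rw [dist_eq_norm, show x + t • v - (x + s • -v) = (t + s) • v by
        simp only [smul_neg, add_smul]; abel, norm_smul, hv, mul_one, Real.norm_eq_abs,
        abs_of_nonneg (by linarith)]
    linarith
  · have : ediam (frontier Ω) = ∞ := by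
      by_contra h'
      exact h (isBounded_iff_ediam_ne_top.2 h')
    rw [this]
    exact le_top

/-! ### Regularity of the boundary measure -/

/-- The properties of `Ω` that carry the duality: the boundary measure has upper growth of order
`n` at all scales, and lower growth of order `n` up to the scale of the distance function. -/
structure IsRegular (C : ℝ≥0) (Ω : Set (E n)) : Prop where
  isOpen : IsOpen Ω
  ne_univ : Ω ≠ univ
  upper : ∀ ξ ∈ frontier Ω, ∀ r : ℝ, 0 < r →
    surfaceMeasure Ω (ball ξ r) ≤ C * ENNReal.ofReal (r ^ n)
  lower : ∀ x ∈ Ω, ∀ ξ ∈ frontier Ω, ∀ r : ℝ, 0 < r → r ≤ bdryDist Ω x →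
    ENNReal.ofReal (r ^ n) ≤ C * surfaceMeasure Ω (ball ξ r)

lemma surfaceMeasure_apply {Ω s : Set (E n)} (hs : MeasurableSet s) :
    surfaceMeasure Ω s = μHE[n] (frontier Ω ∩ s) := by
  rw [surfaceMeasure, Measure.restrict_apply hs, inter_comm]

lemma ae_mem_frontier (Ω : Set (E n)) : ∀ᵐ ξ ∂(surfaceMeasure Ω), ξ ∈ frontier Ω :=
  ae_restrict_mem isClosed_frontier.measurableSet

/-- The closed unit ball is covered by finitely many balls of radius `1 / 2`; their number is a
dimensional constant. -/
lemma exists_finite_cover_closedBall (n : ℕ) : ∃ T : Finset (E n),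
    closedBall (0 : E n) 1 ⊆ ⋃ t ∈ T, ball t (1 / 2) := by
  obtain ⟨t, -, ht, hcov⟩ := finite_cover_balls_of_compact (isCompact_closedBall (0 : E n) 1)
    (by norm_num : (0 : ℝ) < 1 / 2)
  exact ⟨ht.toFinset, by simpa using hcov⟩

/-- Ahlfors regularity gives the lower bound up to the scale `δ(x)`, which does not exceed the
diameter of the boundary, and the upper bound at all scales, by covering. -/
lemma exists_isRegular {n : ℕ} {C₀ : ℝ} (hC₀ : 0 < C₀) :
    ∃ C : ℝ≥0, ∀ Ω : Set (E n), IsOpen Ω → IsConnected Ω → IsAhlforsRegular C₀ (frontier Ω) →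
      (Bornology.IsBounded Ω ∨ ¬ Bornology.IsBounded (frontier Ω)) → IsRegular C Ω := by
  obtain ⟨T, hT⟩ := exists_finite_cover_closedBall n
  refine ⟨T.card * C₀.toNNReal + C₀.toNNReal, fun Ω hΩ hconn hreg hb => ?_⟩
  have hne : Ω ≠ univ := by
    rintro rfl
    rcases hb with hb | hb
    · exact NormedSpace.unbounded_univ ℝ (E n) hb
    · simp at hb
  obtain ⟨x₀, hx₀⟩ := hconn.nonempty
  have hlow : ∀ x ∈ Ω, ∀ ξ ∈ frontier Ω, ∀ r : ℝ, 0 < r → r ≤ bdryDist Ω x →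
      ENNReal.ofReal (r ^ n) ≤ ENNReal.ofReal C₀ * surfaceMeasure Ω (ball ξ r) := by
    intro x hx ξ hξ r hr hrx
    have h := (hreg ξ hξ r hr ((ENNReal.ofReal_le_ofReal hrx).trans
      (bdryDist_le_ediam_frontier hΩ hb hx))).1
    rw [surfaceMeasure_apply measurableSet_ball]
    calc ENNReal.ofReal (r ^ n) = ENNReal.ofReal C₀ * ENNReal.ofReal (C₀⁻¹ * r ^ n) := by
          rw [← ENNReal.ofReal_mul hC₀.le, mul_inv_cancel_left₀ hC₀.ne']
      _ ≤ _ := by gcongr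
  have hup : ∀ ξ ∈ frontier Ω, ∀ r : ℝ, 0 < r → ENNReal.ofReal r ≤ ediam (frontier Ω) →
      surfaceMeasure Ω (ball ξ r) ≤ ENNReal.ofReal C₀ * ENNReal.ofReal (r ^ n) := by
    intro ξ hξ r hr hrd
    rw [surfaceMeasure_apply measurableSet_ball, ← ENNReal.ofReal_mul hC₀.le]
    exact (hreg ξ hξ r hr hrd).2
  have hle : ENNReal.ofReal C₀ ≤ ((T.card * C₀.toNNReal + C₀.toNNReal : ℝ≥0) : ℝ≥0∞) := by
    push_cast
    exact le_add_self
  refine ⟨hΩ, hne, fun ξ hξ r hr => ?_, fun x hx ξ hξ r hr hrx =>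
    (hlow x hx ξ hξ r hr hrx).trans (by gcongr)⟩
  by_cases hrd : ENNReal.ofReal r ≤ ediam (frontier Ω)
  · exact (hup ξ hξ r hr hrd).trans (by gcongr)
  -- Beyond the diameter `d`, the boundary is covered by boundedly many balls of radius `d / 2`,
  -- each of which lies in a ball of radius `d` centred on the boundary if it meets it.
  push Not at hrd
  have hfin : ediam (frontier Ω) ≠ ∞ := hrd.ne_top
  set d : ℝ := (ediam (frontier Ω)).toReal with hd
  have hdd : ENNReal.ofReal d = ediam (frontier Ω) := ENNReal.ofReal_toReal hfin
  have hdpos : 0 < d := by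
    have h1 := bdryDist_le_ediam_frontier hΩ hb hx₀
    rw [← hdd] at h1
    by_contra h0
    rw [ENNReal.ofReal_of_nonpos (not_lt.1 h0), nonpos_iff_eq_zero, ENNReal.ofReal_eq_zero] at h1
    exact absurd ((bdryDist_pos_iff hΩ hne).2 hx₀) (not_lt.2 h1)
  have hdr : d ≤ r := by
    rw [← hdd] at hrd
    exact ((ENNReal.ofReal_lt_ofReal_iff_of_nonneg hdpos.le).1 hrd).le
  have hcov : frontier Ω ⊆ ⋃ t ∈ T, ball (ξ + d • t) (d / 2) := by
    intro η hη
    have hη' : dist η ξ ≤ d := by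
      have := edist_le_ediam_of_mem hη hξ
      rw [← hdd, edist_dist] at this
      exact (ENNReal.ofReal_le_ofReal_iff hdpos.le).1 this
    have hmem : d⁻¹ • (η - ξ) ∈ closedBall (0 : E n) 1 := by
      rw [mem_closedBall_zero_iff, norm_smul, norm_inv, Real.norm_of_nonneg hdpos.le,
        ← dist_eq_norm, inv_mul_le_iff₀ hdpos, mul_one]
      exact hη'
    obtain ⟨t, ht, htm⟩ := mem_iUnion₂.1 (hT hmem)
    refine mem_iUnion₂.2 ⟨t, ht, ?_⟩
    rw [mem_ball, dist_eq_norm] at htm ⊢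
    have : η - (ξ + d • t) = d • (d⁻¹ • (η - ξ) - t) := by
      rw [smul_sub, smul_inv_smul₀ hdpos.ne']; abel
    rw [this, norm_smul, Real.norm_of_nonneg hdpos.le]
    nlinarith
  have hball : ∀ t ∈ T, surfaceMeasure Ω (ball (ξ + d • t) (d / 2)) ≤
      ENNReal.ofReal C₀ * ENNReal.ofReal (d ^ n) := by
    intro t _
    by_cases hmeet : (frontier Ω ∩ ball (ξ + d • t) (d / 2)).Nonempty
    · obtain ⟨s, hs, hst⟩ := hmeet
      refine (measure_mono ?_).trans (hup s hs d hdpos hdd.le)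
      intro y hy
      rw [mem_ball] at *
      have := dist_triangle_right y s (ξ + d • t)
      linarith
    · rw [surfaceMeasure_apply measurableSet_ball,
        not_nonempty_iff_eq_empty.1 hmeet, measure_empty]
      exact zero_le
  calc surfaceMeasure Ω (ball ξ r) ≤ surfaceMeasure Ω (⋃ t ∈ T, ball (ξ + d • t) (d / 2)) := by
        apply measure_mono_ae
        filter_upwards [ae_mem_frontier Ω] with η hη _ using hcov hη
    _ ≤ ∑ t ∈ T, surfaceMeasure Ω (ball (ξ + d • t) (d / 2)) := measure_biUnion_finset_le _ _
    _ ≤ ∑ t ∈ T, ENNReal.ofReal C₀ * ENNReal.ofReal (d ^ n) := Finset.sum_le_sum hball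
    _ = T.card * (ENNReal.ofReal C₀ * ENNReal.ofReal (d ^ n)) := by simp
    _ ≤ T.card * (ENNReal.ofReal C₀ * ENNReal.ofReal (r ^ n)) := by gcongr
    _ ≤ _ := by
        rw [← mul_assoc]
        gcongr
        push_cast
        exact le_self_add

lemma IsRegular.isLocallyFiniteMeasure {C : ℝ≥0} {Ω : Set (E n)} (h : IsRegular C Ω) :
    IsLocallyFiniteMeasure (surfaceMeasure Ω) := by
  refine ⟨fun x => ⟨ball x 1, ball_mem_nhds x one_pos, ?_⟩⟩
  by_cases hmeet : (frontier Ω ∩ ball x 1).Nonempty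
  · obtain ⟨s, hs, hsx⟩ := hmeet
    refine (measure_mono (t := ball s 2) ?_).trans_lt ((h.upper s hs 2 two_pos).trans_lt
      (ENNReal.mul_lt_top ENNReal.coe_lt_top ENNReal.ofReal_lt_top))
    intro y hy
    rw [mem_ball] at *
    have := dist_triangle_right y s x
    linarith
  · rw [surfaceMeasure_apply measurableSet_ball,
      not_nonempty_iff_eq_empty.1 hmeet, measure_empty]
    exact ENNReal.zero_lt_top

/-! ### Maximal functions of measures -/

/-- The `n`-dimensional maximal function `sup_{r > 0} ν(B(ξ, r)) / rⁿ` of a measure on `ℝⁿ⁺¹`.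
It specializes to the Carleson functional when `ν` is absolutely continuous on `Ω`, and to the
Hardy-Littlewood maximal function when `ν` is absolutely continuous on `∂Ω`. -/
noncomputable def maximal (ν : Measure (E n)) (ξ : E n) : ℝ≥0∞ :=
  ⨆ (r : ℝ) (_ : 0 < r), ν (ball ξ r) / ENNReal.ofReal (r ^ n)

lemma ofReal_pow_ne_zero {r : ℝ} (hr : 0 < r) : ENNReal.ofReal (r ^ n) ≠ 0 := by
  rw [ne_eq, ENNReal.ofReal_eq_zero, not_le]; positivity

lemma measurable_maximal (ν : Measure (E n)) : Measurable (maximal ν) := by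
  apply LowerSemicontinuous.measurable
  refine lowerSemicontinuous_iSup fun r => lowerSemicontinuous_iSup fun hr => ?_
  have h := lowerSemicontinuous_measure_ball ν (ρ := fun _ => r) continuous_const
  intro ξ a ha
  have ha' : a * ENNReal.ofReal (r ^ n) < ν (ball ξ r) :=
    (ENNReal.lt_div_iff_mul_lt (Or.inl (ofReal_pow_ne_zero hr)) (Or.inl ENNReal.ofReal_ne_top)).1 ha
  filter_upwards [h ξ _ ha'] with ζ hζ
  exact (ENNReal.lt_div_iff_mul_lt (Or.inl (ofReal_pow_ne_zero hr))
    (Or.inl ENNReal.ofReal_ne_top)).2 hζ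

lemma measure_ball_le_maximal (ν : Measure (E n)) (ξ : E n) {r : ℝ} (hr : 0 < r) :
    ν (ball ξ r) ≤ ENNReal.ofReal (r ^ n) * maximal ν ξ := by
  rw [mul_comm, ← ENNReal.div_le_iff_le_mul (Or.inl (ofReal_pow_ne_zero hr))
    (Or.inl ENNReal.ofReal_ne_top)]
  exact le_iSup₂ (f := fun (r : ℝ) (_ : 0 < r) => ν (ball ξ r) / ENNReal.ofReal (r ^ n)) r hr

lemma maximal_le {ν : Measure (E n)} {ξ : E n} {K : ℝ≥0∞}
    (h : ∀ r : ℝ, 0 < r → ν (ball ξ r) ≤ ENNReal.ofReal (r ^ n) * K) : maximal ν ξ ≤ K :=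
  iSup₂_le fun r hr => (ENNReal.div_le_iff_le_mul (Or.inl (ofReal_pow_ne_zero hr))
    (Or.inl ENNReal.ofReal_ne_top)).2 (mul_comm K _ ▸ h r hr)

lemma maximal_le_mul_of_measure_ball_le {ν μ : Measure (E n)} {ξ : E n} {K : ℝ≥0∞} {L : ℝ}
    (hL : 0 < L) (h : ∀ r : ℝ, 0 < r → ν (ball ξ r) ≤ K * μ (ball ξ (L * r))) :
    maximal ν ξ ≤ K * ENNReal.ofReal (L ^ n) * maximal μ ξ := by
  refine maximal_le fun r hr => (h r hr).trans ?_
  calc K * μ (ball ξ (L * r)) ≤ K * (ENNReal.ofReal ((L * r) ^ n) * maximal μ ξ) := by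
        gcongr
        exact measure_ball_le_maximal μ ξ (by positivity)
    _ = _ := by
        rw [mul_pow, ENNReal.ofReal_mul (by positivity)]
        ring

lemma exists_ball_of_lt_maximal {ν : Measure (E n)} {ξ : E n} {l : ℝ≥0∞} (h : l < maximal ν ξ) :
    ∃ r : ℝ, 0 < r ∧ l * ENNReal.ofReal (r ^ n) < ν (ball ξ r) := by
  simp only [maximal, lt_iSup_iff] at h
  obtain ⟨r, hr, h⟩ := h
  exact ⟨r, hr, (ENNReal.lt_div_iff_mul_lt (Or.inl (ofReal_pow_ne_zero hr))
    (Or.inl ENNReal.ofReal_ne_top)).1 h⟩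

/-- Vitali covering for balls, in the form in which the selected balls have comparably large
radii. -/
lemma exists_countable_disjoint_closedBall {ι : Type*} (t : Set ι) (x : ι → E n) (r : ι → ℝ)
    (hpos : ∀ a ∈ t, 0 < r a) {R : ℝ} (hR : ∀ a ∈ t, r a ≤ R) :
    ∃ u ⊆ t, u.Countable ∧ u.PairwiseDisjoint (fun a => closedBall (x a) (r a)) ∧
      ∀ a ∈ t, ∃ b ∈ u, dist (x a) (x b) ≤ r a + r b ∧ r a ≤ 2 * r b := by
  obtain ⟨u, hut, hdisj, hcov⟩ := Vitali.exists_disjoint_subfamily_covering_enlargement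
    (fun a => closedBall (x a) (r a)) t r 2 one_lt_two (fun a ha => (hpos a ha).le) R hR
    (fun a ha => ⟨x a, mem_closedBall_self (hpos a ha).le⟩)
  refine ⟨u, hut, ?_, hdisj, fun a ha => ?_⟩
  · refine hdisj.countable_of_nonempty_interior fun a ha => ?_
    exact ⟨x a, ball_subset_interior_closedBall (mem_ball_self (hpos a (hut ha)))⟩
  · obtain ⟨b, hb, ⟨z, hz1, hz2⟩, hab⟩ := hcov a ha
    refine ⟨b, hb, ?_, hab⟩
    have h1 : dist z (x a) ≤ r a := hz1
    have h2 : dist z (x b) ≤ r b := hz2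
    have := dist_triangle_left (x a) (x b) z
    linarith

/-- The weak type `(1, 1)` bound for the maximal function with respect to boundary measure. -/
lemma mul_measure_lt_maximal_le (hn : 1 ≤ n) {C : ℝ≥0} {Ω : Set (E n)} (hΩ : IsRegular C Ω)
    (ν : Measure (E n)) [IsFiniteMeasure ν] {l : ℝ≥0∞} (hl : l ≠ 0) :
    l * surfaceMeasure Ω {ξ | l < maximal ν ξ} ≤ C * ENNReal.ofReal (4 ^ n) * ν univ := by
  rcases eq_or_ne l ∞ with rfl | hl'
  · simp
  set t : Set (E n) := {ξ | ξ ∈ frontier Ω ∧ l < maximal ν ξ} with ht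
  have hex : ∀ ξ : E n, ∃ r : ℝ, ξ ∈ t → 0 < r ∧ l * ENNReal.ofReal (r ^ n) < ν (ball ξ r) := by
    intro ξ
    by_cases hξ : ξ ∈ t
    · obtain ⟨r, hr⟩ := exists_ball_of_lt_maximal hξ.2
      exact ⟨r, fun _ => hr⟩
    · exact ⟨0, fun h => absurd h hξ⟩
  choose r hr using hex
  -- The Vitali selection needs bounded radii: `l rⁿ ≤ ν univ`, and `r ≤ rⁿ` once `r ≥ 1`.
  set M : ℝ := (ν univ / l).toReal with hM
  have hrM : ∀ ξ ∈ t, r ξ ≤ max 1 M := by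
    intro ξ hξ
    have h1 : ENNReal.ofReal (r ξ ^ n) ≤ ν univ / l := by
      rw [ENNReal.le_div_iff_mul_le (Or.inl hl) (Or.inl hl'), mul_comm]
      exact (hr ξ hξ).2.le.trans (measure_mono (subset_univ _))
    have h2 : r ξ ^ n ≤ M := by
      rw [hM, ← ENNReal.ofReal_le_iff_le_toReal (ENNReal.div_ne_top (measure_ne_top _ _) hl)]
      exact h1
    by_cases h3 : r ξ ≤ 1
    · exact h3.trans (le_max_left _ _)
    · exact (le_self_pow₀ (not_le.1 h3).le (by omega)).trans (h2.trans (le_max_right _ _))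
  obtain ⟨u, hut, hcount, hdisj, hcov⟩ := exists_countable_disjoint_closedBall t id r
    (fun ξ hξ => (hr ξ hξ).1) hrM
  have hsub : t ⊆ ⋃ b ∈ u, ball b (4 * r b) := by
    intro a ha
    obtain ⟨b, hb, h1, h2⟩ := hcov a ha
    refine mem_iUnion₂.2 ⟨b, hb, ?_⟩
    have := (hr b (hut hb)).1
    simp only [id, mem_ball] at *
    linarith
  calc l * surfaceMeasure Ω {ξ | l < maximal ν ξ}
      ≤ l * surfaceMeasure Ω (⋃ b ∈ u, ball b (4 * r b)) := by
        gcongr 1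
        apply measure_mono_ae
        filter_upwards [ae_mem_frontier Ω] with ξ hξ h using hsub ⟨hξ, h⟩
    _ ≤ l * ∑' b : u, surfaceMeasure Ω (ball (b : E n) (4 * r b)) := by
        gcongr
        exact measure_biUnion_le _ hcount _
    _ = ∑' b : u, l * surfaceMeasure Ω (ball (b : E n) (4 * r b)) := ENNReal.tsum_mul_left.symm
    _ ≤ ∑' b : u, C * ENNReal.ofReal (4 ^ n) * ν (closedBall (b : E n) (r b)) := by
        refine ENNReal.tsum_le_tsum fun b => ?_
        obtain ⟨h1, h2⟩ := hr b (hut b.2)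
        calc l * surfaceMeasure Ω (ball (b : E n) (4 * r b))
            ≤ l * (C * ENNReal.ofReal ((4 * r b) ^ n)) := by
              gcongr
              exact hΩ.upper b (hut b.2).1 _ (by positivity)
          _ = C * ENNReal.ofReal (4 ^ n) * (l * ENNReal.ofReal (r b ^ n)) := by
              rw [mul_pow, ENNReal.ofReal_mul (by positivity)]; ring
          _ ≤ _ := by
              gcongr
              exact h2.le.trans (measure_mono ball_subset_closedBall)
    _ = C * ENNReal.ofReal (4 ^ n) * ∑' b : u, ν (closedBall (b : E n) (r b)) :=
        ENNReal.tsum_mul_left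
    _ = C * ENNReal.ofReal (4 ^ n) * ν (⋃ b ∈ u, closedBall b (r b)) := by
        have := measure_biUnion (μ := ν) hcount hdisj fun _ _ => measurableSet_closedBall
        simp only [id] at this
        rw [this]
    _ ≤ _ := by
        gcongr
        exact subset_univ _

/-- The layer cake formula for functions with values in `[0, ∞]`. -/
lemma lintegral_rpow_eq_layercake {X : Type*} [MeasurableSpace X] (μ : Measure X)
    {f : X → ℝ≥0∞} (hf : Measurable f) {p : ℝ} (hp : 0 < p) :
    ∫⁻ x, f x ^ p ∂μ = ENNReal.ofReal p *
      ∫⁻ t in Ioi (0 : ℝ), μ {x | ENNReal.ofReal t < f x} * ENNReal.ofReal (t ^ (p - 1)) := by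
  have hsup : ∀ a : ℝ≥0∞, ⨆ k : ℕ, min a k = a := fun a => by
    rw [← inf_iSup_eq, ENNReal.iSup_natCast, inf_top_eq]
  have hmono : ∀ a : ℝ≥0∞, Monotone fun k : ℕ => min a (k : ℝ≥0∞) := fun a k l hkl =>
    min_le_min_left _ (by exact_mod_cast hkl)
  have hsupp : ∀ a : ℝ≥0∞, ⨆ k : ℕ, (min a k) ^ p = a ^ p := fun a => by
    have := (ENNReal.monotone_rpow_of_nonneg hp.le).map_iSup_of_continuousAt
      (f := fun x : ℝ≥0∞ => x ^ p) (g := fun k : ℕ => min a (k : ℝ≥0∞))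
      ENNReal.continuous_rpow_const.continuousAt (by simp [hp])
    rw [← this, hsup]
  have hset : ∀ t : ℝ, {x | ENNReal.ofReal t < f x} =
      ⋃ k : ℕ, {x | ENNReal.ofReal t < min (f x) k} := by
    intro t
    ext x
    simp only [mem_iUnion, mem_ofPred_eq]
    rw [← lt_iSup_iff, hsup]
  have hsetm : ∀ t : ℝ, Monotone fun k : ℕ => {x | ENNReal.ofReal t < min (f x) k} :=
    fun t k l hkl x hx => lt_of_lt_of_le hx (hmono _ hkl)
  have hfin : ∀ k : ℕ, ∫⁻ x, (min (f x) k) ^ p ∂μ = ENNReal.ofReal p * ∫⁻ t in Ioi (0 : ℝ),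
      μ {x | ENNReal.ofReal t < min (f x) k} * ENNReal.ofReal (t ^ (p - 1)) := by
    intro k
    have hne : ∀ x, min (f x) k ≠ ∞ := fun x =>
      ((min_le_right _ _).trans_lt (ENNReal.natCast_lt_top k)).ne
    have := lintegral_rpow_eq_lintegral_meas_lt_mul (μ := μ) (f := fun x => (min (f x) k).toReal)
      (ae_of_all _ fun x => ENNReal.toReal_nonneg)
      (hf.min measurable_const).ennreal_toReal.aemeasurable hp
    convert this using 1
    · refine lintegral_congr fun x => ?_
      rw [← ENNReal.ofReal_rpow_of_nonneg ENNReal.toReal_nonneg hp.le,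
        ENNReal.ofReal_toReal (hne x)]
    · congr 1
      refine setLIntegral_congr_fun measurableSet_Ioi fun t ht => ?_
      congr 2
      ext x
      simp only [mem_ofPred_eq]
      rw [ENNReal.ofReal_lt_iff_lt_toReal (le_of_lt ht) (hne x)]
  have hanti : ∀ k : ℕ, Measurable fun t : ℝ => μ {x | ENNReal.ofReal t < min (f x) k} :=
    fun k => Antitone.measurable fun s t hst => measure_mono fun x hx =>
      (ENNReal.ofReal_le_ofReal hst).trans_lt hx
  calc ∫⁻ x, f x ^ p ∂μ = ∫⁻ x, ⨆ k : ℕ, (min (f x) k) ^ p ∂μ := by simp_rw [hsupp]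
    _ = ⨆ k : ℕ, ∫⁻ x, (min (f x) k) ^ p ∂μ := by
        refine lintegral_iSup (fun k => (hf.min measurable_const).pow_const p) fun k l hkl x => ?_
        exact ENNReal.rpow_le_rpow (hmono _ hkl) hp.le
    _ = ENNReal.ofReal p * ⨆ k : ℕ, ∫⁻ t in Ioi (0 : ℝ),
          μ {x | ENNReal.ofReal t < min (f x) k} * ENNReal.ofReal (t ^ (p - 1)) := by
        simp_rw [hfin, ENNReal.mul_iSup]
    _ = _ := by
        rw [← lintegral_iSup]
        · congr 1
          refine lintegral_congr fun t => ?_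
          rw [← ENNReal.iSup_mul, hset, (hsetm t).measure_iUnion]
        · exact fun k => (hanti k).mul (by fun_prop)
        · intro k l hkl t
          dsimp only
          gcongr

/-- The layer cake formula for the integral of a function with values in `[0, ∞]`. -/
lemma lintegral_eq_layercake {X : Type*} [MeasurableSpace X] (μ : Measure X)
    {f : X → ℝ≥0∞} (hf : Measurable f) :
    ∫⁻ x, f x ∂μ = ∫⁻ t in Ioi (0 : ℝ), μ {x | ENNReal.ofReal t < f x} := by
  have := lintegral_rpow_eq_layercake μ hf one_pos
  simpa using this

/-- The Hardy-Littlewood maximal theorem on the boundary. -/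
theorem exists_bdryNorm_maximal_le (hn : 1 ≤ n) (C : ℝ≥0) {p : ℝ} (hp : 1 < p) :
    ∃ A : ℝ≥0, ∀ Ω : Set (E n), IsRegular C Ω → ∀ g : E n → ℝ≥0∞, Measurable g →
      bdryNorm p Ω (maximal ((surfaceMeasure Ω).withDensity g)) ≤ A * bdryNorm p Ω g := by
  have hp0 : 0 < p := by linarith
  set K : ℝ≥0 := C * (4 ^ n) + 1 with hK
  set B : ℝ≥0 := p.toNNReal * K / (p - 1).toNNReal with hB
  refine ⟨(C + 1) * B ^ (1 / p), fun Ω hΩ g hg => ?_⟩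
  set σ := surfaceMeasure Ω with hσ
  set Mg := maximal (σ.withDensity g) with hMg
  have hMgm : Measurable Mg := measurable_maximal _
  have hlev : ∀ t : ℝ, MeasurableSet {x | ENNReal.ofReal t < g x} := fun t =>
    measurableSet_lt measurable_const hg
  -- At height `t` only the part of `g` above `t` matters: the rest has maximal function at most
  -- `C t`, which the division by `C + 1` absorbs.
  have hweak : ∀ t : ℝ, 0 < t → ENNReal.ofReal t * σ {x | ENNReal.ofReal t < Mg x / (C + 1)} ≤
      K * σ.withDensity g {x | ENNReal.ofReal t < g x} := by
    intro t ht
    have htne : ENNReal.ofReal t ≠ 0 := (ENNReal.ofReal_pos.2 ht).ne'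
    set ν : Measure (E n) := (σ.withDensity g).restrict {x | ENNReal.ofReal t < g x} with hν
    -- The weak type bound requires a finite measure; otherwise the right-hand side is infinite.
    rcases eq_or_ne (ν univ) ∞ with hinf | hfin
    · rw [hν, Measure.restrict_apply_univ] at hinf
      rw [hinf, ENNReal.mul_top (by rw [hK]; simp)]
      exact le_top
    have : IsFiniteMeasure ν := ⟨lt_top_iff_ne_top.2 hfin⟩
    have hsub : ∀ ξ ∈ frontier Ω, ENNReal.ofReal t < Mg ξ / (C + 1) →
        ENNReal.ofReal t < maximal ν ξ := by
      intro ξ hξ h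
      by_contra hcon
      push Not at hcon
      refine h.not_ge ?_
      rw [ENNReal.div_le_iff_le_mul (Or.inl (by simp)) (Or.inl (by finiteness))]
      refine maximal_le fun r hr => ?_
      calc σ.withDensity g (ball ξ r)
          ≤ σ.withDensity g (ball ξ r ∩ {x | ENNReal.ofReal t < g x}) +
              σ.withDensity g (ball ξ r ∩ {x | ENNReal.ofReal t < g x}ᶜ) := by
            rw [← sdiff_eq, measure_inter_add_sdiff _ (hlev t)]
        _ ≤ ENNReal.ofReal (r ^ n) * ENNReal.ofReal t +
              ENNReal.ofReal t * (C * ENNReal.ofReal (r ^ n)) := by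
            gcongr
            · rw [← Measure.restrict_apply measurableSet_ball]
              refine (measure_ball_le_maximal ν ξ hr).trans ?_
              gcongr
            · rw [withDensity_apply _ (measurableSet_ball.inter (hlev t).compl)]
              calc ∫⁻ x in ball ξ r ∩ {x | ENNReal.ofReal t < g x}ᶜ, g x ∂σ
                  ≤ ∫⁻ x in ball ξ r ∩ {x | ENNReal.ofReal t < g x}ᶜ, ENNReal.ofReal t ∂σ :=
                    setLIntegral_mono measurable_const fun x hx => not_lt.1 hx.2
                _ = ENNReal.ofReal t * σ (ball ξ r ∩ {x | ENNReal.ofReal t < g x}ᶜ) := by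
                    rw [setLIntegral_const]
                _ ≤ ENNReal.ofReal t * (C * ENNReal.ofReal (r ^ n)) := by
                    gcongr
                    exact (measure_mono inter_subset_left).trans (hΩ.upper ξ hξ r hr)
        _ = _ := by ring
    calc ENNReal.ofReal t * σ {x | ENNReal.ofReal t < Mg x / (C + 1)}
        ≤ ENNReal.ofReal t * σ {x | ENNReal.ofReal t < maximal ν x} := by
          gcongr 1
          apply measure_mono_ae
          filter_upwards [ae_mem_frontier Ω] with ξ hξ h using hsub ξ hξ h
      _ ≤ C * ENNReal.ofReal (4 ^ n) * ν univ := mul_measure_lt_maximal_le hn hΩ ν htne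
      _ ≤ _ := by
          rw [hν, Measure.restrict_apply_univ]
          gcongr
          rw [hK, ENNReal.ofReal_pow (by norm_num)]
          push_cast
          simp
  have hp1 : ENNReal.ofReal (p - 1) ≠ 0 := by simp [hp]
  have hmain : ∫⁻ x, (Mg x / (C + 1)) ^ p ∂σ ≤ B * ∫⁻ x, g x ^ p ∂σ := by
    calc ∫⁻ x, (Mg x / (C + 1)) ^ p ∂σ
        = ENNReal.ofReal p * ∫⁻ t in Ioi (0 : ℝ),
            σ {x | ENNReal.ofReal t < Mg x / (C + 1)} * ENNReal.ofReal (t ^ (p - 1)) :=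
          lintegral_rpow_eq_layercake σ (hMgm.div_const _) hp0
      _ ≤ ENNReal.ofReal p * ∫⁻ t in Ioi (0 : ℝ), K *
            (σ.withDensity g {x | ENNReal.ofReal t < g x} *
              ENNReal.ofReal (t ^ (p - 1 - 1))) := by
          gcongr ENNReal.ofReal p * ?_
          refine lintegral_mono_ae ((ae_restrict_iff' measurableSet_Ioi).2
            (ae_of_all _ fun t ht => ?_))
          rw [Real.rpow_sub_one (ne_of_gt ht) (p - 1), ENNReal.ofReal_div_of_pos ht, ← mul_assoc]
          have htne : ENNReal.ofReal t ≠ 0 := (ENNReal.ofReal_pos.2 ht).ne'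
          rw [← mul_div_assoc, ENNReal.le_div_iff_mul_le (Or.inl htne)
            (Or.inl ENNReal.ofReal_ne_top), mul_right_comm,
            mul_comm (σ {x | ENNReal.ofReal t < Mg x / (C + 1)})]
          exact mul_le_mul_left (hweak t ht) _
      _ = ENNReal.ofReal p * K * ∫⁻ t in Ioi (0 : ℝ),
            (σ.withDensity g {x | ENNReal.ofReal t < g x} *
              ENNReal.ofReal (t ^ (p - 1 - 1))) := by
          rw [lintegral_const_mul' _ _ ENNReal.coe_ne_top, mul_assoc]
      _ = ENNReal.ofReal p * K / ENNReal.ofReal (p - 1) *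
            ∫⁻ x, g x ^ (p - 1) ∂(σ.withDensity g) := by
          rw [lintegral_rpow_eq_layercake (σ.withDensity g) hg (by linarith : 0 < p - 1),
            ← mul_assoc, ENNReal.div_mul_cancel hp1 ENNReal.ofReal_ne_top]
      _ = B * ∫⁻ x, g x ^ p ∂σ := by
          rw [lintegral_withDensity_eq_lintegral_mul σ hg (hg.pow_const _)]
          congr 1
          · rw [hB, ENNReal.coe_div (by simpa using hp), ENNReal.coe_mul]
            rfl
          · refine lintegral_congr fun x => ?_
            rw [Pi.mul_apply]
            nth_rewrite 1 [← ENNReal.rpow_one (g x)]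
            rw [← ENNReal.rpow_add_of_nonneg _ _ zero_le_one (by linarith)]
            congr 1
            ring
  have hrew : ∀ x, Mg x = (C + 1 : ℝ≥0) * (Mg x / (C + 1)) := fun x => by
    push_cast
    rw [ENNReal.mul_div_cancel (by simp) (by finiteness)]
  calc bdryNorm p Ω Mg = (∫⁻ x, ((C + 1 : ℝ≥0) * (Mg x / (C + 1))) ^ p ∂σ) ^ (1 / p) := by
        unfold bdryNorm
        simp_rw [← hrew]
        rfl
    _ = (C + 1 : ℝ≥0) * (∫⁻ x, (Mg x / (C + 1)) ^ p ∂σ) ^ (1 / p) := by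
        simp_rw [ENNReal.mul_rpow_of_nonneg _ _ hp0.le]
        rw [lintegral_const_mul' _ _ (by finiteness),
          ENNReal.mul_rpow_of_nonneg _ _ (by positivity),
          ← ENNReal.rpow_mul, mul_one_div_cancel hp0.ne', ENNReal.rpow_one]
    _ ≤ (C + 1 : ℝ≥0) * (B * ∫⁻ x, g x ^ p ∂σ) ^ (1 / p) := by gcongr
    _ = _ := by
        rw [ENNReal.mul_rpow_of_nonneg _ _ (by positivity), bdryNorm, ENNReal.coe_mul,
          ENNReal.coe_rpow_of_nonneg _ (by positivity), mul_assoc]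

lemma bdryNorm_le_mul {p : ℝ} (hp : 1 < p) (Ω : Set (E n)) (K : ℝ≥0) {f g : E n → ℝ≥0∞}
    (h : ∀ ξ ∈ frontier Ω, f ξ ≤ K * g ξ) : bdryNorm p Ω f ≤ K * bdryNorm p Ω g := by
  have hp0 : 0 < p := by linarith
  calc bdryNorm p Ω f ≤ (∫⁻ ξ, (K * g ξ) ^ p ∂(surfaceMeasure Ω)) ^ (1 / p) := by
        unfold bdryNorm
        gcongr ?_ ^ (1 / p)
        apply lintegral_mono_ae
        filter_upwards [ae_mem_frontier Ω] with ξ hξ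
        gcongr
        exact h ξ hξ
    _ = K * bdryNorm p Ω g := by
        simp_rw [ENNReal.mul_rpow_of_nonneg _ _ hp0.le]
        rw [lintegral_const_mul' _ _ (by finiteness),
          ENNReal.mul_rpow_of_nonneg _ _ (by positivity),
          ← ENNReal.rpow_mul, mul_one_div_cancel hp0.ne', ENNReal.rpow_one, bdryNorm]

/-! ### The Carleson embedding -/

/-- The nontangential supremum of a function on `Ω`. -/
noncomputable def ntSup (α : ℝ) (Ω : Set (E n)) (w : E n → ℝ≥0∞) (ξ : E n) : ℝ≥0∞ :=
  ⨆ x ∈ cone α Ω ξ, w x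

/-- A nontangential supremum is lower semicontinuous on the boundary, for any function. -/
lemma measurable_ntSup (α : ℝ) (Ω : Set (E n)) (w : E n → ℝ≥0∞) :
    Measurable (ntSup α Ω w) := by
  apply LowerSemicontinuous.measurable
  intro ξ a ha
  simp only [ntSup, lt_iSup_iff] at ha
  obtain ⟨x, hx, hax⟩ := ha
  have : ∀ᶠ ζ in nhds ξ, dist x ζ < (1 + α) * bdryDist Ω x :=
    (continuous_const.dist continuous_id).continuousAt.eventually_lt continuousAt_const hx.2
  filter_upwards [this] with ζ hζ
  simp only [ntSup, lt_iSup_iff]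
  exact ⟨x, ⟨hx.1, hζ⟩, hax⟩

lemma le_ntSup {α : ℝ} {Ω : Set (E n)} {w : E n → ℝ≥0∞} {x ξ : E n} (h : x ∈ cone α Ω ξ) :
    w x ≤ ntSup α Ω w ξ := le_iSup₂ (f := fun x (_ : x ∈ cone α Ω ξ) => w x) x h

/-- The mass of a superlevel set of `w` is controlled by the maximal function over the
corresponding superlevel set of the nontangential supremum: a Vitali selection among the boundary
balls below the points of the set replaces a Whitney decomposition. -/
lemma measure_superlevel_le {C : ℝ≥0} {α : ℝ} (hα : 0 < α) {Ω : Set (E n)} (hΩ : IsRegular C Ω)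
    {ν : Measure (E n)} (hν : ν Ωᶜ = 0) (w : E n → ℝ≥0∞) (l : ℝ≥0∞) :
    ν {x | l < w x} ≤ C * ENNReal.ofReal ((6 / (min α 1 / 2)) ^ n) *
      (surfaceMeasure Ω).withDensity (maximal ν) {ξ | l < ntSup α Ω w ξ} := by
  -- With `a < α`, the point `b` lies in the cone over every boundary point within `a δ(b)` of the
  -- boundary point `f b` nearest to `b`; with `a ≤ 1`, the lower bound applies to such balls.
  set a : ℝ := min α 1 / 2 with ha
  have ha0 : 0 < a := by positivity
  have ha1 : a ≤ 1 / 2 := by have := min_le_right α 1; linarith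
  have haα : a < α := by have := min_le_left α 1; linarith
  set σ := surfaceMeasure Ω with hσ
  set K : ℝ≥0∞ := C * ENNReal.ofReal ((6 / a) ^ n) with hK
  have hex : ∀ x : E n, ∃ ξ : E n, x ∈ Ω → ξ ∈ frontier Ω ∧ dist x ξ = bdryDist Ω x := by
    intro x
    by_cases hx : x ∈ Ω
    · obtain ⟨ξ, h⟩ := exists_mem_frontier_dist_eq hΩ.isOpen hΩ.ne_univ hx
      exact ⟨ξ, fun _ => h⟩
    · exact ⟨0, fun h => absurd h hx⟩
  choose f hf using hex
  have hδ : ∀ x ∈ Ω, 0 < bdryDist Ω x := fun x hx =>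
    (bdryDist_pos_iff hΩ.isOpen hΩ.ne_univ).2 hx
  -- Radii are bounded only on the part of the superlevel set where `δ < R`.
  have key : ∀ R : ℕ, ν {x | x ∈ Ω ∧ l < w x ∧ bdryDist Ω x < R} ≤
      K * σ.withDensity (maximal ν) {ξ | l < ntSup α Ω w ξ} := by
    intro R
    set t : Set (E n) := {x | x ∈ Ω ∧ l < w x ∧ bdryDist Ω x < R} with ht
    obtain ⟨u, hut, hcount, hdisj, hcov⟩ := exists_countable_disjoint_closedBall t f
      (fun x => a * bdryDist Ω x) (fun x hx => mul_pos ha0 (hδ x hx.1)) (R := R)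
      (fun x hx => by have := hδ x hx.1; have := hx.2.2; nlinarith)
    have hsub : t ⊆ ⋃ b ∈ u, ball (f b) (5 * bdryDist Ω b) := by
      intro x hx
      obtain ⟨b, hb, h1, h2⟩ := hcov x hx
      refine mem_iUnion₂.2 ⟨b, hb, ?_⟩
      have h3 := (hf x hx.1).2
      have h4 := hδ b (hut hb).1
      have h5 : bdryDist Ω x ≤ 2 * bdryDist Ω b := by
        have : a * bdryDist Ω x ≤ a * (2 * bdryDist Ω b) := by linarith
        exact le_of_mul_le_mul_left this ha0
      have h6 := dist_triangle x (f x) (f b)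
      rw [mem_ball]
      have := hδ x hx.1
      nlinarith
    -- The enlarged ball is seen by the maximal function at every point of the selected ball.
    have hball : ∀ b ∈ u, ν (ball (f b) (5 * bdryDist Ω b)) ≤
        K * σ.withDensity (maximal ν) (closedBall (f b) (a * bdryDist Ω b)) := by
      intro b hb
      have hb0 := hδ b (hut hb).1
      have hlow := hΩ.lower b (hut hb).1 (f b) (hf b (hut hb).1).1 (a * bdryDist Ω b)
        (by positivity) (by nlinarith)
      have hmax : ∀ ζ ∈ closedBall (f b) (a * bdryDist Ω b), ν (ball (f b) (5 * bdryDist Ω b)) ≤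
          ENNReal.ofReal ((6 * bdryDist Ω b) ^ n) * maximal ν ζ := by
        intro ζ hζ
        refine (measure_mono (ball_subset_ball' ?_)).trans
          (measure_ball_le_maximal ν ζ (by positivity))
        rw [mem_closedBall, dist_comm] at hζ
        nlinarith
      have hint : ν (ball (f b) (5 * bdryDist Ω b)) *
          σ (closedBall (f b) (a * bdryDist Ω b)) ≤ ENNReal.ofReal ((6 * bdryDist Ω b) ^ n) *
          σ.withDensity (maximal ν) (closedBall (f b) (a * bdryDist Ω b)) := by
        rw [withDensity_apply _ measurableSet_closedBall, ← setLIntegral_const,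
          ← lintegral_const_mul _ (measurable_maximal ν)]
        exact setLIntegral_mono ((measurable_maximal ν).const_mul _) hmax
      have hne := ofReal_pow_ne_zero (n := n) (mul_pos ha0 hb0)
      rw [← ENNReal.mul_le_mul_iff_right hne ENNReal.ofReal_ne_top]
      calc ENNReal.ofReal ((a * bdryDist Ω b) ^ n) * ν (ball (f b) (5 * bdryDist Ω b))
          ≤ C * σ (closedBall (f b) (a * bdryDist Ω b)) *
              ν (ball (f b) (5 * bdryDist Ω b)) := by
            gcongr
            exact hlow.trans (by gcongr; exact ball_subset_closedBall)
        _ = C * (ν (ball (f b) (5 * bdryDist Ω b)) *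
              σ (closedBall (f b) (a * bdryDist Ω b))) := by ring
        _ ≤ C * (ENNReal.ofReal ((6 * bdryDist Ω b) ^ n) *
              σ.withDensity (maximal ν) (closedBall (f b) (a * bdryDist Ω b))) := by gcongr
        _ = _ := by
            have : (6 * bdryDist Ω b) ^ n = (a * bdryDist Ω b) ^ n * (6 / a) ^ n := by
              rw [← mul_pow]; congr 1; field_simp
            rw [this, ENNReal.ofReal_mul (by positivity), hK]
            ring
    have hlev : ∀ b ∈ u, ∀ ξ ∈ closedBall (f b) (a * bdryDist Ω b), l < ntSup α Ω w ξ := by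
      intro b hb ξ hξ
      refine (hut hb).2.1.trans_le (le_ntSup ⟨(hut hb).1, ?_⟩)
      have h1 := (hf b (hut hb).1).2
      have h2 := dist_triangle_right b ξ (f b)
      have h3 := hδ b (hut hb).1
      rw [mem_closedBall] at hξ
      nlinarith
    calc ν t ≤ ν (⋃ b ∈ u, ball (f b) (5 * bdryDist Ω b)) := measure_mono hsub
      _ ≤ ∑' b : u, ν (ball (f b) (5 * bdryDist Ω b)) := measure_biUnion_le _ hcount _
      _ ≤ ∑' b : u, K * σ.withDensity (maximal ν) (closedBall (f b) (a * bdryDist Ω b)) :=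
          ENNReal.tsum_le_tsum fun b => hball b b.2
      _ = K * ∑' b : u, σ.withDensity (maximal ν) (closedBall (f b) (a * bdryDist Ω b)) :=
          ENNReal.tsum_mul_left
      _ = K * σ.withDensity (maximal ν) (⋃ b ∈ u, closedBall (f b) (a * bdryDist Ω b)) := by
          rw [measure_biUnion hcount hdisj fun _ _ => measurableSet_closedBall]
      _ ≤ _ := by
          gcongr
          exact iUnion₂_subset fun b hb ξ hξ => hlev b hb ξ hξ
  have hmono : Monotone fun R : ℕ => {x | x ∈ Ω ∧ l < w x ∧ bdryDist Ω x < R} :=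
    fun R R' hRR x hx => ⟨hx.1, hx.2.1, hx.2.2.trans_le (by exact_mod_cast hRR)⟩
  calc ν {x | l < w x} ≤ ν (⋃ R : ℕ, {x | x ∈ Ω ∧ l < w x ∧ bdryDist Ω x < R}) := by
        apply measure_mono_ae
        filter_upwards [compl_mem_ae_iff.2 hν] with x hx hlx
        rw [compl_compl] at hx
        obtain ⟨R, hR⟩ := exists_nat_gt (bdryDist Ω x)
        exact mem_iUnion.2 ⟨R, hx, hlx, hR⟩
    _ = ⨆ R : ℕ, ν {x | x ∈ Ω ∧ l < w x ∧ bdryDist Ω x < R} := hmono.measure_iUnion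
    _ ≤ _ := iSup_le key

/-- The Carleson embedding: `∫ w dν ≲ ∫_{∂Ω} N(w) M(ν) dσ`. -/
theorem exists_lintegral_le_ntSup_mul_maximal (C : ℝ≥0) {α : ℝ} (hα : 0 < α) :
    ∃ A : ℝ≥0, ∀ Ω : Set (E n), IsRegular C Ω → ∀ ν : Measure (E n), ν Ωᶜ = 0 →
      ∀ w : E n → ℝ≥0∞, Measurable w →
        ∫⁻ x, w x ∂ν ≤ A * ∫⁻ ξ, ntSup α Ω w ξ * maximal ν ξ ∂(surfaceMeasure Ω) := by
  refine ⟨C * ((6 / (min α 1 / 2)) ^ n).toNNReal, fun Ω hΩ ν hν w hw => ?_⟩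
  have hNm := measurable_ntSup α Ω w
  calc ∫⁻ x, w x ∂ν = ∫⁻ t in Ioi (0 : ℝ), ν {x | ENNReal.ofReal t < w x} :=
        lintegral_eq_layercake ν hw
    _ ≤ ∫⁻ t in Ioi (0 : ℝ), (C * ((6 / (min α 1 / 2)) ^ n).toNNReal : ℝ≥0) *
          (surfaceMeasure Ω).withDensity (maximal ν) {ξ | ENNReal.ofReal t < ntSup α Ω w ξ} := by
        refine lintegral_mono fun t => ?_
        rw [ENNReal.coe_mul]
        exact measure_superlevel_le hα hΩ hν w _
    _ = (C * ((6 / (min α 1 / 2)) ^ n).toNNReal : ℝ≥0) *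
          ∫⁻ ξ, ntSup α Ω w ξ ∂((surfaceMeasure Ω).withDensity (maximal ν)) := by
        rw [lintegral_const_mul' _ _ ENNReal.coe_ne_top, ← lintegral_eq_layercake _ hNm]
    _ = _ := by
        rw [lintegral_withDensity_eq_lintegral_mul _ (measurable_maximal ν) hNm]
        simp_rw [Pi.mul_apply, mul_comm]

/-! ### The area functional -/

/-- The area functional `ξ ↦ ∫_{γ(ξ)} h δ⁻ⁿ dm`. -/
noncomputable def area (α : ℝ) (Ω : Set (E n)) (h : E n → ℝ≥0∞) (ξ : E n) : ℝ≥0∞ :=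
  ∫⁻ x in cone α Ω ξ, h x / ENNReal.ofReal (bdryDist Ω x ^ n)

/-- The averages `δ(x)⁻ⁿ ∫_{B(x, (1 + α) δ(x))} g dσ` over boundary balls; the adjoint of the area
functional. -/
noncomputable def bdryAvg (α : ℝ) (Ω : Set (E n)) (g : E n → ℝ≥0∞) (x : E n) : ℝ≥0∞ :=
  (surfaceMeasure Ω).withDensity g (ball x ((1 + α) * bdryDist Ω x)) /
    ENNReal.ofReal (bdryDist Ω x ^ n)

lemma measurable_bdryDist_pow (Ω : Set (E n)) :
    Measurable fun x => ENNReal.ofReal (bdryDist Ω x ^ n) :=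
  ((continuous_bdryDist Ω).pow n).measurable.ennreal_ofReal

lemma measurable_bdryAvg (α : ℝ) (Ω : Set (E n)) (g : E n → ℝ≥0∞) :
    Measurable (bdryAvg α Ω g) :=
  (lowerSemicontinuous_measure_ball ((surfaceMeasure Ω).withDensity g)
    (continuous_const.mul (continuous_bdryDist Ω))).measurable.div (measurable_bdryDist_pow Ω)

lemma measurableSet_cone_prod {Ω : Set (E n)} (hΩ : IsOpen Ω) (α : ℝ) :
    MeasurableSet {z : E n × E n | z.2 ∈ cone α Ω z.1} := by
  have h1 : IsOpen {z : E n × E n | z.2 ∈ Ω} := hΩ.preimage continuous_snd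
  have h2 : IsOpen {z : E n × E n | dist z.2 z.1 < (1 + α) * bdryDist Ω z.2} :=
    isOpen_lt (continuous_snd.dist continuous_fst)
      (continuous_const.mul ((continuous_bdryDist Ω).comp continuous_snd))
  exact (h1.inter h2).measurableSet

lemma measurableSet_cone {Ω : Set (E n)} (hΩ : IsOpen Ω) (α : ℝ) (ξ : E n) :
    MeasurableSet (cone α Ω ξ) :=
  (measurableSet_cone_prod hΩ α).preimage (measurable_const.prodMk measurable_id)

lemma area_eq_lintegral_indicator {Ω : Set (E n)} (hΩ : IsOpen Ω) (α : ℝ) (h : E n → ℝ≥0∞)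
    (ξ : E n) : area α Ω h ξ = ∫⁻ x, ({z : E n × E n | z.2 ∈ cone α Ω z.1}).indicator
      (fun z => h z.2 / ENNReal.ofReal (bdryDist Ω z.2 ^ n)) (ξ, x) := by
  rw [area, ← lintegral_indicator (measurableSet_cone hΩ α ξ)]
  rfl

lemma measurable_area {Ω : Set (E n)} (hΩ : IsOpen Ω) (α : ℝ) {h : E n → ℝ≥0∞}
    (hh : Measurable h) : Measurable (area α Ω h) := by
  rw [funext (area_eq_lintegral_indicator hΩ α h)]
  refine Measurable.lintegral_prod_right' (Measurable.indicator ?_ (measurableSet_cone_prod hΩ α))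
  exact (hh.comp measurable_snd).div ((measurable_bdryDist_pow Ω).comp measurable_snd)

lemma area_mono {α : ℝ} {Ω : Set (E n)} {h h' : E n → ℝ≥0∞} (hh : ∀ x ∈ Ω, h x ≤ h' x)
    (hΩ : IsOpen Ω) (ξ : E n) : area α Ω h ξ ≤ area α Ω h' ξ := by
  unfold area
  refine setLIntegral_mono_ae' (measurableSet_cone hΩ α ξ) (ae_of_all _ fun x hx => ?_)
  gcongr
  exact hh x hx.1

/-- The area functional and the boundary averages are adjoint to each other. -/
lemma lintegral_area_mul {C : ℝ≥0} {Ω : Set (E n)} (hΩ : IsRegular C Ω) (α : ℝ)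
    {h g : E n → ℝ≥0∞} (hh : Measurable h) (hg : Measurable g) :
    ∫⁻ ξ, area α Ω h ξ * g ξ ∂(surfaceMeasure Ω) = ∫⁻ x in Ω, h x * bdryAvg α Ω g x := by
  have := hΩ.isLocallyFiniteMeasure
  -- `F` is the integrand of the area functional cut off to the cone, to which Tonelli applies.
  obtain ⟨F, hFm, hF, hF1, hF0⟩ : ∃ F : E n → E n → ℝ≥0∞, Measurable (Function.uncurry F) ∧
      (∀ ξ, area α Ω h ξ = ∫⁻ x, F ξ x) ∧
      (∀ ξ x, x ∈ cone α Ω ξ → F ξ x = h x / ENNReal.ofReal (bdryDist Ω x ^ n)) ∧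
      (∀ ξ x, x ∉ cone α Ω ξ → F ξ x = 0) :=
    ⟨fun ξ x => ({z : E n × E n | z.2 ∈ cone α Ω z.1}).indicator
      (fun z => h z.2 / ENNReal.ofReal (bdryDist Ω z.2 ^ n)) (ξ, x),
      Measurable.indicator ((hh.comp measurable_snd).div
        ((measurable_bdryDist_pow Ω).comp measurable_snd)) (measurableSet_cone_prod hΩ.isOpen α),
      area_eq_lintegral_indicator hΩ.isOpen α h,
      fun ξ x hx => indicator_of_mem (a := (ξ, x)) hx _,
      fun ξ x hx => indicator_of_notMem (a := (ξ, x)) hx _⟩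
  have hFξ : ∀ ξ, Measurable (F ξ) := fun ξ => hFm.comp (measurable_const.prodMk measurable_id)
  calc ∫⁻ ξ, area α Ω h ξ * g ξ ∂(surfaceMeasure Ω)
      = ∫⁻ ξ, (∫⁻ x, F ξ x * g ξ) ∂(surfaceMeasure Ω) := by
        refine lintegral_congr fun ξ => ?_
        rw [hF, lintegral_mul_const _ (hFξ ξ)]
    _ = ∫⁻ x, ∫⁻ ξ, F ξ x * g ξ ∂(surfaceMeasure Ω) :=
        lintegral_lintegral_swap (hFm.mul (hg.comp measurable_fst)).aemeasurable
    _ = ∫⁻ x, Ω.indicator (fun x => h x * bdryAvg α Ω g x) x := by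
        refine lintegral_congr fun x => ?_
        by_cases hx : x ∈ Ω
        · rw [indicator_of_mem hx, bdryAvg, withDensity_apply _ measurableSet_ball,
            mul_div_assoc', mul_comm, mul_div_assoc, ← lintegral_mul_const _ hg,
            ← lintegral_indicator measurableSet_ball]
          refine lintegral_congr fun ξ => ?_
          by_cases hξ : dist x ξ < (1 + α) * bdryDist Ω x
          · rw [indicator_of_mem (by rwa [mem_ball, dist_comm]), hF1 ξ x ⟨hx, hξ⟩, mul_comm]
          · rw [indicator_of_notMem (by rwa [mem_ball, dist_comm]), hF0 ξ x fun h => hξ h.2,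
              zero_mul]
        · rw [indicator_of_notMem hx]
          simp [hF0 _ x fun h => hx h.1]
    _ = _ := lintegral_indicator hΩ.isOpen.measurableSet _

/-- The boundary ball below a point of `Ω` carries a fixed proportion of `δ(x)ⁿ`, also inside any
ball centred on the boundary that is somewhat larger than one containing the point. -/
lemma one_le_bdryAvg_indicator {C : ℝ≥0} {α : ℝ} (hα : 0 < α) {Ω : Set (E n)}
    (hΩ : IsRegular C Ω) {ξ x : E n} (hξ : ξ ∈ frontier Ω) (hx : x ∈ Ω) {r : ℝ}
    (hxr : dist x ξ < r) :
    1 ≤ C * ENNReal.ofReal ((1 / min α 1) ^ n) *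
      bdryAvg α Ω ((ball ξ (3 * r)).indicator 1) x := by
  have hδ := (bdryDist_pos_iff hΩ.isOpen hΩ.ne_univ).2 hx
  obtain ⟨η, hη, hxη⟩ := exists_mem_frontier_dist_eq hΩ.isOpen hΩ.ne_univ hx
  have hδr := (bdryDist_le_dist_of_mem_frontier hΩ.isOpen (x := x) hξ).trans_lt hxr
  set a : ℝ := min α 1 with ha
  have ha0 : 0 < a := by positivity
  have ha1 : a ≤ 1 := min_le_right _ _
  have haα : a ≤ α := min_le_left _ _
  have hlow := hΩ.lower x hx η hη (a * bdryDist Ω x) (by positivity) (by nlinarith)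
  have hsub : ball η (a * bdryDist Ω x) ⊆ ball ξ (3 * r) ∩ ball x ((1 + α) * bdryDist Ω x) := by
    intro z hz
    rw [mem_ball] at hz
    have h1 := dist_triangle_right z x η
    have h2 := dist_triangle z x ξ
    have h3 : a * bdryDist Ω x ≤ bdryDist Ω x := by nlinarith
    have h4 : a * bdryDist Ω x ≤ α * bdryDist Ω x := by gcongr
    constructor <;> rw [mem_ball] <;> linarith
  have hδn := ofReal_pow_ne_zero (n := n) hδ
  have hmeas : (surfaceMeasure Ω).withDensity ((ball ξ (3 * r)).indicator 1)
      (ball x ((1 + α) * bdryDist Ω x)) =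
      surfaceMeasure Ω (ball ξ (3 * r) ∩ ball x ((1 + α) * bdryDist Ω x)) := by
    rw [withDensity_indicator_one measurableSet_ball, Measure.restrict_apply measurableSet_ball,
      inter_comm]
  rw [bdryAvg, hmeas, ← mul_div_assoc, ENNReal.le_div_iff_mul_le (Or.inl hδn)
    (Or.inl ENNReal.ofReal_ne_top), one_mul]
  calc ENNReal.ofReal (bdryDist Ω x ^ n)
      = ENNReal.ofReal ((1 / a) ^ n) * ENNReal.ofReal ((a * bdryDist Ω x) ^ n) := by
        rw [← ENNReal.ofReal_mul (by positivity), ← mul_pow]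
        congr 2
        field_simp
    _ ≤ ENNReal.ofReal ((1 / a) ^ n) * (C * surfaceMeasure Ω (ball η (a * bdryDist Ω x))) := by
        gcongr
    _ ≤ ENNReal.ofReal ((1 / a) ^ n) * (C * surfaceMeasure Ω
          (ball ξ (3 * r) ∩ ball x ((1 + α) * bdryDist Ω x))) := by gcongr
    _ = _ := by ring

/-- The area functional dominates the Carleson functional in `L^p`: by duality with the boundary
averages, the mass of `h` in a ball centred on the boundary is controlled by the integral of the
area functional over a larger boundary ball, so that the maximal theorem applies. -/
theorem exists_bdryNorm_maximal_le_area (hn : 1 ≤ n) (C : ℝ≥0) {α : ℝ} (hα : 0 < α) {p : ℝ}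
    (hp : 1 < p) :
    ∃ A : ℝ≥0, ∀ Ω : Set (E n), IsRegular C Ω → ∀ h : E n → ℝ≥0∞, Measurable h →
      bdryNorm p Ω (maximal ((volume.restrict Ω).withDensity h)) ≤
        A * bdryNorm p Ω (area α Ω h) := by
  obtain ⟨A, hA⟩ := exists_bdryNorm_maximal_le hn C hp
  set K : ℝ≥0 := C * ((1 / min α 1) ^ n).toNNReal with hK
  refine ⟨K * (3 ^ n) * A, fun Ω hΩ h hh => ?_⟩
  set σ := surfaceMeasure Ω with hσ
  have hball : ∀ ξ ∈ frontier Ω, ∀ r : ℝ, 0 < r → (volume.restrict Ω).withDensity h (ball ξ r) ≤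
      K * σ.withDensity (area α Ω h) (ball ξ (3 * r)) := by
    intro ξ hξ r hr
    have hg : Measurable ((ball ξ (3 * r)).indicator (1 : E n → ℝ≥0∞)) :=
      measurable_one.indicator measurableSet_ball
    have heq : σ.withDensity (area α Ω h) (ball ξ (3 * r)) =
        ∫⁻ x in Ω, h x * bdryAvg α Ω ((ball ξ (3 * r)).indicator 1) x := by
      rw [← lintegral_area_mul hΩ α hh hg, withDensity_apply _ measurableSet_ball,
        ← lintegral_indicator measurableSet_ball]
      refine lintegral_congr fun z => ?_
      by_cases hz : z ∈ ball ξ (3 * r) <;> simp [hz]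
    rw [heq, withDensity_apply _ measurableSet_ball, Measure.restrict_restrict measurableSet_ball,
      ← lintegral_const_mul' _ _ ENNReal.coe_ne_top]
    refine le_trans (setLIntegral_mono_ae' (measurableSet_ball.inter hΩ.isOpen.measurableSet)
      (ae_of_all _ fun x hx => ?_)) (lintegral_mono_set inter_subset_right)
    have h1 := one_le_bdryAvg_indicator hα hΩ hξ hx.2 hx.1
    calc h x = h x * 1 := (mul_one _).symm
      _ ≤ h x * (C * ENNReal.ofReal ((1 / min α 1) ^ n) *
            bdryAvg α Ω ((ball ξ (3 * r)).indicator 1) x) := by gcongr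
      _ = _ := by
          rw [hK, ENNReal.coe_mul]
          change _ = _ * ENNReal.ofReal ((1 / min α 1) ^ n) * _
          ring
  calc bdryNorm p Ω (maximal ((volume.restrict Ω).withDensity h))
      ≤ (K * 3 ^ n : ℝ≥0) * bdryNorm p Ω (maximal (σ.withDensity (area α Ω h))) := by
        refine bdryNorm_le_mul hp Ω _ fun ξ hξ => ?_
        have := maximal_le_mul_of_measure_ball_le (by norm_num : (0 : ℝ) < 3) (hball ξ hξ)
        rw [ENNReal.ofReal_pow (by norm_num), ENNReal.ofReal_ofNat] at this
        rw [ENNReal.coe_mul, ENNReal.coe_pow]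
        exact this
    _ ≤ (K * 3 ^ n : ℝ≥0) * (A * bdryNorm p Ω (area α Ω h)) := by
        gcongr
        exact hA Ω hΩ _ (measurable_area hΩ.isOpen α hh)
    _ = _ := by rw [ENNReal.coe_mul (_ * _) A, mul_assoc (_ : ℝ≥0∞) A]

/-! ### Exhaustion by compact sets -/

/-- The compact exhaustion of `Ω` by the sets of points at distance at least `1 / (k + 1)` from the
complement and at most `k` from the origin. -/
def exhaustion (Ω : Set (E n)) (k : ℕ) : Set (E n) :=
  {x | 1 / ((k : ℝ) + 1) ≤ bdryDist Ω x} ∩ closedBall 0 k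

lemma isCompact_exhaustion (Ω : Set (E n)) (k : ℕ) : IsCompact (exhaustion Ω k) :=
  (isCompact_closedBall _ _).inter_left (isClosed_le continuous_const (continuous_bdryDist Ω))

lemma exhaustion_subset (Ω : Set (E n)) (k : ℕ) : exhaustion Ω k ⊆ Ω := by
  intro x hx
  refine mem_of_dist_lt_bdryDist (x := x) ?_
  rw [dist_self]
  exact lt_of_lt_of_le (by positivity) hx.1

lemma monotone_exhaustion (Ω : Set (E n)) : Monotone (exhaustion Ω) := by
  intro k l hkl x hx
  exact ⟨(Nat.one_div_le_one_div (α := ℝ) hkl).trans hx.1,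
    closedBall_subset_closedBall (by exact_mod_cast hkl) hx.2⟩

lemma eventually_mem_exhaustion {C : ℝ≥0} {Ω : Set (E n)} (hΩ : IsRegular C Ω) {x : E n}
    (hx : x ∈ Ω) : ∀ᶠ k in atTop, x ∈ exhaustion Ω k := by
  obtain ⟨k, hk⟩ := exists_nat_one_div_lt ((bdryDist_pos_iff hΩ.isOpen hΩ.ne_univ).2 hx)
  obtain ⟨l, hl⟩ := exists_nat_ge ‖x‖
  filter_upwards [eventually_ge_atTop (max k l)] with j hj
  refine ⟨(Nat.one_div_le_one_div (α := ℝ) (le_of_max_le_left hj)).trans hk.le, ?_⟩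
  rw [mem_closedBall_zero_iff]
  exact hl.trans (by exact_mod_cast le_of_max_le_right hj)

lemma iUnion_exhaustion {C : ℝ≥0} {Ω : Set (E n)} (hΩ : IsRegular C Ω) :
    ⋃ k, exhaustion Ω k = Ω := by
  refine (iUnion_subset (exhaustion_subset Ω)).antisymm fun x hx => ?_
  exact mem_iUnion.2 (eventually_mem_exhaustion hΩ hx).exists

lemma MemLqLoc.aestronglyMeasurable {C : ℝ≥0} {q : ℝ} {Ω : Set (E n)} (hΩ : IsRegular C Ω)
    {u : E n → ℝ} (hu : MemLqLoc q Ω u) : AEStronglyMeasurable u (volume.restrict Ω) := by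
  rw [← iUnion_exhaustion hΩ]
  exact AEStronglyMeasurable.iUnion fun k =>
    (hu _ (exhaustion_subset Ω k) (isCompact_exhaustion Ω k)).1

/-! ### Means over Whitney balls -/

lemma volume_ball_mul (x : E n) {a : ℝ} (ha : 0 < a) (s : ℝ) :
    volume (ball x (a * s)) = ENNReal.ofReal (a ^ (n + 1)) * volume (ball (0 : E n) s) := by
  rw [Measure.addHaar_ball_mul_of_pos _ _ ha, finrank_euclideanSpace_fin]

lemma volume_ball_ne_zero {s : ℝ} (hs : 0 < s) (x : E n) : volume (ball x s) ≠ 0 :=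
  (measure_ball_pos _ _ hs).ne'

lemma volume_ball_ne_top (x : E n) (s : ℝ) : volume (ball x s) ≠ ∞ := measure_ball_lt_top.ne

/-- Two Whitney balls that meet have comparable size and distance. -/
lemma bdryDist_comparable {Ω : Set (E n)} {c c' : ℝ} (hc : c ≤ 1 / 2) (hc' : c' ≤ 1 / 2)
    {x z y : E n} (hx : y ∈ ball x (c * bdryDist Ω x)) (hz : y ∈ ball z (c' * bdryDist Ω z)) :
    bdryDist Ω x ≤ 3 * bdryDist Ω z ∧ bdryDist Ω z ≤ 3 * bdryDist Ω x ∧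
      dist x z < 2 * bdryDist Ω z ∧ dist x z < 2 * bdryDist Ω x := by
  have h1 := bdryDist_le_add_dist Ω x y
  have h2 := bdryDist_le_add_dist Ω y x
  have h3 := bdryDist_le_add_dist Ω z y
  have h4 := bdryDist_le_add_dist Ω y z
  have h5 := dist_triangle_left x z y
  have h6 := bdryDist_nonneg Ω x
  have h7 := bdryDist_nonneg Ω z
  rw [mem_ball] at hx hz
  rw [dist_comm x y] at h1
  rw [dist_comm z y] at h3
  have h8 : c * bdryDist Ω x ≤ 1 / 2 * bdryDist Ω x := by gcongr
  have h9 : c' * bdryDist Ω z ≤ 1 / 2 * bdryDist Ω z := by gcongr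
  refine ⟨?_, ?_, ?_, ?_⟩ <;> linarith

/-- The indicator of the pairs `(x, y)` such that `y` lies in the Whitney ball of `x`. -/
noncomputable def whitneyKernel (c : ℝ) (Ω : Set (E n)) (x y : E n) : ℝ≥0∞ :=
  if dist y x < c * bdryDist Ω x then 1 else 0

lemma measurable_whitneyKernel (c : ℝ) (Ω : Set (E n)) :
    Measurable (Function.uncurry (whitneyKernel c Ω)) := by
  have hopen : IsOpen {z : E n × E n | dist z.2 z.1 < c * bdryDist Ω z.1} :=
    isOpen_lt (continuous_snd.dist continuous_fst)
      (continuous_const.mul ((continuous_bdryDist Ω).comp continuous_fst))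
  exact Measurable.ite hopen.measurableSet measurable_const measurable_const

lemma measurable_whitneyKernel_right (c : ℝ) (Ω : Set (E n)) (x : E n) :
    Measurable (whitneyKernel c Ω x) :=
  (measurable_whitneyKernel c Ω).of_uncurry_left

lemma measurable_whitneyKernel_left (c : ℝ) (Ω : Set (E n)) (y : E n) :
    Measurable fun x => whitneyKernel c Ω x y :=
  (measurable_whitneyKernel c Ω).of_uncurry_right

lemma whitneyKernel_of_mem {c : ℝ} {Ω : Set (E n)} {x y : E n}
    (h : y ∈ ball x (c * bdryDist Ω x)) : whitneyKernel c Ω x y = 1 := if_pos h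

lemma whitneyKernel_of_notMem {c : ℝ} {Ω : Set (E n)} {x y : E n}
    (h : y ∉ ball x (c * bdryDist Ω x)) : whitneyKernel c Ω x y = 0 := if_neg h

lemma lintegral_whitneyKernel_mul (c : ℝ) (Ω : Set (E n)) (x : E n) (f : E n → ℝ≥0∞) :
    ∫⁻ y, whitneyKernel c Ω x y * f y = ∫⁻ y in ball x (c * bdryDist Ω x), f y := by
  rw [← lintegral_indicator measurableSet_ball]
  refine lintegral_congr fun y => ?_
  by_cases hy : y ∈ ball x (c * bdryDist Ω x)
  · rw [whitneyKernel_of_mem hy, one_mul, indicator_of_mem hy]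
  · rw [whitneyKernel_of_notMem hy, zero_mul, indicator_of_notMem hy]

/-- Integrals over `Ω` are controlled by integrals of means over Whitney balls. -/
lemma setLIntegral_le_setLIntegral_laverage {C : ℝ≥0} {Ω : Set (E n)} (hΩ : IsRegular C Ω)
    {c : ℝ} (hc : c ∈ Ioc (0 : ℝ) (1 / 2)) {f : E n → ℝ≥0∞} (hf : Measurable f) :
    ∫⁻ x in Ω, f x ≤ ENNReal.ofReal (3 ^ (n + 1)) *
      ∫⁻ x in Ω, ⨍⁻ y in ball x (c * bdryDist Ω x), f y ∂volume := by
  have hvol : Measurable fun x => volume (ball x (c * bdryDist Ω x)) :=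
    (lowerSemicontinuous_measure_ball (volume : Measure (E n))
      (continuous_const.mul (continuous_bdryDist Ω))).measurable
  have hF : Measurable (Function.uncurry fun x y => whitneyKernel c Ω x y * f y /
      volume (ball x (c * bdryDist Ω x))) :=
    ((measurable_whitneyKernel c Ω).mul (hf.comp measurable_snd)).div (hvol.comp measurable_fst)
  have hswap : ∫⁻ x in Ω, ⨍⁻ y in ball x (c * bdryDist Ω x), f y ∂volume =
      ∫⁻ y, ∫⁻ x in Ω, whitneyKernel c Ω x y * f y / volume (ball x (c * bdryDist Ω x)) := by
    rw [← lintegral_lintegral_swap hF.aemeasurable]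
    refine lintegral_congr fun x => ?_
    rw [setLAverage_eq, ← lintegral_whitneyKernel_mul]
    simp_rw [div_eq_mul_inv]
    exact (lintegral_mul_const _ ((measurable_whitneyKernel_right c Ω x).mul hf)).symm
  rw [hswap, ← lintegral_const_mul' _ _ ENNReal.ofReal_ne_top]
  refine le_trans (setLIntegral_mono_ae' hΩ.isOpen.measurableSet (ae_of_all _ fun y hy => ?_))
    (setLIntegral_le_lintegral Ω _)
  have hδ := (bdryDist_pos_iff hΩ.isOpen hΩ.ne_univ).2 hy
  have hc0 := hc.1
  have hc1 := hc.2
  -- The Whitney balls of all points of a small ball about `y` contain `y`.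
  have hmem : ∀ x ∈ ball y (c / 2 * bdryDist Ω y), x ∈ Ω ∧ y ∈ ball x (c * bdryDist Ω x) ∧
      volume (ball x (c * bdryDist Ω x)) ≤
        ENNReal.ofReal (3 ^ (n + 1)) * volume (ball y (c / 2 * bdryDist Ω y)) := by
    intro x hx
    rw [mem_ball] at hx
    have h1 := bdryDist_le_add_dist Ω y x
    have h2 := bdryDist_le_add_dist Ω x y
    rw [dist_comm y x] at h1
    have h3 : c / 2 * bdryDist Ω y ≤ 1 / 4 * bdryDist Ω y :=
      mul_le_mul_of_nonneg_right (by linarith) hδ.le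
    refine ⟨mem_of_dist_lt_bdryDist (x := y) (by rw [dist_comm]; linarith), ?_, ?_⟩
    · rw [mem_ball, dist_comm]
      nlinarith
    · calc volume (ball x (c * bdryDist Ω x)) ≤
            volume (ball x (3 * (c / 2 * bdryDist Ω y))) := by
            refine measure_mono (ball_subset_ball ?_)
            nlinarith
        _ = _ := by
            rw [volume_ball_mul _ three_pos, ← Measure.addHaar_ball_center volume y]
  have hsub : ball y (c / 2 * bdryDist Ω y) ⊆ Ω := fun x hx => (hmem x hx).1
  have hV0 : volume (ball y (c / 2 * bdryDist Ω y)) ≠ 0 := volume_ball_ne_zero (by positivity) y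
  have hVt := volume_ball_ne_top y (c / 2 * bdryDist Ω y)
  have h30 : ENNReal.ofReal (3 ^ (n + 1)) ≠ 0 := by simp
  calc f y = ENNReal.ofReal (3 ^ (n + 1)) *
        ∫⁻ x in ball y (c / 2 * bdryDist Ω y), f y / (ENNReal.ofReal (3 ^ (n + 1)) *
          volume (ball y (c / 2 * bdryDist Ω y))) := by
        rw [setLIntegral_const, div_eq_mul_inv, mul_assoc,
          ENNReal.mul_inv (Or.inl h30) (Or.inl ENNReal.ofReal_ne_top), mul_assoc,
          ENNReal.inv_mul_cancel hV0 hVt, mul_one, mul_left_comm,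
          ENNReal.mul_inv_cancel h30 ENNReal.ofReal_ne_top, mul_one]
    _ ≤ ENNReal.ofReal (3 ^ (n + 1)) * ∫⁻ x in ball y (c / 2 * bdryDist Ω y),
          whitneyKernel c Ω x y * f y / volume (ball x (c * bdryDist Ω x)) := by
        gcongr 1
        refine setLIntegral_mono_ae' measurableSet_ball (ae_of_all _ fun x hx => ?_)
        rw [whitneyKernel_of_mem (hmem x hx).2.1, one_mul]
        exact ENNReal.div_le_div_left (hmem x hx).2.2 _
    _ ≤ _ := by
        gcongr

/-- Means over smaller Whitney balls are controlled by means over larger ones. -/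
lemma localMean_le_of_le {Ω : Set (E n)} {c c' q : ℝ} (hc : 0 < c) (hcc : c ≤ c') (hq : 0 < q)
    (u : E n → ℝ) (x : E n) :
    localMean c q Ω u x ≤
      ENNReal.ofReal ((c' / c) ^ (n + 1)) ^ (1 / q) * localMean c' q Ω u x := by
  have hc' : 0 < c' := hc.trans_le hcc
  unfold localMean
  rw [← ENNReal.mul_rpow_of_nonneg _ _ (by positivity)]
  gcongr ?_ ^ (1 / q)
  rw [setLAverage_eq, setLAverage_eq, ← mul_div_assoc]
  rcases (bdryDist_nonneg Ω x).eq_or_lt with h0 | hδ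
  · simp [← h0]
  have hV : volume (ball x (c' * bdryDist Ω x)) =
      ENNReal.ofReal ((c' / c) ^ (n + 1)) * volume (ball x (c * bdryDist Ω x)) := by
    rw [← Measure.addHaar_ball_center volume x (c * bdryDist Ω x) |>.symm,
      ← volume_ball_mul x (by positivity)]
    congr 2
    field_simp
  have hr0 : ENNReal.ofReal ((c' / c) ^ (n + 1)) ≠ 0 := (ENNReal.ofReal_pos.2 (by positivity)).ne'
  rw [hV, ENNReal.mul_div_mul_left _ _ hr0 ENNReal.ofReal_ne_top]
  gcongr

/-- Hölder's inequality on a Whitney ball. -/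
lemma laverage_mul_le {Ω : Set (E n)} {c q q' : ℝ} (hq : q.HolderConjugate q') {u H : E n → ℝ}
    (hu : Measurable u) (hH : Measurable H) (x : E n) :
    ⨍⁻ y in ball x (c * bdryDist Ω x), ‖u y * H y‖ₑ ∂volume ≤
      localMean c q Ω u x * localMean c q' Ω H x := by
  simp_rw [enorm_mul]
  exact ENNReal.lintegral_mul_le_Lp_mul_Lq _ hq hu.enorm.aemeasurable hH.enorm.aemeasurable

lemma carleson_eq_maximal (c q : ℝ) (Ω : Set (E n)) (H : E n → ℝ) :
    carleson c q Ω H = maximal ((volume.restrict Ω).withDensity (localMean c q Ω H)) := by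
  funext ξ
  rw [maximal, carleson]
  congr! with r hr
  rw [withDensity_apply _ measurableSet_ball, Measure.restrict_restrict measurableSet_ball]

/-! ### The bound for the pairing -/

/-- The bound for the pairing: averaging over Whitney balls and Hölder's inequality reduce it to
the Carleson embedding for the local means. -/
theorem exists_setLIntegral_mul_le (C : ℝ≥0) {p p' q q' : ℝ} (hp : p.HolderConjugate p')
    (hq : q.HolderConjugate q') {α : ℝ} (hα : 0 < α) {c₁ c₂ : ℝ}
    (hc₁ : c₁ ∈ Ioc (0 : ℝ) (1 / 2)) (hc₂ : c₂ ∈ Ioc (0 : ℝ) (1 / 2)) :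
    ∃ A : ℝ≥0, ∀ Ω : Set (E n), IsRegular C Ω → ∀ u H : E n → ℝ,
      AEStronglyMeasurable u (volume.restrict Ω) → AEStronglyMeasurable H (volume.restrict Ω) →
        ∫⁻ x in Ω, ‖u x * H x‖ₑ ≤
          A * bdryNorm p Ω (ntMax α c₁ q Ω u) * bdryNorm p' Ω (carleson c₂ q' Ω H) := by
  obtain ⟨A, hA⟩ := exists_lintegral_le_ntSup_mul_maximal (n := n) C hα
  set c : ℝ := min c₁ c₂ with hc
  have hc0 : 0 < c := lt_min hc₁.1 hc₂.1
  set K₁ : ℝ≥0∞ := ENNReal.ofReal ((c₁ / c) ^ (n + 1)) ^ (1 / q) with hK₁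
  set K₂ : ℝ≥0∞ := ENNReal.ofReal ((c₂ / c) ^ (n + 1)) ^ (1 / q') with hK₂
  have hK₁t : K₁ ≠ ∞ := ENNReal.rpow_ne_top_of_nonneg (by have := hq.pos; positivity)
    ENNReal.ofReal_ne_top
  have hK₂t : K₂ ≠ ∞ := ENNReal.rpow_ne_top_of_nonneg (by have := hq.symm.pos; positivity)
    ENNReal.ofReal_ne_top
  set B : ℝ≥0∞ := ENNReal.ofReal (3 ^ (n + 1)) * (K₁ * K₂) * A with hB
  have hBt : B ≠ ∞ := by finiteness
  refine ⟨B.toNNReal, fun Ω hΩ u H hu hH => ?_⟩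
  -- All terms depend on the classes of `u` and `H` only.
  wlog hm : Measurable u ∧ Measurable H generalizing u H
  · have hu' := hu.ae_eq_mk
    have hH' := hH.ae_eq_mk
    rw [ntMax_congr hc₁ q hu', carleson_congr hc₂ q' hH']
    have := this (hu.mk u) (hH.mk H) (hu.congr hu') (hH.congr hH')
      ⟨hu.stronglyMeasurable_mk.measurable, hH.stronglyMeasurable_mk.measurable⟩
    refine le_trans (lintegral_congr_ae ?_).le this
    filter_upwards [hu', hH'] with x h1 h2
    rw [h1, h2]
  obtain ⟨hum, hHm⟩ := hm
  rw [ENNReal.coe_toNNReal hBt]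
  have hw := measurable_localMean c₁ q Ω u
  have hh := measurable_localMean c₂ q' Ω H
  calc ∫⁻ x in Ω, ‖u x * H x‖ₑ
      ≤ ENNReal.ofReal (3 ^ (n + 1)) *
          ∫⁻ x in Ω, ⨍⁻ y in ball x (c * bdryDist Ω x), ‖u y * H y‖ₑ ∂volume :=
        setLIntegral_le_setLIntegral_laverage hΩ ⟨hc0, (min_le_left _ _).trans hc₁.2⟩
          (hum.mul hHm).enorm
    _ ≤ ENNReal.ofReal (3 ^ (n + 1)) * ∫⁻ x in Ω, K₁ * K₂ *
          (localMean c₂ q' Ω H x * localMean c₁ q Ω u x) := by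
        gcongr ENNReal.ofReal (3 ^ (n + 1)) * ?_
        refine lintegral_mono fun x => (laverage_mul_le hq hum hHm x).trans ?_
        calc localMean c q Ω u x * localMean c q' Ω H x
            ≤ (K₁ * localMean c₁ q Ω u x) * (K₂ * localMean c₂ q' Ω H x) :=
              mul_le_mul' (localMean_le_of_le hc0 (min_le_left _ _) hq.pos u x)
                (localMean_le_of_le hc0 (min_le_right _ _) hq.symm.pos H x)
          _ = _ := by ring
    _ = ENNReal.ofReal (3 ^ (n + 1)) * (K₁ * K₂) *
          ∫⁻ x, localMean c₁ q Ω u x ∂((volume.restrict Ω).withDensity (localMean c₂ q' Ω H)) := by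
        rw [lintegral_const_mul' _ _ (by finiteness), ← mul_assoc,
          lintegral_withDensity_eq_lintegral_mul _ hh hw]
        rfl
    _ ≤ ENNReal.ofReal (3 ^ (n + 1)) * (K₁ * K₂) *
          (A * ∫⁻ ξ, (ntMax α c₁ q Ω u * carleson c₂ q' Ω H) ξ ∂(surfaceMeasure Ω)) := by
        gcongr
        refine (hA Ω hΩ _ ?_ _ hw).trans (le_of_eq ?_)
        · exact withDensity_absolutelyContinuous _ _ (by simp [hΩ.isOpen.measurableSet])
        · congr 1
          refine lintegral_congr fun ξ => ?_
          rw [Pi.mul_apply]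
          rw [carleson_eq_maximal]
          rfl
    _ ≤ ENNReal.ofReal (3 ^ (n + 1)) * (K₁ * K₂) *
          (A * (bdryNorm p Ω (ntMax α c₁ q Ω u) * bdryNorm p' Ω (carleson c₂ q' Ω H))) := by
        gcongr
        exact ENNReal.lintegral_mul_le_Lp_mul_Lq _ hp (measurable_ntMax ..).aemeasurable
          (measurable_carleson ..).aemeasurable
    _ = _ := by rw [hB]; ring

/-! ### Finiteness and semicontinuity of local means -/

lemma setLIntegral_eq_of_subset_of_eq_zero {s t : Set (E n)} (hs : MeasurableSet s)
    (ht : MeasurableSet t) (hst : s ⊆ t) {f : E n → ℝ≥0∞} (hf : ∀ y ∈ t, y ∉ s → f y = 0) :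
    ∫⁻ y in s, f y = ∫⁻ y in t, f y := by
  rw [← lintegral_indicator hs, ← lintegral_indicator ht]
  refine lintegral_congr fun y => ?_
  by_cases hys : y ∈ s
  · rw [indicator_of_mem hys, indicator_of_mem (hst hys)]
  · by_cases hyt : y ∈ t
    · rw [indicator_of_notMem hys, indicator_of_mem hyt, hf y hyt hys]
    · rw [indicator_of_notMem hys, indicator_of_notMem hyt]

lemma ball_eq_empty_of_notMem {Ω : Set (E n)} {c : ℝ} {x : E n} (hx : x ∉ Ω) :
    ball x (c * bdryDist Ω x) = ∅ := by
  have : bdryDist Ω x = 0 :=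
    le_antisymm ((bdryDist_le_dist_of_notMem hx).trans (dist_self x).le) (bdryDist_nonneg Ω x)
  rw [this, mul_zero, ball_zero]

lemma localMean_of_notMem {Ω : Set (E n)} {c q : ℝ} (hq : 0 < q) {u : E n → ℝ} {x : E n}
    (hx : x ∉ Ω) : localMean c q Ω u x = 0 := by
  simp [localMean, ball_eq_empty_of_notMem hx, hq]

lemma localMean_mono {Ω : Set (E n)} {c q : ℝ} (hq : 0 < q) {u v : E n → ℝ} {x : E n}
    (h : ∀ y ∈ ball x (c * bdryDist Ω x), ‖u y‖ₑ ≤ ‖v y‖ₑ) :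
    localMean c q Ω u x ≤ localMean c q Ω v x := by
  unfold localMean
  rw [setLAverage_eq, setLAverage_eq]
  gcongr ?_ ^ (1 / q)
  gcongr ?_ / _
  refine setLIntegral_mono_ae' measurableSet_ball (ae_of_all _ fun y hy => ?_)
  gcongr
  exact h y hy

lemma setLIntegral_rpow_lt_top {Ω : Set (E n)} {q : ℝ} (hq : 0 < q) {u : E n → ℝ}
    (hu : MemLqLoc q Ω u) {K : Set (E n)} (hK : IsCompact K) (hKΩ : K ⊆ Ω) :
    ∫⁻ y in K, ‖u y‖ₑ ^ q < ∞ := by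
  have := lintegral_rpow_enorm_lt_top_of_eLpNorm_lt_top (by simp [hq]) ENNReal.ofReal_ne_top
    (hu K hKΩ hK).2
  rwa [ENNReal.toReal_ofReal hq.le] at this

lemma closedBall_subset_of_mem {Ω : Set (E n)} {c : ℝ} (hc : c ∈ Ioc (0 : ℝ) (1 / 2)) {x : E n}
    (hx : 0 < bdryDist Ω x) : closedBall x (c * bdryDist Ω x) ⊆ Ω := by
  intro y hy
  refine mem_of_dist_lt_bdryDist (x := x) ?_
  rw [mem_closedBall, dist_comm] at hy
  have := hc.2
  nlinarith

lemma setLIntegral_eq_localMean {Ω : Set (E n)} {c q : ℝ} (hc : 0 < c) (hq : 0 < q)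
    (u : E n → ℝ) {x : E n} (hx : 0 < bdryDist Ω x) :
    ∫⁻ y in ball x (c * bdryDist Ω x), ‖u y‖ₑ ^ q =
      localMean c q Ω u x ^ q * volume (ball x (c * bdryDist Ω x)) := by
  rw [localMean, ← ENNReal.rpow_mul, one_div_mul_cancel hq.ne', ENNReal.rpow_one, setLAverage_eq,
    ENNReal.div_mul_cancel (volume_ball_ne_zero (by positivity) x) (volume_ball_ne_top _ _)]

lemma localMean_lt_top {C : ℝ≥0} {Ω : Set (E n)} (hΩ : IsRegular C Ω) {c q : ℝ}
    (hc : c ∈ Ioc (0 : ℝ) (1 / 2)) (hq : 0 < q) {u : E n → ℝ} (hu : MemLqLoc q Ω u) (x : E n) :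
    localMean c q Ω u x < ∞ := by
  by_cases hx : x ∈ Ω
  · have hδ := (bdryDist_pos_iff hΩ.isOpen hΩ.ne_univ).2 hx
    have hc0 := hc.1
    unfold localMean
    refine ENNReal.rpow_lt_top_of_nonneg (by positivity) (ne_of_lt ?_)
    rw [setLAverage_eq]
    refine ENNReal.div_lt_top (ne_of_lt ?_) (volume_ball_ne_zero (by positivity) x)
    exact (lintegral_mono_set ball_subset_closedBall).trans_lt
      (setLIntegral_rpow_lt_top hq hu (isCompact_closedBall _ _)
        (closedBall_subset_of_mem hc hδ))
  · rw [localMean_of_notMem hq hx]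
    exact ENNReal.zero_lt_top

/-- A function all of whose local means are finite is locally in `L^q`. -/
lemma memLqLoc_of_localMean_lt_top {C : ℝ≥0} {Ω : Set (E n)} (hΩ : IsRegular C Ω) {c q : ℝ}
    (hc : c ∈ Ioc (0 : ℝ) (1 / 2)) (hq : 0 < q) {u : E n → ℝ}
    (hum : AEStronglyMeasurable u (volume.restrict Ω))
    (hu : ∀ x ∈ Ω, localMean c q Ω u x < ∞) : MemLqLoc q Ω u := by
  intro K hKΩ hK
  refine ⟨hum.mono_measure (Measure.restrict_mono hKΩ le_rfl), ?_⟩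
  rw [eLpNorm_lt_top_iff_lintegral_rpow_enorm_lt_top (by simp [hq]) ENNReal.ofReal_ne_top,
    ENNReal.toReal_ofReal hq.le]
  have hc0 := hc.1
  have hδ : ∀ x ∈ K, 0 < bdryDist Ω x := fun x hx =>
    (bdryDist_pos_iff hΩ.isOpen hΩ.ne_univ).2 (hKΩ hx)
  obtain ⟨t, htK, hcov⟩ := hK.elim_nhds_subcover (fun x => ball x (c * bdryDist Ω x))
    fun x hx => ball_mem_nhds x (mul_pos hc0 (hδ x hx))
  calc ∫⁻ y in K, ‖u y‖ₑ ^ q ≤ ∫⁻ y in ⋃ x ∈ t, ball x (c * bdryDist Ω x), ‖u y‖ₑ ^ q :=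
        lintegral_mono_set hcov
    _ ≤ ∑ x ∈ t, ∫⁻ y in ball x (c * bdryDist Ω x), ‖u y‖ₑ ^ q := by
        have := measure_biUnion_finset_le (μ := volume.withDensity fun y => ‖u y‖ₑ ^ q) t
          fun x => ball x (c * bdryDist Ω x)
        rw [withDensity_apply _ (Finset.measurableSet_biUnion t fun _ _ => measurableSet_ball)]
          at this
        simpa only [withDensity_apply _ measurableSet_ball] using this
    _ < ∞ := by
        refine ENNReal.sum_lt_top.2 fun x hx => ?_
        rw [setLIntegral_eq_localMean hc0 hq u (hδ x (htK x hx))]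
        exact ENNReal.mul_lt_top (ENNReal.rpow_lt_top_of_nonneg hq.le (hu x (hKΩ (htK x hx))).ne)
          (volume_ball_ne_top _ _).lt_top

/-- The local mean is lower semicontinuous on `Ω`, also where `u` is not locally in `L^q`. -/
lemma eventually_lt_localMean {C : ℝ≥0} {Ω : Set (E n)} (hΩ : IsRegular C Ω) {c q : ℝ}
    (hc : 0 < c) (hq : 0 < q) (u : E n → ℝ) {x : E n} (hx : x ∈ Ω) {a : ℝ≥0∞}
    (ha : a < localMean c q Ω u x) : ∀ᶠ y in 𝓝 x, a < localMean c q Ω u y := by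
  have hδ : ∀ y ∈ Ω, 0 < bdryDist Ω y := fun y hy =>
    (bdryDist_pos_iff hΩ.isOpen hΩ.ne_univ).2 hy
  have hρ : Continuous fun x : E n => c * bdryDist Ω x :=
    continuous_const.mul (continuous_bdryDist Ω)
  have hat : a ^ q ≠ ∞ := ENNReal.rpow_ne_top_of_nonneg hq.le (ha.trans_le le_top).ne
  set ν : Measure (E n) := volume.withDensity fun y => ‖u y‖ₑ ^ q with hν
  have hiff : ∀ y ∈ Ω, a < localMean c q Ω u y ↔
      a ^ q * volume (ball y (c * bdryDist Ω y)) < ν (ball y (c * bdryDist Ω y)) := by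
    intro y hy
    have := hδ y hy
    rw [localMean, one_div, ENNReal.lt_rpow_inv_iff hq, setLAverage_eq,
      ENNReal.lt_div_iff_mul_lt (Or.inl (volume_ball_ne_zero (by positivity) y))
        (Or.inl (volume_ball_ne_top _ _)), hν, withDensity_apply _ measurableSet_ball]
  have hcont : Continuous fun y : E n => a ^ q * volume (ball y (c * bdryDist Ω y)) := by
    have : ∀ y : E n, volume (ball y (c * bdryDist Ω y)) =
        ENNReal.ofReal ((c * bdryDist Ω y) ^ (n + 1)) * volume (ball (0 : E n) 1) := fun y => by
      rw [Measure.addHaar_ball _ _ (mul_nonneg hc.le (bdryDist_nonneg Ω y)),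
        finrank_euclideanSpace_fin]
    simp_rw [this]
    refine ENNReal.continuous_const_mul hat |>.comp ?_
    exact (ENNReal.continuous_mul_const (volume_ball_ne_top _ _)).comp
      (ENNReal.continuous_ofReal.comp (hρ.pow _))
  obtain ⟨b, hb1, hb2⟩ := exists_between ((hiff x hx).1 ha)
  filter_upwards [hcont.continuousAt.eventually_lt continuousAt_const hb1,
    lowerSemicontinuous_measure_ball ν hρ x b hb2, hΩ.isOpen.mem_nhds hx] with y h1 h2 hy
  exact (hiff y hy).2 (h1.trans h2)

lemma localMean_sum_le {Ω : Set (E n)} {c q : ℝ} (hc : c ∈ Ioc (0 : ℝ) (1 / 2)) (hq : 1 ≤ q)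
    {ι : Type*} (s : Finset ι) {f : ι → E n → ℝ} (hf : ∀ i, Measurable (f i)) (x : E n) :
    localMean c q Ω (∑ i ∈ s, f i) x ≤ ∑ i ∈ s, localMean c q Ω (f i) x := by
  classical
  induction s using Finset.induction_on with
  | empty => simp [localMean_zero hq]
  | insert i s hi ih =>
    rw [Finset.sum_insert hi, Finset.sum_insert hi]
    refine (localMean_add_le hc hq (hf i).aestronglyMeasurable ?_ x).trans (by gcongr)
    rw [Finset.sum_fn]
    exact (Finset.measurable_sum s fun i _ => hf i).aestronglyMeasurable

/-! ### Dual functions of local means -/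

/-- The function on the Whitney ball of `x` dual to the local mean of `u` at `x`, normalized so
that its integral against `|u|` is that mean. Where the mean vanishes so does the function, by the
convention `0 ^ (1 - q) = 0`. -/
noncomputable def dualBump (c q : ℝ) (Ω : Set (E n)) (u : E n → ℝ) (x : E n) : E n → ℝ :=
  (ball x (c * bdryDist Ω x)).indicator fun y => |u y| ^ (q - 1) *
    ((localMean c q Ω u x).toReal ^ (1 - q) / (volume (ball x (c * bdryDist Ω x))).toReal)

section DualBump

variable {C : ℝ≥0} {Ω : Set (E n)} {c c₁ c₂ q q' : ℝ} {u : E n → ℝ}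

lemma dualBump_nonneg (x y : E n) : 0 ≤ dualBump c q Ω u x y := by
  unfold dualBump
  refine indicator_nonneg (fun y _ => ?_) y
  positivity

lemma measurable_dualBump (hu : Measurable u) (x : E n) : Measurable (dualBump c q Ω u x) := by
  refine Measurable.indicator ?_ measurableSet_ball
  exact ((measurable_norm.comp hu).pow_const _).mul_const _

lemma dualBump_eq_zero_of_localMean (hq : 1 < q) {x : E n} (h : localMean c q Ω u x = 0) :
    dualBump c q Ω u x = 0 := by
  funext y
  simp [dualBump, h, Real.zero_rpow (by linarith : 1 - q ≠ 0)]

lemma dualBump_eq_zero_of_notMem {x y : E n} (h : y ∉ ball x (c * bdryDist Ω x)) :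
    dualBump c q Ω u x y = 0 := indicator_of_notMem h _

lemma enorm_dualBump (hc : 0 < c) (hq : 1 < q) {x y : E n} (hx : 0 < bdryDist Ω x)
    (h0 : localMean c q Ω u x ≠ 0) (ht : localMean c q Ω u x ≠ ∞)
    (hy : y ∈ ball x (c * bdryDist Ω x)) :
    ‖dualBump c q Ω u x y‖ₑ = ‖u y‖ₑ ^ (q - 1) *
      (localMean c q Ω u x ^ (1 - q) / volume (ball x (c * bdryDist Ω x))) := by
  have hV0 := volume_ball_ne_zero (mul_pos hc hx) x
  have hVt := volume_ball_ne_top x (c * bdryDist Ω x)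
  rw [Real.enorm_of_nonneg (dualBump_nonneg x y), dualBump, indicator_of_mem hy,
    ENNReal.ofReal_mul (by positivity),
    ← ENNReal.ofReal_rpow_of_nonneg (abs_nonneg _) (by linarith),
    ← Real.enorm_eq_ofReal_abs, ENNReal.ofReal_div_of_pos (ENNReal.toReal_pos hV0 hVt),
    ← ENNReal.ofReal_rpow_of_pos (ENNReal.toReal_pos h0 ht), ENNReal.ofReal_toReal ht,
    ENNReal.ofReal_toReal hVt]

/-- The pairing of `u` with its dual function at `x` is the local mean of `u` at `x`. -/
lemma lintegral_mul_dualBump (hΩ : IsRegular C Ω) (hc : c ∈ Ioc (0 : ℝ) (1 / 2)) (hq : 1 < q)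
    (hu : MemLqLoc q Ω u) (x : E n) :
    ∫⁻ y in Ω, ‖u y * dualBump c q Ω u x y‖ₑ = localMean c q Ω u x := by
  have hq0 : 0 < q := by linarith
  rcases eq_or_ne (localMean c q Ω u x) 0 with h0 | h0
  · simp [h0, dualBump_eq_zero_of_localMean hq h0]
  have hx : x ∈ Ω := by
    by_contra hx
    exact h0 (localMean_of_notMem hq0 hx)
  have hδ := (bdryDist_pos_iff hΩ.isOpen hΩ.ne_univ).2 hx
  have ht := (localMean_lt_top hΩ hc hq0 hu x).ne
  have hV0 := volume_ball_ne_zero (mul_pos hc.1 hδ) x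
  have hVt := volume_ball_ne_top x (c * bdryDist Ω x)
  set w := localMean c q Ω u x with hw
  set V := volume (ball x (c * bdryDist Ω x)) with hV
  calc ∫⁻ y in Ω, ‖u y * dualBump c q Ω u x y‖ₑ
      = ∫⁻ y in ball x (c * bdryDist Ω x), ‖u y * dualBump c q Ω u x y‖ₑ := by
        symm
        refine setLIntegral_eq_of_subset_of_eq_zero measurableSet_ball hΩ.isOpen.measurableSet
          (ball_subset Ω hc x) fun y _ hy => ?_
        rw [dualBump_eq_zero_of_notMem hy, mul_zero, enorm_zero]
    _ = ∫⁻ y in ball x (c * bdryDist Ω x), ‖u y‖ₑ ^ q * (w ^ (1 - q) / V) := by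
        refine setLIntegral_congr_fun measurableSet_ball fun y hy => ?_
        rw [enorm_mul, enorm_dualBump hc.1 hq hδ h0 ht hy, ← mul_assoc]
        congr 1
        nth_rewrite 1 [← ENNReal.rpow_one ‖u y‖ₑ]
        rw [← ENNReal.rpow_add_of_nonneg _ _ zero_le_one (by linarith), add_sub_cancel]
    _ = w ^ q * V * (w ^ (1 - q) / V) := by
        rw [lintegral_mul_const' _ _ (ENNReal.div_ne_top
          (ENNReal.rpow_ne_top_of_ne_zero h0 ht) hV0), setLIntegral_eq_localMean hc.1 hq0 u hδ]
    _ = w := by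
        rw [mul_assoc, ENNReal.mul_div_cancel hV0 hVt, ← ENNReal.rpow_add _ _ h0 ht,
          add_sub_cancel, ENNReal.rpow_one]

lemma localMean_dualBump_eq_zero (hq : q.HolderConjugate q') {x z : E n}
    (hz : ∀ y ∈ ball x (c₁ * bdryDist Ω x), y ∉ ball z (c₂ * bdryDist Ω z)) :
    localMean c₂ q' Ω (dualBump c₁ q Ω u x) z = 0 := by
  have : localMean c₂ q' Ω (dualBump c₁ q Ω u x) z ≤ localMean c₂ q' Ω 0 z :=
    localMean_mono hq.symm.pos fun y hy => by
      rw [dualBump_eq_zero_of_notMem fun h => hz y h hy]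
      simp
  rw [localMean_zero hq.symm.lt.le] at this
  exact le_antisymm this zero_le

/-- The dual function is normalized in `L^{q'}` on its Whitney ball, and Whitney balls that meet are
comparable. -/
lemma localMean_dualBump_le (hΩ : IsRegular C Ω) (hq : q.HolderConjugate q')
    (hc₁ : c₁ ∈ Ioc (0 : ℝ) (1 / 2)) (hc₂ : c₂ ∈ Ioc (0 : ℝ) (1 / 2)) (hu : MemLqLoc q Ω u)
    (x z : E n) :
    localMean c₂ q' Ω (dualBump c₁ q Ω u x) z ≤
      ENNReal.ofReal ((3 * c₁ / c₂) ^ (n + 1)) ^ (1 / q') *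
        (volume (ball x (c₁ * bdryDist Ω x)))⁻¹ := by
  have hq0 := hq.pos
  have hq0' := hq.symm.pos
  have hzero : dualBump c₁ q Ω u x = 0 → localMean c₂ q' Ω (dualBump c₁ q Ω u x) z ≤
      ENNReal.ofReal ((3 * c₁ / c₂) ^ (n + 1)) ^ (1 / q') *
        (volume (ball x (c₁ * bdryDist Ω x)))⁻¹ := fun h => by
    rw [h, localMean_zero hq.symm.lt.le]
    exact zero_le
  rcases eq_or_ne (localMean c₁ q Ω u x) 0 with h0 | h0
  · exact hzero (dualBump_eq_zero_of_localMean hq.lt h0)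
  have hx : x ∈ Ω := by
    by_contra hx
    exact h0 (localMean_of_notMem hq0 hx)
  by_cases hz : z ∈ Ω
  swap
  · rw [localMean_of_notMem hq0' hz]
    exact zero_le
  have hδ := (bdryDist_pos_iff hΩ.isOpen hΩ.ne_univ).2 hx
  have hδz := (bdryDist_pos_iff hΩ.isOpen hΩ.ne_univ).2 hz
  have ht := (localMean_lt_top hΩ hc₁ hq0 hu x).ne
  have h10 := hc₁.1
  have h20 := hc₂.1
  have hV0 := volume_ball_ne_zero (mul_pos hc₁.1 hδ) x
  have hVt := volume_ball_ne_top x (c₁ * bdryDist Ω x)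
  have hVz0 := volume_ball_ne_zero (mul_pos hc₂.1 hδz) z
  have hVzt := volume_ball_ne_top z (c₂ * bdryDist Ω z)
  by_cases hmeet : ∃ y, y ∈ ball x (c₁ * bdryDist Ω x) ∧ y ∈ ball z (c₂ * bdryDist Ω z)
  swap
  · push Not at hmeet
    rw [localMean_dualBump_eq_zero hq hmeet]
    exact zero_le
  obtain ⟨y, hyx, hyz⟩ := hmeet
  have hcomp := (bdryDist_comparable hc₁.2 hc₂.2 hyx hyz).1
  set w := localMean c₁ q Ω u x with hw
  set V := volume (ball x (c₁ * bdryDist Ω x)) with hV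
  set Vz := volume (ball z (c₂ * bdryDist Ω z)) with hVz
  have hVle : V ≤ ENNReal.ofReal ((3 * c₁ / c₂) ^ (n + 1)) * Vz := by
    calc V ≤ volume (ball x (3 * c₁ / c₂ * (c₂ * bdryDist Ω z))) := by
          refine measure_mono (ball_subset_ball ?_)
          have : 3 * c₁ / c₂ * (c₂ * bdryDist Ω z) = c₁ * (3 * bdryDist Ω z) := by field_simp
          rw [this]
          gcongr
      _ = _ := by
          rw [volume_ball_mul _ (by positivity), ← Measure.addHaar_ball_center volume z]
  have hint : ∫⁻ y in ball z (c₂ * bdryDist Ω z), ‖dualBump c₁ q Ω u x y‖ₑ ^ q' ≤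
      V * V⁻¹ ^ q' := by
    calc ∫⁻ y in ball z (c₂ * bdryDist Ω z), ‖dualBump c₁ q Ω u x y‖ₑ ^ q'
        ≤ ∫⁻ y, ‖dualBump c₁ q Ω u x y‖ₑ ^ q' := setLIntegral_le_lintegral _ _
      _ = ∫⁻ y in ball x (c₁ * bdryDist Ω x), ‖dualBump c₁ q Ω u x y‖ₑ ^ q' := by
          rw [← setLIntegral_univ]
          symm
          refine setLIntegral_eq_of_subset_of_eq_zero measurableSet_ball MeasurableSet.univ
            (subset_univ _) fun y _ hy => ?_
          rw [dualBump_eq_zero_of_notMem hy, enorm_zero, ENNReal.zero_rpow_of_pos hq0']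
      _ = ∫⁻ y in ball x (c₁ * bdryDist Ω x), ‖u y‖ₑ ^ q * (w ^ (1 - q) / V) ^ q' := by
          refine setLIntegral_congr_fun measurableSet_ball fun y hy => ?_
          rw [enorm_dualBump hc₁.1 hq.lt hδ h0 ht hy, ENNReal.mul_rpow_of_nonneg _ _ hq0'.le,
            ← ENNReal.rpow_mul, hq.sub_one_mul_conj]
      _ = w ^ q * V * (w ^ (1 - q) / V) ^ q' := by
          rw [lintegral_mul_const' _ _ (ENNReal.rpow_ne_top_of_nonneg hq0'.le (ENNReal.div_ne_top
            (ENNReal.rpow_ne_top_of_ne_zero h0 ht) hV0)), setLIntegral_eq_localMean hc₁.1 hq0 u hδ]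
      _ = w ^ q * w ^ ((1 - q) * q') * (V * V⁻¹ ^ q') := by
          rw [div_eq_mul_inv, ENNReal.mul_rpow_of_nonneg _ _ hq0'.le, ← ENNReal.rpow_mul]
          ring
      _ = V * V⁻¹ ^ q' := by
          have : (1 - q) * q' = -q := by have := hq.sub_one_mul_conj; linarith
          rw [this, ← ENNReal.rpow_add _ _ h0 ht, add_neg_cancel, ENNReal.rpow_zero, one_mul]
  calc localMean c₂ q' Ω (dualBump c₁ q Ω u x) z
      = ((∫⁻ y in ball z (c₂ * bdryDist Ω z), ‖dualBump c₁ q Ω u x y‖ₑ ^ q') / Vz) ^ (1 / q') := by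
        rw [localMean, setLAverage_eq]
    _ ≤ (ENNReal.ofReal ((3 * c₁ / c₂) ^ (n + 1)) * V⁻¹ ^ q') ^ (1 / q') := by
        gcongr ?_ ^ (1 / q')
        rw [ENNReal.div_le_iff_le_mul (Or.inl hVz0) (Or.inl hVzt)]
        refine hint.trans ?_
        rw [mul_right_comm]
        gcongr
    _ = _ := by
        rw [ENNReal.mul_rpow_of_nonneg _ _ (by positivity), ← ENNReal.rpow_mul,
          mul_one_div_cancel hq0'.ne', ENNReal.rpow_one]

/-- The mass that the local mean of a dual function puts on the domain is bounded. -/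
lemma lintegral_localMean_dualBump_le (hΩ : IsRegular C Ω) (hq : q.HolderConjugate q')
    (hc₁ : c₁ ∈ Ioc (0 : ℝ) (1 / 2)) (hc₂ : c₂ ∈ Ioc (0 : ℝ) (1 / 2)) (hu : MemLqLoc q Ω u)
    (x : E n) :
    ∫⁻ z, localMean c₂ q' Ω (dualBump c₁ q Ω u x) z ≤
      ENNReal.ofReal ((3 * c₁ / c₂) ^ (n + 1)) ^ (1 / q') *
        ENNReal.ofReal ((2 / c₁) ^ (n + 1)) := by
  by_cases hx : x ∈ Ω
  swap
  · have : ∀ z, localMean c₂ q' Ω (dualBump c₁ q Ω u x) z = 0 := fun z =>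
      localMean_dualBump_eq_zero hq fun y hy => by
        rw [ball_eq_empty_of_notMem hx] at hy
        exact hy.elim
    simp [this]
  have hδ := (bdryDist_pos_iff hΩ.isOpen hΩ.ne_univ).2 hx
  have h10 := hc₁.1
  have hV0 := volume_ball_ne_zero (mul_pos hc₁.1 hδ) x
  have hVt := volume_ball_ne_top x (c₁ * bdryDist Ω x)
  set K := ENNReal.ofReal ((3 * c₁ / c₂) ^ (n + 1)) ^ (1 / q') with hK
  calc ∫⁻ z, localMean c₂ q' Ω (dualBump c₁ q Ω u x) z
      = ∫⁻ z in ball x (2 * bdryDist Ω x), localMean c₂ q' Ω (dualBump c₁ q Ω u x) z := by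
        rw [← setLIntegral_univ]
        symm
        refine setLIntegral_eq_of_subset_of_eq_zero measurableSet_ball MeasurableSet.univ
          (subset_univ _) fun z _ hz => localMean_dualBump_eq_zero hq fun y hy hyz => hz ?_
        rw [mem_ball, dist_comm]
        exact (bdryDist_comparable hc₁.2 hc₂.2 hy hyz).2.2.2
    _ ≤ ∫⁻ z in ball x (2 * bdryDist Ω x), K * (volume (ball x (c₁ * bdryDist Ω x)))⁻¹ :=
        lintegral_mono fun z => localMean_dualBump_le hΩ hq hc₁ hc₂ hu x z
    _ = K * ENNReal.ofReal ((2 / c₁) ^ (n + 1)) := by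
        have : volume (ball x (2 * bdryDist Ω x)) =
            ENNReal.ofReal ((2 / c₁) ^ (n + 1)) * volume (ball x (c₁ * bdryDist Ω x)) := by
          rw [show 2 * bdryDist Ω x = 2 / c₁ * (c₁ * bdryDist Ω x) by field_simp,
            volume_ball_mul x (by positivity : 0 < 2 / c₁),
            Measure.addHaar_ball_center volume x]
        rw [setLIntegral_const, this, mul_assoc,
          mul_left_comm _ (ENNReal.ofReal ((2 / c₁) ^ (n + 1))),
          ENNReal.inv_mul_cancel hV0 hVt, mul_one]

/-- The local mean of a dual function puts no mass on a boundary ball unless the boundary ball below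
its base point lies in a fixed dilate of that ball. -/
lemma setLIntegral_localMean_dualBump_eq_zero (hΩ : IsOpen Ω) (hq : q.HolderConjugate q')
    (hc₁ : c₁ ≤ 1 / 2) (hc₂ : c₂ ≤ 1 / 2) {α : ℝ} (hα : 0 < α) {x ξ : E n} (hξ : ξ ∈ frontier Ω)
    {r : ℝ} (hsub : ¬ball x ((1 + α) * bdryDist Ω x) ⊆ ball ξ ((10 + 3 * α) * r)) :
    ∫⁻ z in ball ξ r ∩ Ω, localMean c₂ q' Ω (dualBump c₁ q Ω u x) z = 0 := by
  rw [setLIntegral_congr_fun (g := fun _ => 0) (measurableSet_ball.inter hΩ.measurableSet),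
    lintegral_zero]
  intro z hz
  refine localMean_dualBump_eq_zero hq fun y hy hyz => hsub ?_
  obtain ⟨h1, h2, h3, h4⟩ := bdryDist_comparable hc₁ hc₂ hy hyz
  have h5 := bdryDist_le_dist_of_mem_frontier hΩ (x := z) hξ
  have h6 : dist z ξ < r := hz.1
  intro v hv
  rw [mem_ball] at hv ⊢
  have h7 := dist_triangle4 v x z ξ
  have h8 : (1 + α) * bdryDist Ω x ≤ (1 + α) * (3 * r) := by
    gcongr
    linarith
  nlinarith

end DualBump

/-! ### The space `C` is norming for the nontangential maximal functional -/

/-- The absorption that ends each norming argument: the test function depends on the quantity being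
estimated, whose power `1 / p'` is then divided out, provided that it is finite. -/
lemma rpow_one_div_le_of_le_mul_rpow {p p' : ℝ} (hp : p.HolderConjugate p') {I T : ℝ≥0∞}
    (hI : I ≠ ∞) (h : I ≤ T * I ^ (1 / p')) : I ^ (1 / p) ≤ T := by
  have hp0 := hp.pos
  have hp0' := hp.symm.pos
  rcases eq_or_ne I 0 with rfl | h0
  · simp [hp0]
  have h1 : I = I ^ (1 / p) * I ^ (1 / p') := by
    rw [← ENNReal.rpow_add _ _ h0 hI, one_div, one_div, hp.inv_add_inv_eq_one, ENNReal.rpow_one]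
  have h2 : I ^ (1 / p') ≠ 0 := (ENNReal.rpow_pos (pos_iff_ne_zero.2 h0) hI).ne'
  have h3 : I ^ (1 / p') ≠ ∞ := ENNReal.rpow_ne_top_of_nonneg (by positivity) hI
  rw [← ENNReal.mul_le_mul_iff_left h2 h3, ← h1]
  exact h

/-- A superposition of dual functions, with the masses that a boundary density `g` gives to
disjoint subsets of the boundary balls below the base points as coefficients, has Carleson
functional controlled by the maximal function of `g`. -/
lemma exists_bdryNorm_carleson_sum_dualBump_le (hn : 1 ≤ n) (C : ℝ≥0) {p q q' : ℝ} (hp : 1 < p)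
    (hq : q.HolderConjugate q') {α : ℝ} (hα : 0 < α) {c₁ c₂ : ℝ}
    (hc₁ : c₁ ∈ Ioc (0 : ℝ) (1 / 2)) (hc₂ : c₂ ∈ Ioc (0 : ℝ) (1 / 2)) :
    ∃ A : ℝ≥0, ∀ Ω : Set (E n), IsRegular C Ω → ∀ u : E n → ℝ, Measurable u → MemLqLoc q Ω u →
      ∀ (s : Finset ℕ) (x : ℕ → E n) (V : ℕ → Set (E n)), (∀ i, MeasurableSet (V i)) →
      Pairwise (Function.onFun Disjoint V) →
      (∀ i, V i ⊆ ball (x i) ((1 + α) * bdryDist Ω (x i))) →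
      ∀ g : E n → ℝ≥0∞, Measurable g →
        bdryNorm p Ω (carleson c₂ q' Ω (∑ i ∈ s,
          ((surfaceMeasure Ω).withDensity g (V i)).toReal • dualBump c₁ q Ω u (x i))) ≤
        A * bdryNorm p Ω g := by
  obtain ⟨A, hA⟩ := exists_bdryNorm_maximal_le hn C hp
  have hq0' := hq.symm.pos
  set K : ℝ≥0∞ := ENNReal.ofReal ((3 * c₁ / c₂) ^ (n + 1)) ^ (1 / q') *
    ENNReal.ofReal ((2 / c₁) ^ (n + 1)) with hK
  have hKt : K ≠ ∞ := ENNReal.mul_ne_top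
    (ENNReal.rpow_ne_top_of_nonneg (by positivity) ENNReal.ofReal_ne_top) ENNReal.ofReal_ne_top
  have hBt : K * ENNReal.ofReal ((10 + 3 * α) ^ n) ≠ ∞ := by finiteness
  set B : ℝ≥0 := (K * ENNReal.ofReal ((10 + 3 * α) ^ n)).toNNReal with hB
  refine ⟨B * A, fun Ω hΩ u hum hu s x V hV hdisj hVsub g hg => ?_⟩
  set μ : Measure (E n) := (surfaceMeasure Ω).withDensity g with hμ
  set H : E n → ℝ := ∑ i ∈ s, (μ (V i)).toReal • dualBump c₁ q Ω u (x i) with hH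
  have hball : ∀ ξ ∈ frontier Ω, ∀ r : ℝ, 0 < r →
      (volume.restrict Ω).withDensity (localMean c₂ q' Ω H) (ball ξ r) ≤
        K * μ (ball ξ ((10 + 3 * α) * r)) := by
    intro ξ hξ r hr
    rw [withDensity_apply _ measurableSet_ball, Measure.restrict_restrict measurableSet_ball]
    have hmean : ∀ z, localMean c₂ q' Ω H z ≤
        ∑ i ∈ s, μ (V i) * localMean c₂ q' Ω (dualBump c₁ q Ω u (x i)) z := by
      intro z
      refine (localMean_sum_le hc₂ hq.symm.lt.le s (fun i =>
        (measurable_dualBump hum (x i)).const_smul _) z).trans (Finset.sum_le_sum fun i _ => ?_)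
      rw [localMean_smul hq.symm.lt.le, Real.enorm_of_nonneg ENNReal.toReal_nonneg]
      gcongr
      exact ENNReal.ofReal_toReal_le
    calc ∫⁻ z in ball ξ r ∩ Ω, localMean c₂ q' Ω H z
        ≤ ∫⁻ z in ball ξ r ∩ Ω, ∑ i ∈ s, μ (V i) *
            localMean c₂ q' Ω (dualBump c₁ q Ω u (x i)) z := lintegral_mono hmean
      _ = ∑ i ∈ s, μ (V i) * ∫⁻ z in ball ξ r ∩ Ω,
            localMean c₂ q' Ω (dualBump c₁ q Ω u (x i)) z := by
          rw [lintegral_finsetSum s fun i _ => (measurable_localMean _ _ _ _).const_mul _]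
          exact Finset.sum_congr rfl fun i _ =>
            lintegral_const_mul _ (measurable_localMean _ _ _ _)
      _ ≤ ∑ i ∈ s, K * μ (V i ∩ ball ξ ((10 + 3 * α) * r)) := by
          refine Finset.sum_le_sum fun i _ => ?_
          by_cases hsub : ball (x i) ((1 + α) * bdryDist Ω (x i)) ⊆ ball ξ ((10 + 3 * α) * r)
          · rw [inter_eq_self_of_subset_left ((hVsub i).trans hsub), mul_comm]
            gcongr
            exact (setLIntegral_le_lintegral _ _).trans
              (lintegral_localMean_dualBump_le hΩ hq hc₁ hc₂ hu (x i))
          · rw [setLIntegral_localMean_dualBump_eq_zero hΩ.isOpen hq hc₁.2 hc₂.2 hα hξ hsub,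
              mul_zero]
            exact zero_le
      _ = K * μ (⋃ i ∈ s, (V i ∩ ball ξ ((10 + 3 * α) * r))) := by
          rw [← Finset.mul_sum, measure_biUnion_finset]
          · exact fun i _ j _ hij => (hdisj hij).mono inter_subset_left inter_subset_left
          · exact fun i _ => (hV i).inter measurableSet_ball
      _ ≤ _ := by
          gcongr
          exact iUnion₂_subset fun i _ => inter_subset_right
  calc bdryNorm p Ω (carleson c₂ q' Ω H) ≤ B * bdryNorm p Ω (maximal μ) := by
        refine bdryNorm_le_mul hp Ω B fun ξ hξ => ?_
        rw [carleson_eq_maximal, hB, ENNReal.coe_toNNReal hBt]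
        exact maximal_le_mul_of_measure_ball_le (by positivity) (hball ξ hξ)
    _ ≤ B * (A * bdryNorm p Ω g) := by
        gcongr
        exact hA Ω hΩ g hg
    _ = _ := by rw [ENNReal.coe_mul, mul_assoc]

/-- The nontangential maximal function is a supremum over a countable dense set of points. -/
lemma ntMax_eq_iSup_denseSeq {C : ℝ≥0} {Ω : Set (E n)} (hΩ : IsRegular C Ω) {α c q : ℝ}
    (hc : 0 < c) (hq : 0 < q) (u : E n → ℝ) (ξ : E n) :
    ntMax α c q Ω u ξ = ⨆ i : ℕ, {ξ | TopologicalSpace.denseSeq (E n) i ∈ cone α Ω ξ}.indicator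
      (fun _ => localMean c q Ω u (TopologicalSpace.denseSeq (E n) i)) ξ := by
  apply le_antisymm
  · refine iSup₂_le fun x hx => le_of_forall_lt fun a ha => ?_
    have hopen : ∀ᶠ y in 𝓝 x, y ∈ cone α Ω ξ := by
      refine Filter.Eventually.and (hΩ.isOpen.mem_nhds hx.1) ?_
      exact (continuous_id.dist continuous_const).continuousAt.eventually_lt
        (continuous_const.mul (continuous_bdryDist Ω)).continuousAt hx.2
    obtain ⟨i, hi⟩ := (TopologicalSpace.denseRange_denseSeq (E n)).exists_mem_open
      isOpen_interior ⟨x, mem_interior_iff_mem_nhds.2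
        (hopen.and (eventually_lt_localMean hΩ hc hq u hx.1 ha))⟩
    obtain ⟨h1, h2⟩ := interior_subset hi
    refine lt_iSup_iff.2 ⟨i, ?_⟩
    rw [indicator_of_mem (by exact h1)]
    exact h2
  · refine iSup_le fun i => ?_
    by_cases h : TopologicalSpace.denseSeq (E n) i ∈ cone α Ω ξ
    · rw [indicator_of_mem (by exact h)]
      exact le_iSup₂ (f := fun x (_ : x ∈ cone α Ω ξ) => localMean c q Ω u x) _ h
    · rw [indicator_of_notMem (by exact h)]
      exact zero_le

lemma iSup_rpow {ι : Sort*} (f : ι → ℝ≥0∞) {p : ℝ} (hp : 0 < p) :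
    (⨆ i, f i) ^ p = ⨆ i, f i ^ p := (ENNReal.orderIsoRpow p hp).map_iSup f

lemma bdryNorm_iSup {p : ℝ} (hp : 1 < p) (Ω : Set (E n)) {f : ℕ → E n → ℝ≥0∞}
    (hf : ∀ k, Measurable (f k)) (hmono : Monotone f) :
    bdryNorm p Ω (fun ξ => ⨆ k, f k ξ) = ⨆ k, bdryNorm p Ω (f k) := by
  have hp0 : 0 < p := by linarith
  unfold bdryNorm
  simp_rw [iSup_rpow _ hp0]
  rw [lintegral_iSup (fun k => (hf k).pow_const p) fun k l hkl ξ =>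
    ENNReal.rpow_le_rpow (hmono hkl ξ) hp0.le, iSup_rpow _ (by positivity)]

/-- Norming for the nontangential maximal functional. The supremum over each cone is linearized:
for finitely many base points, the set where a given one realizes the maximum is a piece of the
boundary, and the dual functions are superposed with the masses of these pieces. It suffices to test
against nonnegative functions of compact support bounded by a multiple of `|u| ^ (q - 1)`. -/
theorem exists_bdryNorm_ntMax_le (hn : 1 ≤ n) (C : ℝ≥0) {p p' q q' : ℝ}
    (hp : p.HolderConjugate p') (hq : q.HolderConjugate q') {α : ℝ} (hα : 0 < α) {c₁ c₂ : ℝ}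
    (hc₁ : c₁ ∈ Ioc (0 : ℝ) (1 / 2)) (hc₂ : c₂ ∈ Ioc (0 : ℝ) (1 / 2)) :
    ∃ A : ℝ≥0, ∀ Ω : Set (E n), IsRegular C Ω → ∀ u : E n → ℝ, Measurable u → MemLqLoc q Ω u →
      ∀ S : ℝ≥0∞, (∀ H : E n → ℝ, Measurable H → (∀ y, 0 ≤ H y) →
        (∃ B : ℝ, ∀ y, H y ≤ B * |u y| ^ (q - 1)) →
        (∃ K ⊆ Ω, IsCompact K ∧ ∀ y ∉ K, H y = 0) →
        bdryNorm p' Ω (carleson c₂ q' Ω H) < ∞ →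
        ∫⁻ y in Ω, ‖u y * H y‖ₑ ≤ S * bdryNorm p' Ω (carleson c₂ q' Ω H)) →
      bdryNorm p Ω (ntMax α c₁ q Ω u) ≤ A * S := by
  obtain ⟨A, hA⟩ := exists_bdryNorm_carleson_sum_dualBump_le hn C hp.symm.lt hq hα hc₁ hc₂
  refine ⟨A, fun Ω hΩ u hum hu S hS => ?_⟩
  have := hΩ.isLocallyFiniteMeasure
  have hp0 := hp.pos
  have hp0' := hp.symm.pos
  set σ := surfaceMeasure Ω with hσ
  set x : ℕ → E n := TopologicalSpace.denseSeq (E n) with hx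
  set w : ℕ → ℝ≥0∞ := fun i => localMean c₁ q Ω u (x i) with hw
  have hwt : ∀ i, w i ≠ ∞ := fun i => (localMean_lt_top hΩ hc₁ hq.pos hu (x i)).ne
  set U : ℕ → Set (E n) := fun i => {ξ | x i ∈ cone α Ω ξ} with hU
  have hUopen : ∀ i, IsOpen (U i) := fun i => by
    have h1 : IsOpen {ξ : E n | dist (x i) ξ < (1 + α) * bdryDist Ω (x i)} :=
      isOpen_lt (continuous_const.dist continuous_id) continuous_const
    exact (isOpen_const (p := x i ∈ Ω)).inter h1
  have hUsub : ∀ i, U i ⊆ ball (x i) ((1 + α) * bdryDist Ω (x i)) := fun i ξ hξ => by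
    rw [mem_ball, dist_comm]
    exact hξ.2
  have hUfin : ∀ i, σ (U i) < ∞ := fun i => (measure_mono (hUsub i)).trans_lt measure_ball_lt_top
  set f : ℕ → E n → ℝ≥0∞ := fun i => (U i).indicator fun _ => w i with hf
  have hfm : ∀ i, Measurable (f i) := fun i => measurable_const.indicator (hUopen i).measurableSet
  have hfU : ∀ i, ∀ ξ ∈ U i, f i ξ = w i := fun i ξ h => indicator_of_mem h _
  have hf0 : ∀ i, ∀ ξ ∉ U i, f i ξ = 0 := fun i ξ h => indicator_of_notMem h _
  set N : ℕ → E n → ℝ≥0∞ := fun k ξ => (Finset.range k).sup fun i => f i ξ with hN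
  have hNm : ∀ k, Measurable (N k) := fun k => by
    simp only [hN, Finset.sup_eq_iSup]
    exact Measurable.biSup _ (to_countable _) fun i _ => hfm i
  have hNmono : Monotone N := fun k l hkl ξ =>
    Finset.sup_mono (Finset.range_mono hkl)
  have hNsup : ntMax α c₁ q Ω u = fun ξ => ⨆ k, N k ξ := by
    funext ξ
    rw [ntMax_eq_iSup_denseSeq hΩ hc₁.1 hq.pos]
    apply le_antisymm
    · exact iSup_le fun i => le_iSup_of_le (i + 1)
        (Finset.le_sup (f := fun i => f i ξ) (Finset.self_mem_range_succ i))
    · exact iSup_le fun k => Finset.sup_le fun i _ => le_iSup (fun i => f i ξ) i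
  rw [hNsup, bdryNorm_iSup hp.lt Ω hNm hNmono]
  refine iSup_le fun k => ?_
  -- The maximum is attained, and the pieces `V i` are where `i` is the first maximizer.
  have hmax : ∀ ξ, N k ξ ≠ 0 → ∃ i ∈ Finset.range k, f i ξ = N k ξ := by
    intro ξ hξ
    have hne : (Finset.range k).Nonempty := by
      by_contra h
      rw [Finset.not_nonempty_iff_eq_empty] at h
      exact hξ (by simp [hN, h])
    obtain ⟨i, hi, h⟩ := Finset.exists_mem_eq_sup _ hne fun i => f i ξ
    exact ⟨i, hi, h.symm⟩
  set V : ℕ → Set (E n) := fun i =>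
    (U i ∩ {ξ | f i ξ = N k ξ}) ∩ ⋂ j ∈ Iio i, {ξ | f j ξ = N k ξ}ᶜ with hV
  have hVm : ∀ i, MeasurableSet (V i) := fun i =>
    ((hUopen i).measurableSet.inter (measurableSet_eq_fun (hfm i) (hNm k))).inter
      (MeasurableSet.biInter (to_countable _) fun j _ =>
        (measurableSet_eq_fun (hfm j) (hNm k)).compl)
  have hVdisj : Pairwise (Function.onFun Disjoint V) := by
    intro i j hij
    refine disjoint_left.2 fun ξ hi hj => ?_
    rcases lt_or_gt_of_ne hij with h | h
    · exact mem_iInter₂.1 hj.2 i h hi.1.2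
    · exact mem_iInter₂.1 hi.2 j h hj.1.2
  have hVU : ∀ i, V i ⊆ U i := fun i ξ h => h.1.1
  -- `g` is dual to `N k`: `∫ (N k) g = ‖N k‖_p^p` and `‖g‖_{p'} = ‖N k‖_p^{p-1}`.
  set g : E n → ℝ≥0∞ := fun ξ => N k ξ ^ (p - 1) with hg
  have hgm : Measurable g := (hNm k).pow_const _
  have hp1 : 0 < p - 1 := by linarith [hp.lt]
  set μ : Measure (E n) := σ.withDensity g with hμ
  have hpt : ∀ ξ, N k ξ * g ξ ≤
      ∑ i ∈ Finset.range k, (V i).indicator (fun ξ => w i * g ξ) ξ := by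
    intro ξ
    rcases eq_or_ne (N k ξ) 0 with h0 | h0
    · rw [h0, zero_mul]
      exact zero_le
    obtain ⟨i, hi, hfi⟩ := hmax ξ h0
    have hex : ∃ i, f i ξ = N k ξ := ⟨i, hfi⟩
    classical
    set j := Nat.find hex with hj
    have hjk : j ∈ Finset.range k :=
      Finset.mem_range.2 ((Nat.find_min' hex hfi).trans_lt (Finset.mem_range.1 hi))
    have hfj : f j ξ = N k ξ := Nat.find_spec hex
    have hjU : ξ ∈ U j := by
      by_contra h
      exact h0 (by rw [← hfj, hf0 j ξ h])
    have hjV : ξ ∈ V j :=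
      ⟨⟨hjU, hfj⟩, mem_iInter₂.2 fun l hl => Nat.find_min hex hl⟩
    have hwj : w j = N k ξ := by rw [← hfj, hfU j ξ hjU]
    refine le_trans ?_ (Finset.single_le_sum (f := fun i => (V i).indicator (fun ξ => w i * g ξ) ξ)
      (fun _ _ => zero_le) hjk)
    rw [indicator_of_mem hjV, hwj]
  set I : ℝ≥0∞ := ∫⁻ ξ, N k ξ ^ p ∂σ with hI
  -- Finiteness, needed for the absorption: `N k` is bounded with bounded support.
  have hIfin : I ≠ ∞ := by
    have hle : ∀ ξ, N k ξ ^ p ≤ ∑ i ∈ Finset.range k, (U i).indicator (fun _ => w i ^ p) ξ := by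
      intro ξ
      rcases eq_or_ne (N k ξ) 0 with h0 | h0
      · rw [h0, ENNReal.zero_rpow_of_pos hp0]
        exact zero_le
      obtain ⟨i, hi, hfi⟩ := hmax ξ h0
      have hiU : ξ ∈ U i := by
        by_contra h
        exact h0 (by rw [← hfi, hf0 i ξ h])
      refine le_trans (le_of_eq ?_) (Finset.single_le_sum
        (f := fun i => (U i).indicator (fun _ => w i ^ p) ξ) (fun _ _ => zero_le) hi)
      rw [indicator_of_mem hiU, ← hfi, hfU i ξ hiU]
    refine ne_of_lt ((lintegral_mono hle).trans_lt ?_)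
    rw [lintegral_finsetSum _ fun i _ => measurable_const.indicator (hUopen i).measurableSet]
    refine ENNReal.sum_lt_top.2 fun i _ => ?_
    rw [lintegral_indicator_const (hUopen i).measurableSet]
    exact ENNReal.mul_lt_top (ENNReal.rpow_lt_top_of_nonneg hp0.le (hwt i)) (hUfin i)
  have hμV : ∀ i, μ (V i) ≠ ∞ := by
    intro i
    rw [hμ, withDensity_apply _ (hVm i)]
    have : ∫⁻ ξ in V i, g ξ ∂σ ≤ ∫⁻ ξ in V i, w i ^ (p - 1) ∂σ := by
      refine setLIntegral_mono measurable_const fun ξ hξ => ?_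
      have : N k ξ = w i := by
        rw [← hfU i ξ hξ.1.1]
        exact hξ.1.2.symm
      rw [hg]
      simp only [this, le_refl]
    refine ne_of_lt (this.trans_lt ?_)
    rw [setLIntegral_const]
    exact ENNReal.mul_lt_top (ENNReal.rpow_lt_top_of_nonneg hp1.le (hwt i))
      ((measure_mono (hVU i)).trans_lt (hUfin i))
  have hIle : I ≤ ∑ i ∈ Finset.range k, μ (V i) * w i := by
    calc I = ∫⁻ ξ, N k ξ * g ξ ∂σ := by
          refine lintegral_congr fun ξ => ?_
          rw [hg]
          nth_rewrite 2 [← ENNReal.rpow_one (N k ξ)]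
          rw [← ENNReal.rpow_add_of_nonneg _ _ zero_le_one hp1.le, add_sub_cancel]
      _ ≤ ∫⁻ ξ, ∑ i ∈ Finset.range k, (V i).indicator (fun ξ => w i * g ξ) ξ ∂σ :=
          lintegral_mono hpt
      _ = ∑ i ∈ Finset.range k, μ (V i) * w i := by
          rw [lintegral_finsetSum _ fun i _ => (hgm.const_mul _).indicator (hVm i)]
          refine Finset.sum_congr rfl fun i _ => ?_
          rw [lintegral_indicator (hVm i), lintegral_const_mul _ hgm, hμ,
            withDensity_apply _ (hVm i), mul_comm]
  set H : E n → ℝ := ∑ i ∈ Finset.range k, (μ (V i)).toReal • dualBump c₁ q Ω u (x i) with hH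
  have hHapp : ∀ y, H y =
      ∑ i ∈ Finset.range k, (μ (V i)).toReal * dualBump c₁ q Ω u (x i) y := fun y => by
    rw [hH, Finset.sum_apply]
    rfl
  have hHnn : ∀ y, 0 ≤ H y := fun y => by
    rw [hHapp]
    exact Finset.sum_nonneg fun i _ => mul_nonneg ENNReal.toReal_nonneg (dualBump_nonneg _ _)
  have hHm : Measurable H := by
    rw [hH, Finset.sum_fn]
    exact Finset.measurable_sum _ fun i _ => (measurable_dualBump hum (x i)).const_smul _
  have hHint : ∫⁻ y in Ω, ‖u y * H y‖ₑ = ∑ i ∈ Finset.range k, μ (V i) * w i := by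
    have : ∀ y, ‖u y * H y‖ₑ =
        ∑ i ∈ Finset.range k, μ (V i) * ‖u y * dualBump c₁ q Ω u (x i) y‖ₑ := by
      intro y
      rw [enorm_mul, Real.enorm_of_nonneg (hHnn y), hHapp, ENNReal.ofReal_sum_of_nonneg fun i _ =>
        mul_nonneg ENNReal.toReal_nonneg (dualBump_nonneg _ _), Finset.mul_sum]
      refine Finset.sum_congr rfl fun i _ => ?_
      rw [ENNReal.ofReal_mul ENNReal.toReal_nonneg, ENNReal.ofReal_toReal (hμV i), enorm_mul,
        Real.enorm_of_nonneg (dualBump_nonneg _ _)]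
      ring
    have hm : ∀ i, Measurable fun y => ‖u y * dualBump c₁ q Ω u (x i) y‖ₑ := fun i =>
      (hum.mul (measurable_dualBump hum (x i))).enorm
    simp_rw [this]
    rw [lintegral_finsetSum _ fun i _ => (hm i).const_mul _]
    refine Finset.sum_congr rfl fun i _ => ?_
    rw [lintegral_const_mul _ (hm i), lintegral_mul_dualBump hΩ hc₁ hq.lt hu]
  have hgnorm : bdryNorm p' Ω g = I ^ (1 / p') := by
    rw [bdryNorm, hI]
    simp_rw [hg, ← ENNReal.rpow_mul, hp.sub_one_mul_conj]
    rfl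
  have hHnorm : bdryNorm p' Ω (carleson c₂ q' Ω H) ≤ A * I ^ (1 / p') := by
    rw [← hgnorm]
    exact hA Ω hΩ u hum hu _ x V hVm hVdisj (fun i => (hVU i).trans (hUsub i)) g hgm
  have hfinal : I ≤ (A * S) * I ^ (1 / p') := by
    calc I ≤ ∫⁻ y in Ω, ‖u y * H y‖ₑ := hIle.trans hHint.ge
      _ ≤ S * bdryNorm p' Ω (carleson c₂ q' Ω H) := by
          refine hS H hHm hHnn ?_ ?_ (hHnorm.trans_lt (ENNReal.mul_lt_top ENNReal.coe_lt_top
            (ENNReal.rpow_lt_top_of_nonneg (by positivity) hIfin)))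
          · refine ⟨∑ i ∈ Finset.range k, (μ (V i)).toReal * ((w i).toReal ^ (1 - q) /
              (volume (ball (x i) (c₁ * bdryDist Ω (x i)))).toReal), fun y => ?_⟩
            rw [hHapp, Finset.sum_mul]
            refine Finset.sum_le_sum fun i _ => ?_
            rw [mul_assoc]
            refine mul_le_mul_of_nonneg_left ?_ ENNReal.toReal_nonneg
            rw [dualBump, mul_comm (_ / _)]
            exact indicator_le_self' (fun _ _ => by positivity) y
          · have hKi : ∀ i, ∃ K ⊆ Ω, IsCompact K ∧
                ball (x i) (c₁ * bdryDist Ω (x i)) ⊆ K := fun i => by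
              by_cases hxi : x i ∈ Ω
              · exact ⟨closedBall (x i) (c₁ * bdryDist Ω (x i)), closedBall_subset_of_mem hc₁
                  ((bdryDist_pos_iff hΩ.isOpen hΩ.ne_univ).2 hxi), isCompact_closedBall _ _,
                  ball_subset_closedBall⟩
              · exact ⟨∅, empty_subset _, isCompact_empty, (ball_eq_empty_of_notMem hxi).subset⟩
            choose K hKΩ hKc hKb using hKi
            refine ⟨⋃ i ∈ Finset.range k, K i, iUnion₂_subset fun i _ => hKΩ i,
              (Finset.range k).isCompact_biUnion fun i _ => hKc i, fun y hy => ?_⟩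
            rw [hHapp]
            refine Finset.sum_eq_zero fun i hi => ?_
            rw [dualBump_eq_zero_of_notMem fun h => hy (mem_iUnion₂.2 ⟨i, hi, hKb i h⟩), mul_zero]
      _ ≤ S * (A * I ^ (1 / p')) := by gcongr
      _ = _ := by ring
  exact rpow_one_div_le_of_le_mul_rpow hp hIfin hfinal

/-! ### Functions supported in the exhaustion -/

lemma bdryDist_le_of_mem_exhaustion {Ω : Set (E n)} {j : ℕ} {x : E n} (hx : x ∈ exhaustion Ω j) :
    bdryDist Ω x ≤ bdryDist Ω 0 + j := by
  have h1 := bdryDist_le_add_dist Ω x 0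
  have h2 := mem_closedBall.1 hx.2
  linarith

/-- The Whitney balls of the points of a member of the exhaustion lie in a later member. -/
lemma exists_ball_subset_exhaustion (Ω : Set (E n)) (j : ℕ) :
    ∃ l, ∀ x ∈ exhaustion Ω j, ball x (1 / 2 * bdryDist Ω x) ⊆ exhaustion Ω l := by
  obtain ⟨m, hm⟩ := exists_nat_ge (bdryDist Ω 0 + 2 * j)
  refine ⟨max (2 * j + 1) m, fun x hx y hy => ⟨?_, ?_⟩⟩
  · have h1 : 1 / ((j : ℝ) + 1) ≤ bdryDist Ω x := hx.1
    have h2 := bdryDist_le_add_dist Ω x y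
    have h3 := mem_ball'.1 hy
    have h4 : 1 / (((max (2 * j + 1) m : ℕ) : ℝ) + 1) ≤ 1 / (((2 * j + 1 : ℕ) : ℝ) + 1) :=
      Nat.one_div_le_one_div (le_max_left _ _)
    have h5 : 1 / (((2 * j + 1 : ℕ) : ℝ) + 1) = 1 / 2 * (1 / ((j : ℝ) + 1)) := by
      push_cast
      field_simp
      ring
    change _ ≤ bdryDist Ω y
    linarith
  · have h1 := bdryDist_le_of_mem_exhaustion hx
    have h2 := mem_closedBall.1 hx.2
    have h3 := mem_ball.1 hy
    have h4 := dist_triangle y x 0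
    have h5 : (m : ℝ) ≤ ((max (2 * j + 1) m : ℕ) : ℝ) := by exact_mod_cast le_max_right _ _
    have h6 := bdryDist_nonneg Ω 0
    rw [mem_closedBall]
    linarith

/-- Local means are bounded on the members of the exhaustion. -/
lemma exists_localMean_le_of_mem_exhaustion {Ω : Set (E n)} {c q : ℝ}
    (hc : c ∈ Ioc (0 : ℝ) (1 / 2)) (hq : 0 < q) {u : E n → ℝ} (hu : MemLqLoc q Ω u) (j : ℕ) :
    ∃ M : ℝ≥0∞, M ≠ ∞ ∧ ∀ x ∈ exhaustion Ω j, localMean c q Ω u x ≤ M := by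
  obtain ⟨l, hl⟩ := exists_ball_subset_exhaustion Ω j
  have hc0 := hc.1
  set d : ℝ := c * (1 / ((j : ℝ) + 1)) with hd
  have hd0 : 0 < d := by positivity
  refine ⟨((∫⁻ y in exhaustion Ω l, ‖u y‖ₑ ^ q) / volume (ball (0 : E n) d)) ^ (1 / q),
    ENNReal.rpow_ne_top_of_nonneg (by positivity) (ENNReal.div_ne_top
      (setLIntegral_rpow_lt_top hq hu (isCompact_exhaustion Ω l) (exhaustion_subset Ω l)).ne
      (volume_ball_ne_zero hd0 0)), fun x hx => ?_⟩
  rw [localMean, setLAverage_eq]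
  have h1 : d ≤ c * bdryDist Ω x := by
    rw [hd]
    gcongr
    exact hx.1
  have h2 : ball x (c * bdryDist Ω x) ⊆ exhaustion Ω l :=
    (ball_subset_ball (mul_le_mul_of_nonneg_right hc.2 (bdryDist_nonneg Ω x))).trans (hl x hx)
  gcongr ?_ ^ (1 / q)
  refine ENNReal.div_le_div (lintegral_mono_set h2) ?_
  calc volume (ball (0 : E n) d) = volume (ball x d) := (Measure.addHaar_ball_center _ _ _).symm
    _ ≤ _ := measure_mono (ball_subset_ball h1)

/-- A bounded function supported in a member of the exhaustion is seen only by the cones with vertex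
in a bounded set, on each of which the area functional is bounded. -/
lemma bdryNorm_area_lt_top {C : ℝ≥0} {Ω : Set (E n)} (hΩ : IsRegular C Ω) {α p : ℝ} (hα : 0 < α)
    (hp : 1 < p) {h : E n → ℝ≥0∞} {j : ℕ} {M : ℝ≥0∞} (hM : M ≠ ∞)
    (hh : ∀ x, h x ≤ (exhaustion Ω j).indicator (fun _ => M) x) :
    bdryNorm p Ω (area α Ω h) < ∞ := by
  have := hΩ.isLocallyFiniteMeasure
  have hp0 : 0 < p := by linarith
  set K := exhaustion Ω j with hK
  set R : ℝ := j + (1 + α) * (bdryDist Ω 0 + j) with hR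
  set T : ℝ≥0∞ := M / ENNReal.ofReal ((1 / ((j : ℝ) + 1)) ^ n) * volume K with hT
  have hd0 : ENNReal.ofReal ((1 / ((j : ℝ) + 1)) ^ n) ≠ 0 :=
    ofReal_pow_ne_zero (by positivity)
  have hTt : T ≠ ∞ := ENNReal.mul_ne_top (ENNReal.div_ne_top hM hd0)
    (isCompact_exhaustion Ω j).measure_lt_top.ne
  have hle : ∀ ξ, area α Ω h ξ ≤ (closedBall (0 : E n) R).indicator (fun _ => T) ξ := by
    intro ξ
    by_cases hξ : ξ ∈ closedBall (0 : E n) R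
    · rw [indicator_of_mem hξ]
      calc area α Ω h ξ ≤ ∫⁻ x in cone α Ω ξ,
            K.indicator (fun _ => M / ENNReal.ofReal ((1 / ((j : ℝ) + 1)) ^ n)) x := by
            refine lintegral_mono fun x => ?_
            by_cases hx : x ∈ K
            · rw [indicator_of_mem hx]
              have h1 := hh x
              rw [indicator_of_mem hx] at h1
              have h2 : 1 / ((j : ℝ) + 1) ≤ bdryDist Ω x := hx.1
              gcongr
            · have h1 := hh x
              rw [indicator_of_notMem hx, nonpos_iff_eq_zero] at h1
              rw [h1, ENNReal.zero_div]
              exact zero_le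
        _ ≤ ∫⁻ x, K.indicator (fun _ => M / ENNReal.ofReal ((1 / ((j : ℝ) + 1)) ^ n)) x :=
            setLIntegral_le_lintegral _ _
        _ = T := by
            rw [lintegral_indicator_const (isCompact_exhaustion Ω j).measurableSet]
    · rw [indicator_of_notMem hξ, nonpos_iff_eq_zero, area]
      rw [setLIntegral_congr_fun (g := fun _ => 0) (measurableSet_cone hΩ.isOpen α ξ),
        lintegral_zero]
      intro x hx
      have hxK : x ∉ K := by
        intro hxK
        apply hξ
        have h1 := bdryDist_le_of_mem_exhaustion hxK
        have h2 := mem_closedBall.1 hxK.2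
        have h3 := dist_triangle_left ξ 0 x
        have h4 := hx.2
        have h5 : (1 + α) * bdryDist Ω x ≤ (1 + α) * (bdryDist Ω 0 + j) := by gcongr
        rw [mem_closedBall]
        linarith
      have h1 := hh x
      rw [indicator_of_notMem hxK, nonpos_iff_eq_zero] at h1
      simp only [h1, ENNReal.zero_div]
  unfold bdryNorm
  refine ENNReal.rpow_lt_top_of_nonneg (by positivity) (ne_of_lt ?_)
  calc ∫⁻ ξ, area α Ω h ξ ^ p ∂(surfaceMeasure Ω)
      ≤ ∫⁻ ξ, (closedBall (0 : E n) R).indicator (fun _ => T ^ p) ξ ∂(surfaceMeasure Ω) := by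
        refine lintegral_mono fun ξ => ?_
        have h1 := hle ξ
        by_cases hξ : ξ ∈ closedBall (0 : E n) R
        · rw [indicator_of_mem hξ] at h1 ⊢
          gcongr
        · rw [indicator_of_notMem hξ, nonpos_iff_eq_zero] at h1
          rw [h1, ENNReal.zero_rpow_of_pos hp0]
          exact zero_le
    _ < ∞ := by
        rw [lintegral_indicator_const measurableSet_closedBall]
        exact ENNReal.mul_lt_top (ENNReal.rpow_lt_top_of_nonneg hp0.le hTt)
          measure_closedBall_lt_top

/-- Finiteness of the nontangential norm forces local integrability: each point lies in the cones
over a set of positive boundary measure. -/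
lemma memLqLoc_of_bdryNorm_ntMax_lt_top {C : ℝ≥0} {Ω : Set (E n)} (hΩ : IsRegular C Ω)
    {α c p q : ℝ} (hα : 0 < α) (hc : c ∈ Ioc (0 : ℝ) (1 / 2)) (hp : 1 < p) (hq : 0 < q)
    {u : E n → ℝ} (hum : AEStronglyMeasurable u (volume.restrict Ω))
    (hu : bdryNorm p Ω (ntMax α c q Ω u) < ∞) : MemLqLoc q Ω u := by
  have hp0 : 0 < p := by linarith
  refine memLqLoc_of_localMean_lt_top hΩ hc hq hum fun x hx => ?_
  have hδ := (bdryDist_pos_iff hΩ.isOpen hΩ.ne_univ).2 hx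
  obtain ⟨ξ, hξ, hxξ⟩ := exists_mem_frontier_dist_eq hΩ.isOpen hΩ.ne_univ hx
  have ha0 : 0 < min α 1 := by positivity
  have hlow := hΩ.lower x hx ξ hξ (min α 1 * bdryDist Ω x) (by positivity)
    (mul_le_of_le_one_left hδ.le (min_le_right _ _))
  set b := ball ξ (min α 1 * bdryDist Ω x) with hb
  have hσ0 : surfaceMeasure Ω b ≠ 0 := by
    intro h0
    rw [h0, mul_zero, nonpos_iff_eq_zero] at hlow
    exact ofReal_pow_ne_zero (by positivity) hlow
  have hle : localMean c q Ω u x ^ p * surfaceMeasure Ω b < ∞ := by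
    rw [← setLIntegral_const]
    have h1 : ∫⁻ ζ, ntMax α c q Ω u ζ ^ p ∂(surfaceMeasure Ω) < ∞ := by
      have := ENNReal.rpow_lt_top_of_nonneg hp0.le hu.ne
      rwa [bdryNorm, ← ENNReal.rpow_mul, one_div_mul_cancel hp0.ne', ENNReal.rpow_one] at this
    refine lt_of_le_of_lt ?_ ((setLIntegral_le_lintegral b _).trans_lt h1)
    refine setLIntegral_mono ((measurable_ntMax ..).pow_const p) fun ζ hζ => ?_
    gcongr
    refine le_ntSup (w := localMean c q Ω u) ⟨hx, ?_⟩
    have h2 := dist_triangle_right x ζ ξ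
    have h3 := mem_ball.1 hζ
    have h4 : min α 1 * bdryDist Ω x ≤ α * bdryDist Ω x := by
      gcongr
      exact min_le_left _ _
    linarith
  by_contra htop
  rw [not_lt, top_le_iff] at htop
  rw [htop, ENNReal.top_rpow_of_pos hp0, ENNReal.top_mul hσ0] at hle
  exact lt_irrefl _ hle

/-! ### Superposition over Whitney balls -/

/-- The superposition `y ↦ ∫ k(x) 1_{B(x, c δ(x))}(y) dx` of indicators of Whitney balls. -/
noncomputable def superpose (c : ℝ) (Ω : Set (E n)) (k : E n → ℝ≥0∞) (y : E n) : ℝ≥0∞ :=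
  ∫⁻ x, k x * whitneyKernel c Ω x y

section Superpose

variable {Ω : Set (E n)} {c c₁ : ℝ}

lemma measurable_superpose {k : E n → ℝ≥0∞} (hk : Measurable k) :
    Measurable (superpose c Ω k) :=
  Measurable.lintegral_prod_left (f := fun x y => k x * whitneyKernel c Ω x y)
    ((hk.comp measurable_fst).mul (measurable_whitneyKernel c Ω))

lemma superpose_eq_zero_of_notMem (hc : c ∈ Ioc (0 : ℝ) (1 / 2)) (k : E n → ℝ≥0∞) {y : E n}
    (hy : y ∉ Ω) : superpose c Ω k y = 0 := by
  have : ∀ x, whitneyKernel c Ω x y = 0 := fun x =>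
    whitneyKernel_of_notMem fun h => hy (ball_subset Ω hc x h)
  simp [superpose, this]

lemma lintegral_mul_superpose {f k : E n → ℝ≥0∞} (hf : Measurable f) (hk : Measurable k) :
    ∫⁻ y, f y * superpose c Ω k y =
      ∫⁻ x, k x * ∫⁻ y in ball x (c * bdryDist Ω x), f y := by
  have hopen : IsOpen {z : E n × E n | dist z.1 z.2 < c * bdryDist Ω z.2} :=
    isOpen_lt (continuous_fst.dist continuous_snd)
      (continuous_const.mul ((continuous_bdryDist Ω).comp continuous_snd))
  have hκ : Measurable fun z : E n × E n => whitneyKernel c Ω z.2 z.1 :=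
    Measurable.ite hopen.measurableSet measurable_const measurable_const
  have hm : Measurable (Function.uncurry fun y x => f y * (k x * whitneyKernel c Ω x y)) :=
    (hf.comp measurable_fst).mul ((hk.comp measurable_snd).mul hκ)
  calc ∫⁻ y, f y * superpose c Ω k y
      = ∫⁻ y, ∫⁻ x, f y * (k x * whitneyKernel c Ω x y) := by
        refine lintegral_congr fun y => ?_
        rw [superpose]
        exact (lintegral_const_mul _ (hk.mul (measurable_whitneyKernel_left c Ω y))).symm
    _ = ∫⁻ x, ∫⁻ y, f y * (k x * whitneyKernel c Ω x y) := lintegral_lintegral_swap hm.aemeasurable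
    _ = _ := by
        refine lintegral_congr fun x => ?_
        have hm' : Measurable fun y => whitneyKernel c Ω x y * f y :=
          (measurable_whitneyKernel_right c Ω x).mul hf
        rw [← lintegral_whitneyKernel_mul, ← lintegral_const_mul _ hm']
        refine lintegral_congr fun y => ?_
        ring

/-- Hölder's inequality with respect to the measure of superposition. -/
lemma superpose_rpow_le {q q' : ℝ} (hq : q.HolderConjugate q') {k : E n → ℝ≥0∞}
    (hk : Measurable k) (y : E n) :
    superpose c Ω k y ^ q ≤ superpose c Ω (fun x => k x ^ q) y *
      superpose c Ω (fun _ => 1) y ^ (q - 1) := by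
  have hκ := measurable_whitneyKernel_left c Ω y
  have hpow : ∀ {r : ℝ}, 0 < r → ∀ x, whitneyKernel c Ω x y ^ r = whitneyKernel c Ω x y := by
    intro r hr x
    by_cases h : y ∈ ball x (c * bdryDist Ω x)
    · rw [whitneyKernel_of_mem h, ENNReal.one_rpow]
    · rw [whitneyKernel_of_notMem h, ENNReal.zero_rpow_of_pos hr]
  have hsq : ∀ x, whitneyKernel c Ω x y * whitneyKernel c Ω x y = whitneyKernel c Ω x y := by
    intro x
    by_cases h : y ∈ ball x (c * bdryDist Ω x)
    · rw [whitneyKernel_of_mem h, one_mul]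
    · rw [whitneyKernel_of_notMem h, zero_mul]
  have hH := ENNReal.lintegral_mul_le_Lp_mul_Lq volume hq
    (f := fun x => k x * whitneyKernel c Ω x y) (g := fun x => whitneyKernel c Ω x y)
    (hk.mul hκ).aemeasurable hκ.aemeasurable
  simp only [Pi.mul_apply, mul_assoc, hsq, ENNReal.mul_rpow_of_nonneg _ _ hq.nonneg,
    hpow hq.pos, hpow hq.symm.pos] at hH
  calc superpose c Ω k y ^ q ≤ ((∫⁻ x, k x ^ q * whitneyKernel c Ω x y) ^ (1 / q) *
        (∫⁻ x, whitneyKernel c Ω x y) ^ (1 / q')) ^ q := by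
        gcongr
        · exact hq.nonneg
        · exact hH
    _ = _ := by
        rw [ENNReal.mul_rpow_of_nonneg _ _ hq.nonneg, ← ENNReal.rpow_mul, ← ENNReal.rpow_mul,
          one_div_mul_cancel hq.ne_zero, ENNReal.rpow_one]
        have : 1 / q' * q = q - 1 := by
          rw [one_div_mul_eq_div, hq.div_conj_eq_sub_one]
        simp only [this, superpose, one_mul]

/-- The Whitney balls that contain a given point of the Whitney ball of `z` have centres near `z`.
-/
lemma superpose_one_le (hc : c ≤ 1 / 2) (hc₁ : c₁ ≤ 1 / 2) {y z : E n}
    (hy : y ∈ ball z (c₁ * bdryDist Ω z)) :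
    superpose c Ω (fun _ => 1) y ≤ volume (ball z (2 * bdryDist Ω z)) := by
  rw [superpose, ← lintegral_indicator_one measurableSet_ball]
  refine lintegral_mono fun x => ?_
  rw [one_mul]
  by_cases h : y ∈ ball x (c * bdryDist Ω x)
  · rw [whitneyKernel_of_mem h, indicator_of_mem]
    · exact le_rfl
    · exact (bdryDist_comparable hc hc₁ h hy).2.2.1
  · rw [whitneyKernel_of_notMem h]
    exact zero_le

end Superpose

/-! ### The space `N` is norming for the Carleson functional -/

lemma measurable_volume_whitney (c : ℝ) (Ω : Set (E n)) :
    Measurable fun x => volume (ball x (c * bdryDist Ω x)) :=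
  (lowerSemicontinuous_measure_ball (volume : Measure (E n))
    (continuous_const.mul (continuous_bdryDist Ω))).measurable

/-- The coefficient `x ↦ G(x) h(x)^{1 - q'} / m(B(x, c δ(x)))`, with `h` the local mean of `H`, on
the part of `s` where `h` does not vanish. Superposing Whitney balls with these coefficients turns
`|H|^{q' - 1}` into a function whose pairing with `H` is `∫_s h G`. -/
noncomputable def dualCoeff (c q' : ℝ) (Ω : Set (E n)) (H : E n → ℝ) (s : Set (E n))
    (G : E n → ℝ≥0∞) : E n → ℝ≥0∞ :=
  (s ∩ {x | localMean c q' Ω H x ≠ 0}).indicator fun x =>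
    G x * localMean c q' Ω H x ^ (1 - q') * (volume (ball x (c * bdryDist Ω x)))⁻¹

section DualCoeff

variable {C : ℝ≥0} {Ω : Set (E n)} {c c₁ c₂ q q' : ℝ} {H : E n → ℝ} {s : Set (E n)}
  {G : E n → ℝ≥0∞}

lemma measurable_dualCoeff (hs : MeasurableSet s) (hG : Measurable G) :
    Measurable (dualCoeff c q' Ω H s G) := by
  have hh := measurable_localMean c q' Ω H
  refine Measurable.indicator ?_ (hs.inter (hh (measurableSet_singleton 0)).compl)
  exact (hG.mul (hh.pow_const _)).mul (measurable_volume_whitney c Ω).inv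

lemma dualCoeff_of_notMem {x : E n} (h : ¬(x ∈ s ∧ localMean c q' Ω H x ≠ 0)) :
    dualCoeff c q' Ω H s G x = 0 :=
  indicator_of_notMem (show x ∉ s ∩ {x | localMean c q' Ω H x ≠ 0} from h) _

lemma dualCoeff_of_mem {x : E n} (hx : x ∈ s) (h : localMean c q' Ω H x ≠ 0) :
    dualCoeff c q' Ω H s G x =
      G x * localMean c q' Ω H x ^ (1 - q') * (volume (ball x (c * bdryDist Ω x)))⁻¹ :=
  indicator_of_mem (show x ∈ s ∩ {x | localMean c q' Ω H x ≠ 0} from ⟨hx, h⟩) _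

/-- The pairing of `H` with the superposition. -/
lemma lintegral_enorm_rpow_mul_superpose (hΩ : IsRegular C Ω) (hc : c ∈ Ioc (0 : ℝ) (1 / 2))
    (hq' : 1 < q') (hHm : Measurable H) (hH : MemLqLoc q' Ω H) (hs : MeasurableSet s)
    (hsΩ : s ⊆ Ω) (hG : Measurable G) :
    ∫⁻ y, ‖H y‖ₑ ^ q' * superpose c Ω (dualCoeff c q' Ω H s G) y =
      ∫⁻ x in s, localMean c q' Ω H x * G x := by
  have hq0 : 0 < q' := by linarith
  rw [lintegral_mul_superpose (hHm.enorm.pow_const _) (measurable_dualCoeff hs hG),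
    ← lintegral_indicator hs]
  refine lintegral_congr fun x => ?_
  by_cases hx : x ∈ s ∧ localMean c q' Ω H x ≠ 0
  · obtain ⟨hxs, h0⟩ := hx
    have hδ := (bdryDist_pos_iff hΩ.isOpen hΩ.ne_univ).2 (hsΩ hxs)
    have ht := (localMean_lt_top hΩ hc hq0 hH x).ne
    have hV0 := volume_ball_ne_zero (mul_pos hc.1 hδ) x
    have hVt := volume_ball_ne_top x (c * bdryDist Ω x)
    rw [dualCoeff_of_mem hxs h0, indicator_of_mem hxs, setLIntegral_eq_localMean hc.1 hq0 H hδ]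
    set h := localMean c q' Ω H x with hh
    set V := volume (ball x (c * bdryDist Ω x)) with hV
    calc G x * h ^ (1 - q') * V⁻¹ * (h ^ q' * V) = G x * (h ^ (1 - q') * h ^ q') * (V⁻¹ * V) := by
          ring
      _ = h * G x := by
          rw [← ENNReal.rpow_add _ _ h0 ht, sub_add_cancel, ENNReal.rpow_one,
            ENNReal.inv_mul_cancel hV0 hVt, mul_one, mul_comm]
  · rw [dualCoeff_of_notMem hx, zero_mul]
    by_cases hxs : x ∈ s
    · have h0 : localMean c q' Ω H x = 0 := by
        by_contra h0
        exact hx ⟨hxs, h0⟩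
      rw [indicator_of_mem hxs, h0, zero_mul]
    · rw [indicator_of_notMem hxs]

/-- The local means of the superposition are controlled by the size of `G` nearby. Jensen's
inequality for the superposition replaces Minkowski's integral inequality. -/
lemma localMean_le_of_enorm_le_superpose (hΩ : IsRegular C Ω) (hq : q.HolderConjugate q')
    (hc₁ : c₁ ∈ Ioc (0 : ℝ) (1 / 2)) (hc₂ : c₂ ∈ Ioc (0 : ℝ) (1 / 2)) (hHm : Measurable H)
    (hH : MemLqLoc q' Ω H) (hs : MeasurableSet s) (hsΩ : s ⊆ Ω) (hG : Measurable G)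
    {u : E n → ℝ}
    (hu : ∀ y, ‖u y‖ₑ ≤ ‖H y‖ₑ ^ (q' - 1) * superpose c₂ Ω (dualCoeff c₂ q' Ω H s G) y)
    {z : E n} (hz : z ∈ Ω) {T : ℝ≥0∞}
    (hT : ∀ x ∈ Ω, bdryDist Ω x ≤ 3 * bdryDist Ω z → bdryDist Ω z ≤ 3 * bdryDist Ω x →
      dist x z < 2 * bdryDist Ω z → G x ≤ T) :
    localMean c₁ q Ω u z ≤ (ENNReal.ofReal ((2 / c₁) ^ (n + 1)) *
      ENNReal.ofReal ((6 / c₂) ^ (n + 1)) ^ (q - 1)) ^ (1 / q) * T := by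
  have hq0 := hq.pos
  have hq0' := hq.symm.pos
  have hq1 : 0 < q - 1 := hq.sub_one_pos
  have hδz := (bdryDist_pos_iff hΩ.isOpen hΩ.ne_univ).2 hz
  have h10 := hc₁.1
  have h20 := hc₂.1
  set k := dualCoeff c₂ q' Ω H s G with hk
  have hkm : Measurable k := measurable_dualCoeff hs hG
  set B := ball z (c₁ * bdryDist Ω z) with hB
  set V₁ := volume (ball z (c₂ / 3 * bdryDist Ω z)) with hV₁
  set V₂ := volume (ball z (2 * bdryDist Ω z)) with hV₂
  have hV₁0 : V₁ ≠ 0 := volume_ball_ne_zero (by positivity) z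
  have hV₁t : V₁ ≠ ∞ := volume_ball_ne_top _ _
  have hB0 : volume B ≠ 0 := volume_ball_ne_zero (by positivity) z
  have hBt : volume B ≠ ∞ := volume_ball_ne_top _ _
  have hV₂t : V₂ ≠ ∞ := volume_ball_ne_top _ _
  have hV₂B : V₂ = ENNReal.ofReal ((2 / c₁) ^ (n + 1)) * volume B := by
    rw [hV₂, hB, show 2 * bdryDist Ω z = 2 / c₁ * (c₁ * bdryDist Ω z) by field_simp,
      volume_ball_mul z (by positivity : 0 < 2 / c₁), Measure.addHaar_ball_center volume z]
  have hV₂V₁ : V₂ = ENNReal.ofReal ((6 / c₂) ^ (n + 1)) * V₁ := by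
    rw [hV₂, hV₁, show 2 * bdryDist Ω z = 6 / c₂ * (c₂ / 3 * bdryDist Ω z) by field_simp; norm_num,
      volume_ball_mul z (by positivity : 0 < 6 / c₂), Measure.addHaar_ball_center volume z]
  -- The contribution of a single base point `x`.
  have hpoint : ∀ x, k x ^ q * ∫⁻ y in ball x (c₂ * bdryDist Ω x),
      B.indicator (fun y => ‖H y‖ₑ ^ q') y ≤
      (ball z (2 * bdryDist Ω z)).indicator (fun _ => T ^ q * V₁⁻¹ ^ (q - 1)) x := by
    intro x
    by_cases hx : x ∈ s ∧ localMean c₂ q' Ω H x ≠ 0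
    swap
    · rw [hk, dualCoeff_of_notMem hx, ENNReal.zero_rpow_of_pos hq0, zero_mul]
      exact zero_le
    obtain ⟨hxs, h0⟩ := hx
    have hδ := (bdryDist_pos_iff hΩ.isOpen hΩ.ne_univ).2 (hsΩ hxs)
    have ht := (localMean_lt_top hΩ hc₂ hq0' hH x).ne
    by_cases hmeet : ∃ y, y ∈ ball x (c₂ * bdryDist Ω x) ∧ y ∈ B
    swap
    · push Not at hmeet
      rw [setLIntegral_congr_fun (g := fun _ => 0) measurableSet_ball fun y hy =>
        indicator_of_notMem (hmeet y hy) _, lintegral_zero, mul_zero]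
      exact zero_le
    obtain ⟨y, hyx, hyz⟩ := hmeet
    obtain ⟨h1, h2, h3, -⟩ := bdryDist_comparable hc₂.2 hc₁.2 hyx hyz
    rw [indicator_of_mem (by exact h3)]
    have hGT := hT x (hsΩ hxs) h1 h2 h3
    have hV0 := volume_ball_ne_zero (mul_pos hc₂.1 hδ) x
    have hVt := volume_ball_ne_top x (c₂ * bdryDist Ω x)
    have hVV : V₁ ≤ volume (ball x (c₂ * bdryDist Ω x)) := by
      rw [hV₁, Measure.addHaar_ball_center, ← Measure.addHaar_ball_center volume x]
      refine measure_mono (ball_subset_ball ?_)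
      have : c₂ / 3 * bdryDist Ω z ≤ c₂ / 3 * (3 * bdryDist Ω x) := by gcongr
      linarith
    calc k x ^ q * ∫⁻ y in ball x (c₂ * bdryDist Ω x), B.indicator (fun y => ‖H y‖ₑ ^ q') y
        ≤ k x ^ q * ∫⁻ y in ball x (c₂ * bdryDist Ω x), ‖H y‖ₑ ^ q' := by
          gcongr with y
          exact indicator_le_self _ _ y
      _ = (G x * localMean c₂ q' Ω H x ^ (1 - q') *
            (volume (ball x (c₂ * bdryDist Ω x)))⁻¹) ^ q *
            (localMean c₂ q' Ω H x ^ q' * volume (ball x (c₂ * bdryDist Ω x))) := by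
          rw [hk, dualCoeff_of_mem hxs h0, setLIntegral_eq_localMean hc₂.1 hq0' H hδ]
      _ = G x ^ q * (volume (ball x (c₂ * bdryDist Ω x)))⁻¹ ^ (q - 1) := by
          set h := localMean c₂ q' Ω H x with hh
          set V := volume (ball x (c₂ * bdryDist Ω x)) with hV
          have e1 : (1 - q') * q + q' = 0 := by
            have := hq.symm.sub_one_mul_conj
            linarith
          have e2 : V⁻¹ ^ q = V⁻¹ ^ (q - 1) * V⁻¹ := by
            nth_rewrite 3 [← ENNReal.rpow_one V⁻¹]
            rw [← ENNReal.rpow_add_of_nonneg _ _ hq1.le zero_le_one, sub_add_cancel]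
          rw [ENNReal.mul_rpow_of_nonneg _ _ hq0.le, ENNReal.mul_rpow_of_nonneg _ _ hq0.le,
            ← ENNReal.rpow_mul, e2]
          calc G x ^ q * h ^ ((1 - q') * q) * (V⁻¹ ^ (q - 1) * V⁻¹) * (h ^ q' * V)
              = G x ^ q * (h ^ ((1 - q') * q) * h ^ q') * V⁻¹ ^ (q - 1) * (V⁻¹ * V) := by ring
            _ = _ := by
                rw [← ENNReal.rpow_add _ _ h0 ht, e1, ENNReal.rpow_zero, mul_one,
                  ENNReal.inv_mul_cancel hV0 hVt, mul_one]
      _ ≤ T ^ q * V₁⁻¹ ^ (q - 1) := by gcongr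
  have hfm : Measurable (B.indicator fun y => ‖H y‖ₑ ^ q') :=
    (hHm.enorm.pow_const _).indicator measurableSet_ball
  have hint : ∫⁻ y in B, ‖u y‖ₑ ^ q ≤ V₂ ^ (q - 1) * (T ^ q * V₁⁻¹ ^ (q - 1) * V₂) := by
    calc ∫⁻ y in B, ‖u y‖ₑ ^ q
        ≤ ∫⁻ y in B, V₂ ^ (q - 1) * (‖H y‖ₑ ^ q' * superpose c₂ Ω (fun x => k x ^ q) y) := by
          refine setLIntegral_mono_ae' measurableSet_ball (ae_of_all _ fun y hy => ?_)
          calc ‖u y‖ₑ ^ q ≤ (‖H y‖ₑ ^ (q' - 1) * superpose c₂ Ω k y) ^ q := by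
                gcongr
                exact hu y
            _ = ‖H y‖ₑ ^ q' * superpose c₂ Ω k y ^ q := by
                rw [ENNReal.mul_rpow_of_nonneg _ _ hq0.le, ← ENNReal.rpow_mul,
                  hq.symm.sub_one_mul_conj]
            _ ≤ ‖H y‖ₑ ^ q' * (superpose c₂ Ω (fun x => k x ^ q) y * V₂ ^ (q - 1)) := by
                gcongr
                refine (superpose_rpow_le hq hkm y).trans ?_
                gcongr
                exact superpose_one_le hc₂.2 hc₁.2 hy
            _ = _ := by ring
      _ = V₂ ^ (q - 1) * ∫⁻ y, B.indicator (fun y => ‖H y‖ₑ ^ q') y *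
            superpose c₂ Ω (fun x => k x ^ q) y := by
          rw [lintegral_const_mul' _ _ (ENNReal.rpow_ne_top_of_nonneg hq1.le hV₂t),
            ← lintegral_indicator measurableSet_ball]
          congr 1
          refine lintegral_congr fun y => ?_
          by_cases hy : y ∈ B <;> simp [hy, ← hB]
      _ = V₂ ^ (q - 1) * ∫⁻ x, k x ^ q * ∫⁻ y in ball x (c₂ * bdryDist Ω x),
            B.indicator (fun y => ‖H y‖ₑ ^ q') y := by
          rw [lintegral_mul_superpose hfm (hkm.pow_const _)]
      _ ≤ V₂ ^ (q - 1) * ∫⁻ x, (ball z (2 * bdryDist Ω z)).indicator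
            (fun _ => T ^ q * V₁⁻¹ ^ (q - 1)) x := by
          gcongr with x
          exact hpoint x
      _ = _ := by rw [lintegral_indicator_const measurableSet_ball]
  calc localMean c₁ q Ω u z = ((∫⁻ y in B, ‖u y‖ₑ ^ q) / volume B) ^ (1 / q) := by
        rw [localMean, setLAverage_eq]
    _ ≤ (ENNReal.ofReal ((2 / c₁) ^ (n + 1)) *
          ENNReal.ofReal ((6 / c₂) ^ (n + 1)) ^ (q - 1) * T ^ q) ^ (1 / q) := by
        gcongr ?_ ^ (1 / q)
        rw [ENNReal.div_le_iff_le_mul (Or.inl hB0) (Or.inl hBt)]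
        refine hint.trans (le_of_eq ?_)
        nth_rewrite 1 [hV₂V₁]
        rw [hV₂B, ENNReal.mul_rpow_of_nonneg _ _ hq1.le]
        calc ENNReal.ofReal ((6 / c₂) ^ (n + 1)) ^ (q - 1) * V₁ ^ (q - 1) *
              (T ^ q * V₁⁻¹ ^ (q - 1) * (ENNReal.ofReal ((2 / c₁) ^ (n + 1)) * volume B))
            = (V₁ ^ (q - 1) * V₁⁻¹ ^ (q - 1)) * (ENNReal.ofReal ((2 / c₁) ^ (n + 1)) *
              ENNReal.ofReal ((6 / c₂) ^ (n + 1)) ^ (q - 1) * T ^ q * volume B) := by ring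
          _ = _ := by
              rw [← ENNReal.mul_rpow_of_nonneg _ _ hq1.le, ENNReal.mul_inv_cancel hV₁0 hV₁t,
                ENNReal.one_rpow, one_mul]
    _ = _ := by
        rw [ENNReal.mul_rpow_of_nonneg _ _ (by positivity), ← ENNReal.rpow_mul,
          mul_one_div_cancel hq0.ne', ENNReal.rpow_one]

end DualCoeff

lemma area_iSup {α : ℝ} {Ω : Set (E n)} {h : ℕ → E n → ℝ≥0∞} (hh : ∀ j, Measurable (h j))
    (hmono : Monotone h) (ξ : E n) :
    area α Ω (fun x => ⨆ j, h j x) ξ = ⨆ j, area α Ω (h j) ξ := by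
  have hm : ∀ j, Measurable fun x => h j x / ENNReal.ofReal (bdryDist Ω x ^ n) := fun j =>
    (hh j).div (measurable_bdryDist_pow Ω)
  unfold area
  rw [← lintegral_iSup hm fun j l hjl x => ENNReal.div_le_div_right (hmono hjl x) _]
  simp only [ENNReal.iSup_div]

/-- At points comparable to a point of the cone with vertex `ξ`, the boundary averages of `g` are
controlled by the maximal function of `g` at `ξ`. -/
lemma bdryAvg_le_maximal {α : ℝ} (hα : 0 < α) {Ω : Set (E n)} {g : E n → ℝ≥0∞} {ξ x z : E n}
    (hz : z ∈ cone α Ω ξ) (hx : 0 < bdryDist Ω x) (h1 : bdryDist Ω x ≤ 3 * bdryDist Ω z)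
    (h2 : bdryDist Ω z ≤ 3 * bdryDist Ω x) (h3 : dist x z < 2 * bdryDist Ω z) :
    bdryAvg α Ω g x ≤ ENNReal.ofReal ((3 * (6 + 4 * α)) ^ n) *
      maximal ((surfaceMeasure Ω).withDensity g) ξ := by
  have hδz : 0 < bdryDist Ω z := by linarith
  set μ := (surfaceMeasure Ω).withDensity g with hμ
  have hsub : ball x ((1 + α) * bdryDist Ω x) ⊆ ball ξ ((6 + 4 * α) * bdryDist Ω z) := by
    refine ball_subset_ball' ?_
    have h4 := dist_triangle x z ξ
    have h5 := hz.2
    have h6 : (1 + α) * bdryDist Ω x ≤ (1 + α) * (3 * bdryDist Ω z) := by gcongr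
    linarith
  have h0 : ENNReal.ofReal (bdryDist Ω x ^ n) ≠ 0 := ofReal_pow_ne_zero hx
  rw [bdryAvg, ENNReal.div_le_iff h0 ENNReal.ofReal_ne_top]
  calc μ (ball x ((1 + α) * bdryDist Ω x)) ≤ μ (ball ξ ((6 + 4 * α) * bdryDist Ω z)) :=
        measure_mono hsub
    _ ≤ ENNReal.ofReal (((6 + 4 * α) * bdryDist Ω z) ^ n) * maximal μ ξ :=
        measure_ball_le_maximal μ ξ (by positivity)
    _ ≤ ENNReal.ofReal ((3 * (6 + 4 * α) * bdryDist Ω x) ^ n) * maximal μ ξ := by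
        gcongr ENNReal.ofReal (?_ ^ n) * _
        calc (6 + 4 * α) * bdryDist Ω z ≤ (6 + 4 * α) * (3 * bdryDist Ω x) := by gcongr
          _ = _ := by ring
    _ = _ := by
        rw [mul_pow, ENNReal.ofReal_mul (by positivity)]
        ring

/-- The space `N` is norming for the area functional of the local means: the test functions are
superpositions dual to a truncation of the area functional, and their nontangential maximal
functions are controlled by the boundary maximal function. -/
theorem exists_bdryNorm_area_le (hn : 1 ≤ n) (C : ℝ≥0) {p p' q q' : ℝ}
    (hp : p.HolderConjugate p') (hq : q.HolderConjugate q') {α : ℝ} (hα : 0 < α) {c₁ c₂ : ℝ}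
    (hc₁ : c₁ ∈ Ioc (0 : ℝ) (1 / 2)) (hc₂ : c₂ ∈ Ioc (0 : ℝ) (1 / 2)) :
    ∃ A : ℝ≥0, ∀ Ω : Set (E n), IsRegular C Ω → ∀ H : E n → ℝ, Measurable H → MemLqLoc q' Ω H →
      ∀ S : ℝ≥0∞, (∀ u : E n → ℝ, Measurable u → (∀ y, 0 ≤ u y) → MemLqLoc q Ω u →
        bdryNorm p Ω (ntMax α c₁ q Ω u) < ∞ → ∫⁻ y in Ω, ‖u y * H y‖ₑ < ∞ →
        ∫⁻ y in Ω, ‖u y * H y‖ₑ ≤ S * bdryNorm p Ω (ntMax α c₁ q Ω u)) →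
      bdryNorm p' Ω (area α Ω (localMean c₂ q' Ω H)) ≤ A * S := by
  obtain ⟨A, hA⟩ := exists_bdryNorm_maximal_le hn C hp.lt
  set B : ℝ≥0 := ((ENNReal.ofReal ((2 / c₁) ^ (n + 1)) *
      ENNReal.ofReal ((6 / c₂) ^ (n + 1)) ^ (q - 1)) ^ (1 / q) *
      ENNReal.ofReal ((3 * (6 + 4 * α)) ^ n)).toNNReal with hB
  have hBe : (B : ℝ≥0∞) = (ENNReal.ofReal ((2 / c₁) ^ (n + 1)) *
      ENNReal.ofReal ((6 / c₂) ^ (n + 1)) ^ (q - 1)) ^ (1 / q) *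
      ENNReal.ofReal ((3 * (6 + 4 * α)) ^ n) := by
    refine ENNReal.coe_toNNReal (ENNReal.mul_ne_top (ENNReal.rpow_ne_top_of_nonneg
      (one_div_nonneg.2 hq.nonneg) (ENNReal.mul_ne_top ENNReal.ofReal_ne_top
      (ENNReal.rpow_ne_top_of_nonneg hq.sub_one_pos.le ENNReal.ofReal_ne_top)))
      ENNReal.ofReal_ne_top)
  refine ⟨B * A, fun Ω hΩ H hHm hH S hS => ?_⟩
  have hp0 := hp.pos
  have hp0' := hp.symm.pos
  have hp1' : 0 < p' - 1 := hp.symm.sub_one_pos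
  have hq0' := hq.symm.pos
  set σ := surfaceMeasure Ω with hσ
  set h := localMean c₂ q' Ω H with hh
  have hhm : Measurable h := measurable_localMean c₂ q' Ω H
  -- Cut off to the exhaustion, so that the area functional has finite norm.
  set hj : ℕ → E n → ℝ≥0∞ := fun j => (exhaustion Ω j).indicator h with hhj
  have hKm : ∀ j, MeasurableSet (exhaustion Ω j) := fun j =>
    (isCompact_exhaustion Ω j).measurableSet
  have hjm : ∀ j, Measurable (hj j) := fun j => hhm.indicator (hKm j)
  have hjmono : Monotone hj := fun j l hjl x =>
    indicator_le_indicator_of_subset (monotone_exhaustion Ω hjl) (fun _ => zero_le) x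
  have hsup : h = fun x => ⨆ j, hj j x := by
    funext x
    refine le_antisymm ?_ (iSup_le fun j => indicator_le_self _ _ _)
    by_cases hx : x ∈ Ω
    · obtain ⟨j, hxj⟩ := (eventually_mem_exhaustion hΩ hx).exists
      exact le_iSup_of_le j (indicator_of_mem hxj _).ge
    · rw [hh, localMean_of_notMem hq0' hx]
      exact zero_le
  have hareasup : area α Ω h = fun ξ => ⨆ j, area α Ω (hj j) ξ := by
    funext ξ
    conv_lhs => rw [hsup]
    exact area_iSup hjm hjmono ξ
  rw [hareasup, bdryNorm_iSup hp.symm.lt Ω (fun j => measurable_area hΩ.isOpen α (hjm j))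
    fun j l hjl ξ => area_mono (fun x _ => hjmono hjl x) hΩ.isOpen ξ]
  refine iSup_le fun j => ?_
  obtain ⟨M, hM, hMle⟩ := exists_localMean_le_of_mem_exhaustion hc₂ hq0' hH j
  have hfin : bdryNorm p' Ω (area α Ω (hj j)) < ∞ :=
    bdryNorm_area_lt_top hΩ hα hp.symm.lt hM fun x => indicator_le_indicator' (hMle x)
  set F := area α Ω (hj j) with hF
  have hFm : Measurable F := measurable_area hΩ.isOpen α (hjm j)
  set I : ℝ≥0∞ := ∫⁻ ξ, F ξ ^ p' ∂σ with hI
  have hIfin : I ≠ ∞ := by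
    have := ENNReal.rpow_lt_top_of_nonneg hp0'.le hfin.ne
    rw [bdryNorm, ← ENNReal.rpow_mul, one_div_mul_cancel hp0'.ne', ENNReal.rpow_one] at this
    exact this.ne
  -- `g` is dual to `F`, and `u` is the superposition with `∫ |u H| = ∫_{∂Ω} F g dσ`.
  set g : E n → ℝ≥0∞ := fun ξ => F ξ ^ (p' - 1) with hg
  have hgm : Measurable g := hFm.pow_const _
  set G := bdryAvg α Ω g with hG
  have hGm : Measurable G := measurable_bdryAvg α Ω g
  set s := exhaustion Ω j with hs
  have hsΩ : s ⊆ Ω := exhaustion_subset Ω j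
  set k := superpose c₂ Ω (dualCoeff c₂ q' Ω H s G) with hk
  have hkm : Measurable k := measurable_superpose (measurable_dualCoeff (hKm j) hGm)
  set u : E n → ℝ := fun y => |H y| ^ (q' - 1) * (k y).toReal with hu
  have hum : Measurable u := (hHm.norm.pow_const _).mul hkm.ennreal_toReal
  have hu0 : ∀ y, 0 ≤ u y := fun y =>
    mul_nonneg (Real.rpow_nonneg (abs_nonneg _) _) ENNReal.toReal_nonneg
  have hue : ∀ y, ‖u y‖ₑ = ‖H y‖ₑ ^ (q' - 1) * ENNReal.ofReal (k y).toReal := fun y => by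
    rw [Real.enorm_of_nonneg (hu0 y), hu, ENNReal.ofReal_mul (Real.rpow_nonneg (abs_nonneg _) _),
      ← ENNReal.ofReal_rpow_of_nonneg (abs_nonneg _) hq.symm.sub_one_pos.le,
      ← Real.enorm_eq_ofReal_abs]
  have hule : ∀ y, ‖u y‖ₑ ≤ ‖H y‖ₑ ^ (q' - 1) * k y := fun y => by
    rw [hue]
    gcongr
    exact ENNReal.ofReal_toReal_le
  have hIeq : I = ∫⁻ y, ‖H y‖ₑ ^ q' * k y := by
    calc I = ∫⁻ ξ, F ξ * g ξ ∂σ := by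
          refine lintegral_congr fun ξ => ?_
          rw [hg]
          nth_rewrite 2 [← ENNReal.rpow_one (F ξ)]
          rw [← ENNReal.rpow_add_of_nonneg _ _ zero_le_one hp1'.le, add_sub_cancel]
      _ = ∫⁻ x in Ω, hj j x * G x := lintegral_area_mul hΩ α (hjm j) hgm
      _ = ∫⁻ x in s, hj j x * G x := by
          refine (setLIntegral_eq_of_subset_of_eq_zero (hKm j) hΩ.isOpen.measurableSet hsΩ
            fun y _ hy => ?_).symm
          rw [hhj]
          simp only [indicator_of_notMem (show y ∉ exhaustion Ω j from hy), zero_mul]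
      _ = ∫⁻ x in s, h x * G x := by
          refine setLIntegral_congr_fun (hKm j) fun x hx => ?_
          rw [hhj]
          simp only [indicator_of_mem (show x ∈ exhaustion Ω j from hx)]
      _ = _ := (lintegral_enorm_rpow_mul_superpose hΩ hc₂ hq.symm.lt hHm hH (hKm j) hsΩ hGm).symm
  -- The superposition may be infinite, but only on a null set of points where `H` does not vanish.
  have huH : ∫⁻ y in Ω, ‖u y * H y‖ₑ = I := by
    rw [hIeq, setLIntegral_eq_of_subset_of_eq_zero hΩ.isOpen.measurableSet MeasurableSet.univ
      (subset_univ Ω), setLIntegral_univ]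
    · have hae := ae_lt_top ((hHm.enorm.pow_const q').mul hkm) (hIeq ▸ hIfin)
      refine lintegral_congr_ae ?_
      filter_upwards [hae] with y hy
      rw [enorm_mul, hue]
      rcases eq_or_ne (H y) 0 with h0 | h0
      · simp [h0, hq0']
      · have hk' : k y ≠ ∞ := by
          intro hk'
          have hy' : ‖H y‖ₑ ^ q' * k y < ∞ := hy
          rw [hk', ENNReal.mul_top] at hy'
          · exact lt_irrefl _ hy'
          · simp [h0, hq0']
        rw [ENNReal.ofReal_toReal hk', mul_right_comm]
        congr 1
        nth_rewrite 2 [← ENNReal.rpow_one ‖H y‖ₑ]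
        rw [← ENNReal.rpow_add_of_nonneg _ _ hq.symm.sub_one_pos.le zero_le_one, sub_add_cancel]
    · intro y _ hy
      have : u y = 0 := by
        rw [hu]
        simp only [hk, superpose_eq_zero_of_notMem hc₂ _ hy, ENNReal.toReal_zero, mul_zero]
      rw [this, zero_mul, enorm_zero]
  have hNle : ∀ ξ ∈ frontier Ω, ntMax α c₁ q Ω u ξ ≤ B * maximal (σ.withDensity g) ξ := by
    intro ξ _
    refine iSup₂_le fun z hz => ?_
    rw [hBe, mul_assoc]
    refine localMean_le_of_enorm_le_superpose hΩ hq hc₁ hc₂ hHm hH (hKm j) hsΩ hGm hule hz.1 ?_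
    intro x hx h1 h2 h3
    exact bdryAvg_le_maximal hα hz ((bdryDist_pos_iff hΩ.isOpen hΩ.ne_univ).2 hx) h1 h2 h3
  have hNu : bdryNorm p Ω (ntMax α c₁ q Ω u) ≤ B * A * I ^ (1 / p) := by
    have hgI : bdryNorm p Ω g = I ^ (1 / p) := by
      rw [bdryNorm, hI]
      simp_rw [hg, ← ENNReal.rpow_mul, hp.symm.sub_one_mul_conj]
      rfl
    calc _ ≤ B * bdryNorm p Ω (maximal (σ.withDensity g)) := bdryNorm_le_mul hp.lt Ω B hNle
      _ ≤ B * (A * bdryNorm p Ω g) := by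
          gcongr
          exact hA Ω hΩ g hgm
      _ = _ := by rw [hgI, mul_assoc]
  have hNfin : bdryNorm p Ω (ntMax α c₁ q Ω u) < ∞ := hNu.trans_lt
    (ENNReal.mul_lt_top (ENNReal.mul_lt_top ENNReal.coe_lt_top ENNReal.coe_lt_top)
      (ENNReal.rpow_lt_top_of_nonneg (by positivity) hIfin))
  have hfinal : I ≤ (B * A : ℝ≥0) * S * I ^ (1 / p) := by
    calc I = ∫⁻ y in Ω, ‖u y * H y‖ₑ := huH.symm
      _ ≤ S * bdryNorm p Ω (ntMax α c₁ q Ω u) := hS u hum hu0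
          (memLqLoc_of_bdryNorm_ntMax_lt_top hΩ hα hc₁ hp.lt hq.pos hum.aestronglyMeasurable hNfin)
          hNfin (huH ▸ hIfin.lt_top)
      _ ≤ S * (B * A * I ^ (1 / p)) := by gcongr
      _ = _ := by
          push_cast
          ring
  exact rpow_one_div_le_of_le_mul_rpow hp.symm hIfin hfinal

/-! ### Dominated convergence in the Carleson norm -/

section DominatedConvergence

variable {C : ℝ≥0} {Ω : Set (E n)} {α c q p : ℝ} {H : E n → ℝ} {Hs : ℕ → E n → ℝ}

lemma tendsto_localMean_zero (hΩ : IsRegular C Ω) (hc : c ∈ Ioc (0 : ℝ) (1 / 2)) (hq : 0 < q)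
    (hH : MemLqLoc q Ω H) (hHs : ∀ j, Measurable (Hs j)) (hle : ∀ j y, ‖Hs j y‖ₑ ≤ ‖H y‖ₑ)
    (hlim : ∀ y ∈ Ω, Tendsto (fun j => Hs j y) atTop (𝓝 0)) {x : E n} (hx : x ∈ Ω) :
    Tendsto (fun j => localMean c q Ω (Hs j) x) atTop (𝓝 0) := by
  have hδ := (bdryDist_pos_iff hΩ.isOpen hΩ.ne_univ).2 hx
  have hV0 := volume_ball_ne_zero (mul_pos hc.1 hδ) x
  have hfin : ∫⁻ y in ball x (c * bdryDist Ω x), ‖H y‖ₑ ^ q ≠ ∞ := by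
    rw [setLIntegral_eq_localMean hc.1 hq H hδ]
    exact ENNReal.mul_ne_top
      (ENNReal.rpow_ne_top_of_nonneg hq.le (localMean_lt_top hΩ hc hq hH x).ne)
      (volume_ball_ne_top _ _)
  have hint : Tendsto (fun j => ∫⁻ y in ball x (c * bdryDist Ω x), ‖Hs j y‖ₑ ^ q) atTop
      (𝓝 (∫⁻ y in ball x (c * bdryDist Ω x), 0)) := by
    refine tendsto_lintegral_of_dominated_convergence (fun y => ‖H y‖ₑ ^ q)
      (fun j => (hHs j).enorm.pow_const q) (fun j => ae_of_all _ fun y => ?_) hfin ?_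
    · exact ENNReal.rpow_le_rpow (hle j y) hq.le
    · refine (ae_restrict_iff' measurableSet_ball).2 (ae_of_all _ fun y hy => ?_)
      have h1 := (hlim y (ball_subset Ω hc x hy)).enorm.ennrpow_const q
      simpa [hq] using h1
  rw [lintegral_zero] at hint
  have h2 := (ENNReal.Tendsto.div_const hint (Or.inr hV0)).ennrpow_const (1 / q)
  rw [ENNReal.zero_div, ENNReal.zero_rpow_of_pos (by positivity)] at h2
  simpa only [localMean, setLAverage_eq] using h2

lemma tendsto_bdryNorm_area_zero (hΩ : IsRegular C Ω) (hc : c ∈ Ioc (0 : ℝ) (1 / 2)) (hq : 0 < q)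
    (hp : 0 < p) (hH : MemLqLoc q Ω H) (hfin : bdryNorm p Ω (area α Ω (localMean c q Ω H)) < ∞)
    (hHs : ∀ j, Measurable (Hs j)) (hle : ∀ j y, ‖Hs j y‖ₑ ≤ ‖H y‖ₑ)
    (hlim : ∀ y ∈ Ω, Tendsto (fun j => Hs j y) atTop (𝓝 0)) :
    Tendsto (fun j => bdryNorm p Ω (area α Ω (localMean c q Ω (Hs j)))) atTop (𝓝 0) := by
  have hm : ∀ u : E n → ℝ, Measurable (area α Ω (localMean c q Ω u)) := fun u =>
    measurable_area hΩ.isOpen α (measurable_localMean c q Ω u)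
  have hmean : ∀ j x, localMean c q Ω (Hs j) x ≤ localMean c q Ω H x := fun j x =>
    localMean_mono hq fun y _ => hle j y
  have hIfin : ∫⁻ ξ, area α Ω (localMean c q Ω H) ξ ^ p ∂(surfaceMeasure Ω) ≠ ∞ := by
    have := ENNReal.rpow_lt_top_of_nonneg hp.le hfin.ne
    rw [bdryNorm, ← ENNReal.rpow_mul, one_div_mul_cancel hp.ne', ENNReal.rpow_one] at this
    exact this.ne
  have hint : Tendsto (fun j => ∫⁻ ξ, area α Ω (localMean c q Ω (Hs j)) ξ ^ p ∂(surfaceMeasure Ω))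
      atTop (𝓝 (∫⁻ _, 0 ∂(surfaceMeasure Ω))) := by
    refine tendsto_lintegral_of_dominated_convergence
      (fun ξ => area α Ω (localMean c q Ω H) ξ ^ p) (fun j => (hm _).pow_const p)
      (fun j => ae_of_all _ fun ξ => ?_) hIfin ?_
    · exact ENNReal.rpow_le_rpow (area_mono (fun x _ => hmean j x) hΩ.isOpen ξ) hp.le
    · filter_upwards [ae_lt_top ((hm H).pow_const p) hIfin] with ξ hξ
      have hξ' : area α Ω (localMean c q Ω H) ξ ≠ ∞ := by
        intro h
        rw [h, ENNReal.top_rpow_of_pos hp] at hξ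
        exact lt_irrefl _ hξ
      have hcone : Tendsto (fun j => area α Ω (localMean c q Ω (Hs j)) ξ) atTop
          (𝓝 (∫⁻ _ in cone α Ω ξ, 0)) := by
        refine tendsto_lintegral_of_dominated_convergence
          (fun x => localMean c q Ω H x / ENNReal.ofReal (bdryDist Ω x ^ n))
          (fun j => (measurable_localMean c q Ω (Hs j)).div (measurable_bdryDist_pow Ω))
          (fun j => ae_of_all _ fun x => ENNReal.div_le_div_right (hmean j x) _) hξ' ?_
        refine (ae_restrict_iff' (measurableSet_cone hΩ.isOpen α ξ)).2 (ae_of_all _ fun x hx => ?_)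
        have hδ := (bdryDist_pos_iff hΩ.isOpen hΩ.ne_univ).2 hx.1
        have h1 := ENNReal.Tendsto.div_const
          (tendsto_localMean_zero hΩ hc hq hH hHs hle hlim hx.1)
          (b := ENNReal.ofReal (bdryDist Ω x ^ n)) (Or.inr (ofReal_pow_ne_zero hδ))
        rwa [ENNReal.zero_div] at h1
      rw [lintegral_zero] at hcone
      have h2 := hcone.ennrpow_const p
      rwa [ENNReal.zero_rpow_of_pos hp] at h2
  rw [lintegral_zero] at hint
  have h3 := hint.ennrpow_const (1 / p)
  rwa [ENNReal.zero_rpow_of_pos (by positivity)] at h3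

end DominatedConvergence

/-- The converse of the domination of the Carleson functional by the area functional, qualitatively:
the bound for the pairing is inserted into the norming inequality for the area functional. -/
lemma bdryNorm_area_localMean_lt_top (hn : 1 ≤ n) {C : ℝ≥0} {p p' q q' : ℝ}
    (hp : p.HolderConjugate p') (hq : q.HolderConjugate q') {α : ℝ} (hα : 0 < α) {c : ℝ}
    (hc : c ∈ Ioc (0 : ℝ) (1 / 2)) {Ω : Set (E n)} (hΩ : IsRegular C Ω) {H : E n → ℝ}
    (hHm : Measurable H) (hH : MemLqLoc q' Ω H) (hfin : bdryNorm p' Ω (carleson c q' Ω H) < ∞) :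
    bdryNorm p' Ω (area α Ω (localMean c q' Ω H)) < ∞ := by
  obtain ⟨A, hA⟩ := exists_bdryNorm_area_le hn C hp hq hα hc hc
  obtain ⟨B, hB⟩ := exists_setLIntegral_mul_le C hp hq hα hc hc
  refine (hA Ω hΩ H hHm hH (B * bdryNorm p' Ω (carleson c q' Ω H))
    fun u hum _ _ _ _ => ?_).trans_lt
    (ENNReal.mul_lt_top ENNReal.coe_lt_top (ENNReal.mul_lt_top ENNReal.coe_lt_top hfin))
  exact (hB Ω hΩ u H hum.aestronglyMeasurable hHm.aestronglyMeasurable).trans_eq (by ring)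

/-- Dominated convergence in the Carleson norm. The Carleson functional itself, a supremum, does not
converge pointwise under domination, but the equivalent area functional does. -/
theorem tendsto_bdryNorm_carleson_zero (hn : 1 ≤ n) {C : ℝ≥0} {p p' q q' : ℝ}
    (hp : p.HolderConjugate p') (hq : q.HolderConjugate q') {c : ℝ}
    (hc : c ∈ Ioc (0 : ℝ) (1 / 2)) {Ω : Set (E n)} (hΩ : IsRegular C Ω) {H : E n → ℝ}
    (hHm : Measurable H) (hH : MemLqLoc q' Ω H) (hfin : bdryNorm p' Ω (carleson c q' Ω H) < ∞)
    {Hs : ℕ → E n → ℝ} (hHs : ∀ j, Measurable (Hs j)) (hle : ∀ j y, ‖Hs j y‖ₑ ≤ ‖H y‖ₑ)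
    (hlim : ∀ y ∈ Ω, Tendsto (fun j => Hs j y) atTop (𝓝 0)) :
    Tendsto (fun j => bdryNorm p' Ω (carleson c q' Ω (Hs j))) atTop (𝓝 0) := by
  obtain ⟨A, hA⟩ := exists_bdryNorm_maximal_le_area hn C one_pos hp.symm.lt
  have h1 := tendsto_bdryNorm_area_zero hΩ hc hq.symm.pos hp.symm.pos hH
    (bdryNorm_area_localMean_lt_top hn hp hq one_pos hc hΩ hHm hH hfin) hHs hle hlim
  have h2 := ENNReal.Tendsto.const_mul (a := (A : ℝ≥0∞)) h1 (Or.inr ENNReal.coe_ne_top)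
  rw [mul_zero] at h2
  refine tendsto_of_tendsto_of_tendsto_of_le_of_le tendsto_const_nhds h2 (fun _ => zero_le)
    fun j => ?_
  change bdryNorm p' Ω (carleson c q' Ω (Hs j)) ≤ _
  rw [carleson_eq_maximal]
  exact hA Ω hΩ _ (measurable_localMean c q' Ω (Hs j))

/-- Bounded functions supported in a member of the exhaustion belong to the Carleson space. -/
lemma bdryNorm_carleson_lt_top_of_le_indicator (hn : 1 ≤ n) {C : ℝ≥0} {c p q : ℝ} (hp : 1 < p)
    (hq : 0 < q) (hc : c ∈ Ioc (0 : ℝ) (1 / 2)) {Ω : Set (E n)} (hΩ : IsRegular C Ω)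
    {H : E n → ℝ} {k : ℕ} {B : ℝ≥0}
    (hH : ∀ y, ‖H y‖ₑ ≤ (exhaustion Ω k).indicator (fun _ => (B : ℝ≥0∞)) y) :
    bdryNorm p Ω (carleson c q Ω H) < ∞ := by
  obtain ⟨A, hA⟩ := exists_bdryNorm_maximal_le_area hn C one_pos hp
  obtain ⟨l, hl⟩ : ∃ l, ∀ x, ∀ y ∈ ball x (c * bdryDist Ω x), y ∈ exhaustion Ω k →
      x ∈ exhaustion Ω l := by
    obtain ⟨m, hm⟩ := exists_nat_ge (2 * (bdryDist Ω 0 + 2 * k))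
    refine ⟨max (2 * k + 1) m, fun x y hyx hyk => ?_⟩
    have hx0 := bdryDist_nonneg Ω x
    have h1 : 1 / ((k : ℝ) + 1) ≤ bdryDist Ω y := hyk.1
    have h2 := bdryDist_le_add_dist Ω y x
    have h2' := bdryDist_le_add_dist Ω x y
    have h3 : dist y x < 1 / 2 * bdryDist Ω x :=
      (mem_ball.1 hyx).trans_le (mul_le_mul_of_nonneg_right hc.2 hx0)
    have h6 := bdryDist_le_of_mem_exhaustion hyk
    rw [dist_comm x y] at h2'
    constructor
    · have h4 : 1 / (((max (2 * k + 1) m : ℕ) : ℝ) + 1) ≤ 1 / (((2 * k + 1 : ℕ) : ℝ) + 1) :=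
        Nat.one_div_le_one_div (le_max_left _ _)
      have h5 : 1 / (((2 * k + 1 : ℕ) : ℝ) + 1) = 1 / 2 * (1 / ((k : ℝ) + 1)) := by
        push_cast
        field_simp
        ring
      change _ ≤ bdryDist Ω x
      linarith
    · have h7 := mem_closedBall.1 hyk.2
      have h8 := dist_triangle_left x 0 y
      have h9 : (m : ℝ) ≤ ((max (2 * k + 1) m : ℕ) : ℝ) := by exact_mod_cast le_max_right _ _
      have h10 := bdryDist_nonneg Ω 0
      rw [mem_closedBall]
      linarith
  have hmean : ∀ x, localMean c q Ω H x ≤ (exhaustion Ω l).indicator (fun _ => (B : ℝ≥0∞)) x := by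
    intro x
    by_cases hx : x ∈ exhaustion Ω l
    · rw [indicator_of_mem hx]
      have hδ := (bdryDist_pos_iff hΩ.isOpen hΩ.ne_univ).2 (exhaustion_subset Ω l hx)
      have hV0 := volume_ball_ne_zero (mul_pos hc.1 hδ) x
      rw [localMean, one_div, ENNReal.rpow_inv_le_iff hq, setLAverage_eq,
        ENNReal.div_le_iff hV0 (volume_ball_ne_top _ _), ← setLIntegral_const]
      refine lintegral_mono fun y => ENNReal.rpow_le_rpow ?_ hq.le
      exact (hH y).trans (indicator_le_self _ _ _)
    · rw [indicator_of_notMem hx, nonpos_iff_eq_zero, localMean, setLAverage_eq,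
        setLIntegral_congr_fun (g := fun _ => 0) measurableSet_ball, lintegral_zero,
        ENNReal.zero_div, ENNReal.zero_rpow_of_pos (by positivity)]
      intro y hy
      have h1 := hH y
      rw [indicator_of_notMem fun hyk => hx (hl x y hy hyk), nonpos_iff_eq_zero] at h1
      simp only [h1, ENNReal.zero_rpow_of_pos hq]
  rw [carleson_eq_maximal]
  exact (hA Ω hΩ _ (measurable_localMean c q Ω H)).trans_lt (ENNReal.mul_lt_top ENNReal.coe_lt_top
    (bdryNorm_area_lt_top hΩ one_pos hp ENNReal.coe_ne_top hmean))

/-! ### Bounded functionals on the Carleson space -/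

lemma carleson_mono {c q : ℝ} (hq : 0 < q) {Ω : Set (E n)} {H K : E n → ℝ}
    (h : ∀ y, |K y| ≤ |H y|) (ξ : E n) : carleson c q Ω K ξ ≤ carleson c q Ω H ξ := by
  refine iSup₂_mono fun r _ => ENNReal.div_le_div_right (lintegral_mono fun x => ?_) _
  exact localMean_mono hq fun y _ => enorm_le_iff_norm_le.2 (h y)

lemma MemLqLoc.mono {q : ℝ} {Ω : Set (E n)} {u v : E n → ℝ} (hu : MemLqLoc q Ω u)
    (hv : Measurable v) (h : ∀ y, |v y| ≤ |u y|) : MemLqLoc q Ω v := fun K hKΩ hK =>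
  (hu K hKΩ hK).mono hv.aestronglyMeasurable (ae_of_all _ h)

lemma memLqLoc_of_bound {q : ℝ} {Ω : Set (E n)} {u : E n → ℝ} (hu : Measurable u) {B : ℝ}
    (h : ∀ y, |u y| ≤ B) : MemLqLoc q Ω u := fun K _ hK => by
  have : IsFiniteMeasure (volume.restrict K) := ⟨by simpa using hK.measure_lt_top⟩
  exact MemLp.of_bound hu.aestronglyMeasurable B (ae_of_all _ h)

/-- A Borel function representing an element of the Carleson space. -/
structure MemCarleson (c q p : ℝ) (Ω : Set (E n)) (H : E n → ℝ) : Prop where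
  measurable : Measurable H
  memLqLoc : MemLqLoc q Ω H
  norm_lt_top : bdryNorm p Ω (carleson c q Ω H) < ∞

/-- A bounded linear functional, of norm at most `S`, on the Carleson space, given by its values on
Borel representatives. -/
structure IsBoundedFunctional (c q p : ℝ) (Ω : Set (E n)) (L : (E n → ℝ) → ℝ) (S : ℝ≥0) :
    Prop where
  map_add : ∀ H K, MemCarleson c q p Ω H → MemCarleson c q p Ω K → L (H + K) = L H + L K
  map_smul : ∀ (a : ℝ) H, MemCarleson c q p Ω H → L (a • H) = a * L H
  bound : ∀ H, MemCarleson c q p Ω H → ‖L H‖ₑ ≤ S * bdryNorm p Ω (carleson c q Ω H)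

section Functional

variable {C : ℝ≥0} {c p q : ℝ} {Ω : Set (E n)} {L : (E n → ℝ) → ℝ} {S : ℝ≥0} {H K : E n → ℝ}

lemma MemCarleson.mono (hp : 1 < p) (hq : 0 < q) (hH : MemCarleson c q p Ω H) (hK : Measurable K)
    (h : ∀ y, |K y| ≤ |H y|) : MemCarleson c q p Ω K :=
  ⟨hK, hH.memLqLoc.mono hK h,
    (bdryNorm_mono hp Ω (carleson_mono hq h)).trans_lt hH.norm_lt_top⟩

lemma MemCarleson.smul (hp : 1 < p) (hq : 1 ≤ q) (a : ℝ) (hH : MemCarleson c q p Ω H) :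
    MemCarleson c q p Ω (a • H) := by
  refine ⟨hH.measurable.const_smul a, hH.memLqLoc.smul a, ?_⟩
  rw [funext (carleson_smul hq a H), bdryNorm_mul hp Ω a (measurable_carleson ..)]
  exact ENNReal.mul_lt_top enorm_lt_top hH.norm_lt_top

/-- Bounded Borel functions supported in a member of the exhaustion belong to the Carleson space. -/
lemma memCarleson_of_bound (hn : 1 ≤ n) (hp : 1 < p) (hq : 0 < q) (hc : c ∈ Ioc (0 : ℝ) (1 / 2))
    (hΩ : IsRegular C Ω) (hHm : Measurable H) {k : ℕ} {B : ℝ} (hB : ∀ y, |H y| ≤ B)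
    (hk : ∀ y ∉ exhaustion Ω k, H y = 0) : MemCarleson c q p Ω H := by
  refine ⟨hHm, memLqLoc_of_bound hHm hB,
    bdryNorm_carleson_lt_top_of_le_indicator (k := k) (B := B.toNNReal) hn hp hq hc hΩ fun y => ?_⟩
  by_cases hy : y ∈ exhaustion Ω k
  · rw [indicator_of_mem hy, Real.enorm_eq_ofReal_abs]
    exact ENNReal.ofReal_le_ofReal (hB y)
  · rw [hk y hy, enorm_zero]
    exact zero_le

namespace IsBoundedFunctional

lemma map_sub (hp : 1 < p) (hq : 1 ≤ q) (hL : IsBoundedFunctional c q p Ω L S)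
    (hH : MemCarleson c q p Ω H) (hK : MemCarleson c q p Ω K) : L (H - K) = L H - L K := by
  rw [sub_eq_add_neg, ← neg_one_smul ℝ K, hL.map_add _ _ hH (hK.smul hp hq _),
    hL.map_smul _ _ hK]
  ring

lemma eq_zero_of_ae_eq_zero (hp : 1 < p) (hq : 1 ≤ q) (hc : c ∈ Ioc (0 : ℝ) (1 / 2))
    (hL : IsBoundedFunctional c q p Ω L S) (hH : MemCarleson c q p Ω H)
    (h : H =ᵐ[volume.restrict Ω] 0) : L H = 0 := by
  have h1 := hL.bound H hH
  rw [carleson_congr hc q h, funext (carleson_zero hq), bdryNorm_zero hp, mul_zero,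
    nonpos_iff_eq_zero, enorm_eq_zero] at h1
  exact h1

/-- Bounded functionals on the Carleson space respect dominated convergence. -/
lemma tendsto (hn : 1 ≤ n) {p' q' : ℝ} (hp : p'.HolderConjugate p) (hq : q'.HolderConjugate q)
    (hc : c ∈ Ioc (0 : ℝ) (1 / 2)) (hΩ : IsRegular C Ω) (hL : IsBoundedFunctional c q p Ω L S)
    (hH : MemCarleson c q p Ω H) {Hs : ℕ → E n → ℝ} (hHs : ∀ j, Measurable (Hs j))
    (hK : Measurable K) (hle : ∀ j y, |Hs j y| ≤ |H y|) (hleK : ∀ y, |K y| ≤ |H y|)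
    (hlim : ∀ y ∈ Ω, Tendsto (fun j => Hs j y) atTop (𝓝 (K y))) :
    Tendsto (fun j => L (Hs j)) atTop (𝓝 (L K)) := by
  have hq0 := hq.symm.pos
  have h2H := hH.smul hp.symm.lt hq.symm.lt.le 2
  have hKC := hH.mono hp.symm.lt hq0 hK hleK
  have hHsC := fun j => hH.mono hp.symm.lt hq0 (hHs j) (hle j)
  have hdle : ∀ j y, |(Hs j - K) y| ≤ |((2 : ℝ) • H) y| := by
    intro j y
    rw [Pi.smul_apply, smul_eq_mul, abs_mul, abs_two, Pi.sub_apply]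
    have h1 := abs_sub (Hs j y) (K y)
    have h2 := hle j y
    have h3 := hleK y
    linarith
  have hdC := fun j => h2H.mono hp.symm.lt hq0 ((hHs j).sub hK) (hdle j)
  have hzero := tendsto_bdryNorm_carleson_zero hn hp hq hc hΩ h2H.measurable h2H.memLqLoc
    h2H.norm_lt_top (fun j => (hHs j).sub hK) (fun j y => enorm_le_iff_norm_le.2 (hdle j y))
    fun y hy => by simpa using (hlim y hy).sub_const (K y)
  have hzero' := ENNReal.Tendsto.const_mul (a := (S : ℝ≥0∞)) hzero (Or.inr ENNReal.coe_ne_top)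
  rw [mul_zero] at hzero'
  have hL0 : Tendsto (fun j => ‖L (Hs j - K)‖ₑ) atTop (𝓝 0) :=
    tendsto_of_tendsto_of_tendsto_of_le_of_le tendsto_const_nhds hzero' (fun _ => zero_le)
      fun j => hL.bound _ (hdC j)
  rw [tendsto_iff_edist_tendsto_0]
  refine hL0.congr fun j => ?_
  rw [hL.map_sub hp.symm.lt hq.symm.lt.le (hHsC j) hKC, edist_eq_enorm_sub]

end IsBoundedFunctional

lemma MemCarleson.add (hp : 1 < p) (hq : 1 ≤ q) (hc : c ∈ Ioc (0 : ℝ) (1 / 2))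
    (hH : MemCarleson c q p Ω H) (hK : MemCarleson c q p Ω K) : MemCarleson c q p Ω (H + K) :=
  ⟨hH.measurable.add hK.measurable, hH.memLqLoc.add hK.memLqLoc,
    ((bdryNorm_mono hp Ω (carleson_add_le hc hq hH.measurable.aestronglyMeasurable
      hK.measurable.aestronglyMeasurable)).trans (bdryNorm_add_le hp Ω (measurable_carleson ..)
        (measurable_carleson ..))).trans_lt (ENNReal.add_lt_top.2 ⟨hH.norm_lt_top, hK.norm_lt_top⟩)⟩

lemma memCarleson_zero (hp : 1 < p) (hq : 1 ≤ q) : MemCarleson c q p Ω (0 : E n → ℝ) := by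
  refine ⟨measurable_zero, MemLqLoc.zero, ?_⟩
  rw [funext (carleson_zero hq), bdryNorm_zero hp]
  exact ENNReal.zero_lt_top

lemma memCarleson_sum (hp : 1 < p) (hq : 1 ≤ q) (hc : c ∈ Ioc (0 : ℝ) (1 / 2)) {ι : Type*}
    {f : ι → E n → ℝ} (hf : ∀ i, MemCarleson c q p Ω (f i)) (t : Finset ι) :
    MemCarleson c q p Ω (∑ i ∈ t, f i) :=
  Finset.sum_induction f _ (fun _ _ => MemCarleson.add hp hq hc) (memCarleson_zero hp hq)
    fun i _ => hf i

namespace IsBoundedFunctional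

lemma map_zero (hp : 1 < p) (hq : 1 ≤ q) (hL : IsBoundedFunctional c q p Ω L S) : L 0 = 0 := by
  simpa using hL.map_smul 0 0 (memCarleson_zero hp hq)

lemma map_sum (hp : 1 < p) (hq : 1 ≤ q) (hc : c ∈ Ioc (0 : ℝ) (1 / 2))
    (hL : IsBoundedFunctional c q p Ω L S) {ι : Type*} {f : ι → E n → ℝ}
    (hf : ∀ i, MemCarleson c q p Ω (f i)) (t : Finset ι) :
    L (∑ i ∈ t, f i) = ∑ i ∈ t, L (f i) := by
  classical
  induction t using Finset.induction_on with
  | empty => simpa using hL.map_zero hp hq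
  | insert i t hi ih =>
    rw [Finset.sum_insert hi, Finset.sum_insert hi, hL.map_add _ _ (hf i)
      (memCarleson_sum hp hq hc hf t), ih]

end IsBoundedFunctional

/-! ### Representation of bounded functionals -/

/-- On a piece of the domain contained in a member of the exhaustion, a bounded functional is
integration against an integrable density, by the Radon–Nikodym theorem. -/
theorem IsBoundedFunctional.exists_density (hn : 1 ≤ n) {p' q' : ℝ} (hp : p'.HolderConjugate p)
    (hq : q'.HolderConjugate q) (hc : c ∈ Ioc (0 : ℝ) (1 / 2)) (hΩ : IsRegular C Ω)
    (hL : IsBoundedFunctional c q p Ω L S) {D : Set (E n)} (hD : MeasurableSet D) {k : ℕ}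
    (hDk : D ⊆ exhaustion Ω k) :
    ∃ v : E n → ℝ, Measurable v ∧ Integrable v ∧ ∀ H : E n → ℝ, Measurable H → ∀ B : ℝ,
      (∀ y, |H y| ≤ B) → L (D.indicator H) = ∫ y in D, v y * H y := by
  classical
  have hp1 := hp.symm.lt
  have hq1 := hq.symm.lt.le
  have hmem : ∀ H : E n → ℝ, Measurable H → ∀ B : ℝ, (∀ y, |H y| ≤ B) →
      MemCarleson c q p Ω (D.indicator H) := fun H hH B hB =>
    memCarleson_of_bound (k := k) hn hp1 hq.symm.pos hc hΩ (hH.indicator hD) (B := B)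
      (fun y => by
        rw [← Real.norm_eq_abs]
        exact (norm_indicator_le_norm_self _ _).trans (hB y))
      fun y hy => indicator_of_notMem (fun h => hy (hDk h)) _
  set one : E n → ℝ := fun _ => 1 with hone
  have hindm : ∀ s : Set (E n), MeasurableSet s → Measurable (s.indicator one) := fun s hs =>
    measurable_const.indicator hs
  have hind : ∀ s : Set (E n), ∀ y, |s.indicator one y| ≤ 1 := fun s y => by
    by_cases hy : y ∈ s <;> simp [hy, hone]
  have hmemind : ∀ s : Set (E n), MeasurableSet s →
      MemCarleson c q p Ω (D.indicator (s.indicator one)) := fun s hs =>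
    hmem _ (hindm s hs) 1 (hind s)
  -- The signed measure `s ↦ L(1_{s ∩ D})`; countable additivity is dominated convergence.
  obtain ⟨ν, hν⟩ : ∃ ν : SignedMeasure (E n), ∀ s, MeasurableSet s →
      ν s = L (D.indicator (s.indicator one)) := by
    refine ⟨⟨fun s => if MeasurableSet s then L (D.indicator (s.indicator one)) else 0, ?_,
      fun s hs => if_neg hs, fun f hf hdisj => ?_⟩, fun s hs => if_pos hs⟩
    · rw [if_pos MeasurableSet.empty, indicator_empty]
      have : D.indicator (fun _ : E n => (0 : ℝ)) = 0 := indicator_zero ℝ D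
      rw [this]
      exact hL.map_zero hp1 hq1
    · rw [if_pos (MeasurableSet.iUnion hf)]
      simp only [hf, if_true]
      refine Filter.tendsto_of_seq_tendsto fun t ht => ?_
      have hsum : ∀ j, ∑ i ∈ t j, L (D.indicator ((f i).indicator one)) =
          L (∑ i ∈ t j, D.indicator ((f i).indicator one)) := fun j =>
        (hL.map_sum hp1 hq1 hc (fun i => hmemind _ (hf i)) (t j)).symm
      have hUnion : ∀ j, ∑ i ∈ t j, D.indicator ((f i).indicator one) =
          D.indicator ((⋃ i ∈ t j, f i).indicator one) := by
        intro j
        rw [Finset.indicator_biUnion (t j) f fun i _ l _ hil => hdisj hil]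
        funext y
        by_cases hy : y ∈ D <;> simp [hy]
      change Tendsto (fun j => ∑ i ∈ t j, L (D.indicator ((f i).indicator one))) atTop _
      simp only [hsum, hUnion]
      refine hL.tendsto hn hp hq hc hΩ (hmem one measurable_const 1 (by simp [hone]))
        (fun j => (hindm _ ((t j).measurableSet_biUnion fun i _ => hf i)).indicator hD)
        ((hindm _ (MeasurableSet.iUnion hf)).indicator hD) (fun j y => ?_) (fun y => ?_)
        fun y _ => ?_
      · by_cases hy : y ∈ D
        · simpa [hy, hone] using hind (⋃ i ∈ t j, f i) y
        · simp [hy]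
      · by_cases hy : y ∈ D
        · simpa [hy, hone] using hind (⋃ i, f i) y
        · simp [hy]
      · by_cases hy : y ∈ ⋃ i, f i
        · obtain ⟨i, hi⟩ := mem_iUnion.1 hy
          refine tendsto_const_nhds.congr' ?_
          filter_upwards [ht.eventually (eventually_ge_atTop {i})] with j hj
          have hy' : y ∈ ⋃ i ∈ t j, f i := mem_iUnion₂.2 ⟨i, hj (Finset.mem_singleton_self i), hi⟩
          simp only [indicator, hy, hy', if_true]
        · have hy' : ∀ j, y ∉ ⋃ i ∈ t j, f i := fun j h => by
            obtain ⟨i, _, hi⟩ := mem_iUnion₂.1 h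
            exact hy (mem_iUnion.2 ⟨i, hi⟩)
          simp only [indicator, hy, hy', if_false]
          exact tendsto_const_nhds
  have hac : ν ≪ᵥ (volume : Measure (E n)).toENNRealVectorMeasure := by
    refine VectorMeasure.AbsolutelyContinuous.mk fun s hs h0 => ?_
    rw [Measure.toENNRealVectorMeasure_apply_measurable hs] at h0
    rw [hν s hs]
    refine hL.eq_zero_of_ae_eq_zero hp1 hq1 hc (hmemind s hs) (ae_restrict_of_ae ?_)
    filter_upwards [measure_eq_zero_iff_ae_notMem.1 h0] with y hy
    by_cases hyD : y ∈ D <;> simp [hyD, hy]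
  set v := ν.rnDeriv volume with hv
  have hvm : Measurable v := ν.measurable_rnDeriv volume
  have hvi : Integrable v := ν.integrable_rnDeriv volume
  have hνv : ∀ s, MeasurableSet s → L (D.indicator (s.indicator one)) = ∫ y in s, v y := by
    intro s hs
    rw [← hν s hs, ← withDensityᵥ_apply hvi hs, hv, SignedMeasure.withDensityᵥ_rnDeriv_eq _ _ hac]
  have hvH : ∀ H : E n → ℝ, Measurable H → ∀ B : ℝ, (∀ y, |H y| ≤ B) →
      IntegrableOn (fun y => v y * H y) D := fun H hH B hB =>
    (hvi.mul_bdd hH.aestronglyMeasurable (ae_of_all _ hB)).integrableOn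
  have hsimple : ∀ f : SimpleFunc (E n) ℝ, L (D.indicator f) = ∫ y in D, v y * f y := by
    intro f
    induction f using SimpleFunc.induction with
    | const a hs =>
      rename_i s
      have e1 : D.indicator (SimpleFunc.piecewise s hs (SimpleFunc.const (E n) a)
          (SimpleFunc.const (E n) 0)) = a • D.indicator ((s ∩ D).indicator one) := by
        funext y
        by_cases hy : y ∈ D <;> by_cases hy' : y ∈ s <;> simp [hy, hy', hone]
      have e2 : ∀ y, v y * SimpleFunc.piecewise s hs (SimpleFunc.const (E n) a)
          (SimpleFunc.const (E n) 0) y = s.indicator (fun y => a * v y) y := by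
        intro y
        by_cases hy' : y ∈ s <;> simp [hy', mul_comm]
      rw [e1, hL.map_smul _ _ (hmemind _ (hs.inter hD)), hνv _ (hs.inter hD)]
      simp_rw [e2]
      rw [setIntegral_indicator hs, integral_const_mul, inter_comm]
    | add hdisj hf hg =>
      rename_i f g
      obtain ⟨B, hB⟩ := f.exists_forall_norm_le
      obtain ⟨B', hB'⟩ := g.exists_forall_norm_le
      rw [SimpleFunc.coe_add, indicator_add', hL.map_add _ _ (hmem f f.measurable B hB)
        (hmem g g.measurable B' hB'), hf, hg, ← integral_add (hvH f f.measurable B hB)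
        (hvH g g.measurable B' hB')]
      refine integral_congr_ae (ae_of_all _ fun y => ?_)
      simp [mul_add]
  refine ⟨v, hvm, hvi, fun H hH B hB => ?_⟩
  have hB0 : 0 ≤ B := (abs_nonneg _).trans (hB 0)
  set f := hH.stronglyMeasurable.approxBounded B with hf
  have hfle : ∀ j y, ‖f j y‖ ≤ B := hH.stronglyMeasurable.norm_approxBounded_le hB0
  have hflim : ∀ y, Tendsto (fun j => f j y) atTop (𝓝 (H y)) := fun y =>
    hH.stronglyMeasurable.tendsto_approxBounded_of_norm_le (hB y)
  have hlim1 : Tendsto (fun j => L (D.indicator (f j))) atTop (𝓝 (L (D.indicator H))) := by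
    refine hL.tendsto hn hp hq hc hΩ
      (hmem (fun _ => B) measurable_const B fun _ => (abs_of_nonneg hB0).le)
      (fun j => (f j).measurable.indicator hD) (hH.indicator hD) (fun j y => ?_) (fun y => ?_)
      fun y _ => ?_
    · by_cases hy : y ∈ D
      · simpa [hy, abs_of_nonneg hB0] using hfle j y
      · simp [hy]
    · by_cases hy : y ∈ D
      · simpa [hy, abs_of_nonneg hB0] using hB y
      · simp [hy]
    · by_cases hy : y ∈ D
      · simpa [hy] using hflim y
      · simp [hy]
  have hlim2 : Tendsto (fun j => ∫ y in D, v y * f j y) atTop (𝓝 (∫ y in D, v y * H y)) := by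
    refine tendsto_integral_of_dominated_convergence (fun y => ‖v y‖ * B)
      (fun j => (hvm.mul (f j).measurable).aestronglyMeasurable)
      (hvi.norm.mul_const B).integrableOn (fun j => ae_of_all _ fun y => ?_)
      (ae_of_all _ fun y => (hflim y).const_mul (v y))
    rw [norm_mul]
    exact mul_le_mul_of_nonneg_left (hfle j y) (norm_nonneg _)
  simp only [hsimple] at hlim1
  exact tendsto_nhds_unique hlim1 hlim2

/-- The densities on the successive layers of the exhaustion glue to one function. -/
theorem IsBoundedFunctional.exists_local_density (hn : 1 ≤ n) {p' q' : ℝ}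
    (hp : p'.HolderConjugate p) (hq : q'.HolderConjugate q) (hc : c ∈ Ioc (0 : ℝ) (1 / 2))
    (hΩ : IsRegular C Ω) (hL : IsBoundedFunctional c q p Ω L S) :
    ∃ u : E n → ℝ, Measurable u ∧ ∀ k, IntegrableOn u (exhaustion Ω k) ∧
      ∀ H : E n → ℝ, Measurable H → ∀ B : ℝ, (∀ y, |H y| ≤ B) →
        L ((exhaustion Ω k).indicator H) = ∫ y in exhaustion Ω k, u y * H y := by
  have hKm : ∀ k, MeasurableSet (exhaustion Ω k) := fun k =>
    (isCompact_exhaustion Ω k).measurableSet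
  -- The layers are disjoint, so no compatibility between the densities is required.
  set D := disjointed (exhaustion Ω) with hD
  have hDm : ∀ k, MeasurableSet (D k) := MeasurableSet.disjointed hKm
  have hDsub : ∀ k, D k ⊆ exhaustion Ω k := disjointed_subset (exhaustion Ω)
  choose v hvm hvi hvL using fun k => hL.exists_density hn hp hq hc hΩ (hDm k) (hDsub k)
  obtain ⟨u, hum, hu⟩ := exists_measurable_piecewise D hDm v hvm fun i j hij y hy =>
    ((disjoint_disjointed (exhaustion Ω) hij).le_bot hy).elim
  have huD : ∀ k, IntegrableOn u (D k) := fun k =>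
    (hvi k).integrableOn.congr_fun (fun y hy => (hu k hy).symm) (hDm k)
  have huL : ∀ k, ∀ H : E n → ℝ, Measurable H → ∀ B : ℝ, (∀ y, |H y| ≤ B) →
      L ((D k).indicator H) = ∫ y in D k, u y * H y := fun k H hH B hB => by
    rw [hvL k H hH B hB]
    exact setIntegral_congr_fun (hDm k) fun y hy => by rw [hu k hy]
  refine ⟨u, hum, fun k => ?_⟩
  induction k with
  | zero =>
    have h0 : D 0 = exhaustion Ω 0 := disjointed_zero _
    rw [← h0]
    exact ⟨huD 0, huL 0⟩
  | succ k ih =>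
    have hsub : exhaustion Ω k ⊆ exhaustion Ω (k + 1) := monotone_exhaustion Ω (Nat.le_succ k)
    have hDs : D (k + 1) = exhaustion Ω (k + 1) \ exhaustion Ω k :=
      (monotone_exhaustion Ω).disjointed_succ (not_isMax k)
    have hun : exhaustion Ω (k + 1) = exhaustion Ω k ∪ D (k + 1) := by
      rw [hDs, union_sdiff_cancel hsub]
    have hdisj : Disjoint (exhaustion Ω k) (D (k + 1)) := by
      rw [hDs]
      exact disjoint_sdiff_right
    have hint : IntegrableOn u (exhaustion Ω (k + 1)) := by
      rw [hun]
      exact ih.1.union (huD (k + 1))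
    refine ⟨hint, fun H hH B hB => ?_⟩
    have hmem : ∀ s ⊆ exhaustion Ω (k + 1), MeasurableSet s →
        MemCarleson c q p Ω (s.indicator H) := fun s hs hsm =>
      memCarleson_of_bound (k := k + 1) hn hp.symm.lt hq.symm.pos hc hΩ (hH.indicator hsm) (B := B)
        (fun y => by
          rw [← Real.norm_eq_abs]
          exact (norm_indicator_le_norm_self _ _).trans (hB y))
        fun y hy => indicator_of_notMem (fun h => hy (hs h)) _
    have huH : ∀ s, IntegrableOn u s → IntegrableOn (fun y => u y * H y) s := fun s hs =>
      hs.mul_bdd hH.aestronglyMeasurable (ae_of_all _ hB)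
    rw [hun, indicator_union_of_disjoint hdisj, setIntegral_union hdisj (hDm _) (huH _ ih.1)
      (huH _ (huD _)), ← ih.2 H hH B hB, ← huL (k + 1) H hH B hB]
    exact hL.map_add _ _ (hmem _ hsub (hKm k)) (hmem _ (hDsub _) (hDm _))

end Functional

/-- Monotone convergence for the nontangential norm. -/
lemma bdryNorm_ntMax_eq_iSup {α c p q : ℝ} (hc : c ∈ Ioc (0 : ℝ) (1 / 2)) (hp : 1 < p) (hq : 0 < q)
    {Ω : Set (E n)} {u : E n → ℝ} {us : ℕ → E n → ℝ} (hus : ∀ k, Measurable (us k))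
    (hmono : ∀ y, Monotone fun k => ‖us k y‖ₑ) (hsup : ∀ y ∈ Ω, ‖u y‖ₑ = ⨆ k, ‖us k y‖ₑ) :
    bdryNorm p Ω (ntMax α c q Ω u) = ⨆ k, bdryNorm p Ω (ntMax α c q Ω (us k)) := by
  have hmean : ∀ x, localMean c q Ω u x = ⨆ k, localMean c q Ω (us k) x := by
    intro x
    simp only [localMean, setLAverage_eq]
    rw [← iSup_rpow _ (by positivity), ← ENNReal.iSup_div,
      ← lintegral_iSup (fun k => (hus k).enorm.pow_const q) fun k l hkl y =>
        ENNReal.rpow_le_rpow (hmono y hkl) hq.le]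
    congr 2
    refine setLIntegral_congr_fun measurableSet_ball fun y hy => ?_
    simp only [hsup y (ball_subset Ω hc x hy)]
    exact iSup_rpow _ hq
  have hN : ntMax α c q Ω u = fun ξ => ⨆ k, ntMax α c q Ω (us k) ξ := by
    funext ξ
    simp only [ntMax, hmean]
    rw [iSup_comm]
    refine iSup_congr fun x => ?_
    rw [iSup_comm]
  rw [hN, bdryNorm_iSup hp Ω fun k => measurable_ntMax ..]
  intro k l hkl ξ
  exact iSup₂_mono fun x _ => localMean_mono hq fun y _ => hmono y hkl

/-- The factor with values `±1` that turns a function into its absolute value. -/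
noncomputable def unitSign (t : ℝ) : ℝ := if 0 ≤ t then 1 else -1

lemma mul_unitSign (t : ℝ) : t * unitSign t = |t| := by
  unfold unitSign
  split_ifs with h
  · rw [mul_one, abs_of_nonneg h]
  · rw [mul_neg_one, abs_of_neg (not_le.1 h)]

lemma abs_unitSign (t : ℝ) : |unitSign t| = 1 := by
  unfold unitSign
  split_ifs <;> simp

lemma measurable_unitSign : Measurable unitSign :=
  Measurable.ite measurableSet_Ici measurable_const measurable_const

/-- Every bounded functional on the Carleson space is integration against a function whose
nontangential norm is controlled by the norm of the functional. -/
theorem exists_representation (hn : 1 ≤ n) (C : ℝ≥0) {p p' q q' : ℝ}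
    (hp : p.HolderConjugate p') (hq : q.HolderConjugate q') {α : ℝ} (hα : 0 < α) {c₁ c₂ : ℝ}
    (hc₁ : c₁ ∈ Ioc (0 : ℝ) (1 / 2)) (hc₂ : c₂ ∈ Ioc (0 : ℝ) (1 / 2)) :
    ∃ A : ℝ≥0, ∀ Ω : Set (E n), IsRegular C Ω → ∀ (L : (E n → ℝ) → ℝ) (S : ℝ≥0),
      IsBoundedFunctional c₂ q' p' Ω L S → ∃ u : E n → ℝ, Measurable u ∧ MemLqLoc q Ω u ∧
        bdryNorm p Ω (ntMax α c₁ q Ω u) ≤ A * S ∧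
        ∀ H, MemCarleson c₂ q' p' Ω H → L H = ∫ y in Ω, u y * H y := by
  obtain ⟨A, hA⟩ := exists_bdryNorm_ntMax_le hn C hp hq hα hc₁ hc₂
  obtain ⟨B, hB⟩ := exists_setLIntegral_mul_le C hp hq hα hc₁ hc₂
  refine ⟨A, fun Ω hΩ L S hL => ?_⟩
  have hΩm := hΩ.isOpen.measurableSet
  have hKm : ∀ k, MeasurableSet (exhaustion Ω k) := fun k =>
    (isCompact_exhaustion Ω k).measurableSet
  obtain ⟨u, hum, hu⟩ := hL.exists_local_density hn hp hq hc₂ hΩ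
  -- The local density `u` is not yet known to be locally in `L^q`, so the norming inequality is
  -- applied to bounded truncations.
  set us : ℕ → E n → ℝ := fun k => (exhaustion Ω k).indicator fun y => min |u y| k with hus
  have husm : ∀ k, Measurable (us k) := fun k =>
    (hum.norm.min measurable_const).indicator (hKm k)
  have hus0 : ∀ k y, 0 ≤ us k y := fun k y =>
    indicator_nonneg (fun y _ => le_min (abs_nonneg _) (Nat.cast_nonneg k)) y
  have husle : ∀ k y, us k y ≤ |u y| := fun k y =>
    indicator_le' (fun y _ => min_le_left _ _) (fun y _ => abs_nonneg _) y
  have husk : ∀ k y, |us k y| ≤ k := fun k y => by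
    rw [abs_of_nonneg (hus0 k y)]
    exact indicator_le' (fun y _ => min_le_right _ _) (fun y _ => Nat.cast_nonneg k) y
  have husmono : ∀ y, Monotone fun k => us k y := by
    intro y k l hkl
    by_cases hy : y ∈ exhaustion Ω k
    · have hy' := monotone_exhaustion Ω hkl hy
      simp only [hus, indicator_of_mem hy, indicator_of_mem hy']
      gcongr
    · simp only [hus]
      rw [indicator_of_notMem hy]
      exact hus0 l y
  have huslim : ∀ y ∈ Ω, ∃ k, us k y = |u y| := by
    intro y hy
    obtain ⟨m, hm⟩ := exists_nat_ge |u y|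
    obtain ⟨k, hk, hmk⟩ := ((eventually_mem_exhaustion hΩ hy).and (eventually_ge_atTop m)).exists
    refine ⟨k, ?_⟩
    simp only [hus, indicator_of_mem hk]
    exact min_eq_left (hm.trans (by exact_mod_cast hmk))
  have hnorm : bdryNorm p Ω (ntMax α c₁ q Ω u) ≤ A * S := by
    rw [bdryNorm_ntMax_eq_iSup hc₁ hp.lt hq.pos husm
      (fun y k l hkl => by
        simp only [Real.enorm_of_nonneg (hus0 k y), Real.enorm_of_nonneg (hus0 l y)]
        exact ENNReal.ofReal_le_ofReal (husmono y hkl))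
      (fun y hy => by
        refine le_antisymm ?_ (iSup_le fun k => ?_)
        · obtain ⟨k, hk⟩ := huslim y hy
          refine le_iSup_of_le k ?_
          rw [hk, Real.enorm_abs]
        · rw [Real.enorm_of_nonneg (hus0 k y), Real.enorm_eq_ofReal_abs]
          exact ENNReal.ofReal_le_ofReal (husle k y))]
    refine iSup_le fun k => hA Ω hΩ (us k) (husm k) (memLqLoc_of_bound (husm k) (husk k)) S ?_
    rintro H hHm hH0 ⟨b, hb⟩ - -
    -- The test function is bounded and vanishes where the truncation of `u` does.
    have hHb : ∀ y, |H y| ≤ |b| * (k : ℝ) ^ (q - 1) := by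
      intro y
      rw [abs_of_nonneg (hH0 y)]
      refine (hb y).trans ?_
      gcongr
      · exact le_abs_self b
      · exact hq.sub_one_pos.le
      · exact husk k y
    have hHK : ∀ y ∉ exhaustion Ω k, H y = 0 := by
      intro y hy
      refine le_antisymm ((hb y).trans_eq ?_) (hH0 y)
      simp only [hus, indicator_of_notMem hy, abs_zero]
      rw [Real.zero_rpow hq.sub_one_pos.ne', mul_zero]
    set K : E n → ℝ := fun y => unitSign (u y) * H y with hK
    have hKmeas : Measurable K := (measurable_unitSign.comp hum).mul hHm
    have hKabs : ∀ y, |K y| = |H y| := fun y => by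
      rw [hK]
      simp only [abs_mul, abs_unitSign, one_mul]
    have hKC : MemCarleson c₂ q' p' Ω K := memCarleson_of_bound (k := k) hn hp.symm.lt hq.symm.pos
      hc₂ hΩ hKmeas (fun y => (hKabs y).trans_le (hHb y)) fun y hy => by
        simp only [hK, hHK y hy, mul_zero]
    have hKind : (exhaustion Ω k).indicator K = K :=
      indicator_eq_self.2 fun y hy => by
        by_contra h
        exact hy (by simp only [hK, hHK y h, mul_zero])
    have hLK : L K = ∫ y in exhaustion Ω k, u y * K y := by
      have := (hu k).2 K hKmeas _ fun y => (hKabs y).trans_le (hHb y)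
      rwa [hKind] at this
    have huK : ∀ y, u y * K y = |u y| * H y := fun y => by
      rw [hK, ← mul_assoc, mul_unitSign]
    calc ∫⁻ y in Ω, ‖us k y * H y‖ₑ ≤ ∫⁻ y in Ω, ‖u y * K y‖ₑ := by
          refine lintegral_mono fun y => ?_
          rw [huK, Real.enorm_of_nonneg (mul_nonneg (hus0 k y) (hH0 y)),
            Real.enorm_of_nonneg (mul_nonneg (abs_nonneg _) (hH0 y))]
          exact ENNReal.ofReal_le_ofReal (mul_le_mul_of_nonneg_right (husle k y) (hH0 y))
      _ = ∫⁻ y in exhaustion Ω k, ‖u y * K y‖ₑ :=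
          (setLIntegral_eq_of_subset_of_eq_zero (hKm k) hΩm (exhaustion_subset Ω k)
            fun y _ hy => by simp only [huK, hHK y hy, mul_zero, enorm_zero]).symm
      _ = ‖L K‖ₑ := by
          have hint : IntegrableOn (fun y => u y * K y) (exhaustion Ω k) :=
            (hu k).1.mul_bdd hKmeas.aestronglyMeasurable
              (ae_of_all _ fun y => (hKabs y).trans_le (hHb y))
          have h0 : ∀ y, 0 ≤ u y * K y := fun y => by
            rw [huK]
            exact mul_nonneg (abs_nonneg _) (hH0 y)
          rw [hLK, Real.enorm_of_nonneg (integral_nonneg h0),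
            ofReal_integral_eq_lintegral_ofReal hint (ae_of_all _ h0)]
          simp only [Real.enorm_of_nonneg (h0 _)]
      _ ≤ S * bdryNorm p' Ω (carleson c₂ q' Ω K) := hL.bound K hKC
      _ ≤ S * bdryNorm p' Ω (carleson c₂ q' Ω H) := by
          gcongr
          exact bdryNorm_mono hp.symm.lt Ω (carleson_mono hq.symm.pos fun y => (hKabs y).le)
  have hfin : bdryNorm p Ω (ntMax α c₁ q Ω u) < ∞ :=
    hnorm.trans_lt (ENNReal.mul_lt_top ENNReal.coe_lt_top ENNReal.coe_lt_top)
  refine ⟨u, hum, memLqLoc_of_bdryNorm_ntMax_lt_top hΩ hα hc₁ hp.lt hq.pos hum.aestronglyMeasurable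
    hfin, hnorm, fun H hH => ?_⟩
  have hint : IntegrableOn (fun y => u y * H y) Ω :=
    ⟨(hum.mul hH.measurable).aestronglyMeasurable, (hB Ω hΩ u H hum.aestronglyMeasurable
      hH.measurable.aestronglyMeasurable).trans_lt (ENNReal.mul_lt_top
        (ENNReal.mul_lt_top ENNReal.coe_lt_top hfin) hH.norm_lt_top)⟩
  -- Truncate `H` both in size and in space.
  set T : ℕ → E n → ℝ := fun k y => max (-(k : ℝ)) (min (H y) k) with hT
  have hTm : ∀ k, Measurable (T k) := fun k =>
    measurable_const.max (hH.measurable.min measurable_const)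
  have hTk : ∀ k y, |T k y| ≤ k := fun k y => by
    have hk : (0 : ℝ) ≤ k := Nat.cast_nonneg k
    rw [abs_le]
    exact ⟨le_max_left _ _, max_le (by linarith) (min_le_right _ _)⟩
  have hTle : ∀ k y, |T k y| ≤ |H y| := fun k y => by
    have hk : (0 : ℝ) ≤ k := Nat.cast_nonneg k
    rw [abs_le]
    refine ⟨?_, max_le (by linarith [abs_nonneg (H y)]) ((min_le_left _ _).trans (le_abs_self _))⟩
    refine le_trans ?_ (le_max_right _ _)
    exact le_min (neg_abs_le _) (by linarith [abs_nonneg (H y)])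
  have hTlim : ∀ y ∈ Ω, ∀ᶠ k in atTop, (exhaustion Ω k).indicator (T k) y = H y := by
    intro y hy
    obtain ⟨m, hm⟩ := exists_nat_ge |H y|
    filter_upwards [eventually_mem_exhaustion hΩ hy, eventually_ge_atTop m] with k hk hmk
    have hle : |H y| ≤ k := hm.trans (by exact_mod_cast hmk)
    obtain ⟨h1, h2⟩ := abs_le.1 hle
    rw [indicator_of_mem hk]
    simp only [hT, min_eq_left h2, max_eq_right h1]
  have hindle : ∀ k y, |(exhaustion Ω k).indicator (T k) y| ≤ |H y| := fun k y => by
    rw [← Real.norm_eq_abs]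
    exact (norm_indicator_le_norm_self _ _).trans (hTle k y)
  have hindm : ∀ k, Measurable ((exhaustion Ω k).indicator (T k)) := fun k =>
    (hTm k).indicator (hKm k)
  have hlim1 : Tendsto (fun k => L ((exhaustion Ω k).indicator (T k))) atTop (𝓝 (L H)) :=
    hL.tendsto hn hp hq hc₂ hΩ hH hindm hH.measurable hindle (fun y => le_rfl) fun y hy =>
      tendsto_const_nhds.congr' ((hTlim y hy).mono fun k hk => hk.symm)
  have hlim2 : Tendsto (fun k => ∫ y in Ω, u y * (exhaustion Ω k).indicator (T k) y) atTop
      (𝓝 (∫ y in Ω, u y * H y)) := by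
    refine tendsto_integral_of_dominated_convergence (fun y => ‖u y * H y‖)
      (fun k => (hum.mul (hindm k)).aestronglyMeasurable) hint.norm
      (fun k => ae_of_all _ fun y => ?_) ((ae_restrict_iff' hΩm).2 (ae_of_all _ fun y hy => ?_))
    · rw [norm_mul, norm_mul]
      exact mul_le_mul_of_nonneg_left (hindle k y) (norm_nonneg _)
    · exact tendsto_const_nhds.congr' ((hTlim y hy).mono fun k hk => by simp only [hk])
  refine tendsto_nhds_unique hlim1 (hlim2.congr fun k => ?_)
  rw [(hu k).2 (T k) (hTm k) k (hTk k)]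
  have : ∀ y, u y * (exhaustion Ω k).indicator (T k) y =
      (exhaustion Ω k).indicator (fun y => u y * T k y) y := fun y => by
    by_cases hy : y ∈ exhaustion Ω k <;> simp [hy]
  simp_rw [this]
  rw [setIntegral_indicator (hKm k), inter_eq_self_of_subset_right (exhaustion_subset Ω k)]

/-! ### The norming inequalities -/

lemma localMean_eq_of_abs_eq {c q : ℝ} {Ω : Set (E n)} {u v : E n → ℝ} (h : ∀ y, |u y| = |v y|) :
    localMean c q Ω u = localMean c q Ω v := by
  have h' : ∀ y, ‖u y‖ₑ = ‖v y‖ₑ := fun y => by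
    rw [Real.enorm_eq_ofReal_abs, Real.enorm_eq_ofReal_abs, h]
  funext x
  simp only [localMean, h']

/-- Multiplying `H` by the sign of `u` makes the pairing with `u` equal to `∫ |u H|`. -/
lemma enorm_integral_mul_smul_unitSign {Ω : Set (E n)} {u H : E n → ℝ} (hu : Measurable u)
    (hH : Measurable H) (hH0 : ∀ y, 0 ≤ H y) {a : ℝ} (ha : 0 ≤ a)
    (hfin : ∫⁻ y in Ω, ‖u y * H y‖ₑ < ∞) :
    IntegrableOn (fun y => u y * (a • fun y => unitSign (u y) * H y) y) Ω ∧
      ‖∫ y in Ω, u y * (a • fun y => unitSign (u y) * H y) y‖ₑ =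
        ENNReal.ofReal a * ∫⁻ y in Ω, ‖u y * H y‖ₑ := by
  have h1 : ∀ y, u y * (a • fun y => unitSign (u y) * H y) y = a * |u y * H y| := fun y => by
    rw [Pi.smul_apply, smul_eq_mul, abs_mul, abs_of_nonneg (hH0 y), ← mul_unitSign (u y)]
    ring
  have hint : IntegrableOn (fun y => u y * H y) Ω :=
    ⟨(hu.mul hH).aestronglyMeasurable, hfin⟩
  simp only [h1]
  refine ⟨hint.abs.const_mul a, ?_⟩
  rw [integral_const_mul, enorm_mul, Real.enorm_of_nonneg ha,
    Real.enorm_of_nonneg (integral_nonneg fun _ => abs_nonneg _),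
    ofReal_integral_eq_lintegral_ofReal hint.abs (ae_of_all _ fun _ => abs_nonneg _)]
  simp only [Real.enorm_eq_ofReal_abs]

/-- The exponents match since `(q - 1) q' = q`. -/
lemma memLqLoc_of_le_rpow {q q' : ℝ} (hq : q.HolderConjugate q') {Ω : Set (E n)} {u H : E n → ℝ}
    (hu : MemLqLoc q Ω u) (hHm : Measurable H) {B : ℝ} (hH : ∀ y, |H y| ≤ B * |u y| ^ (q - 1)) :
    MemLqLoc q' Ω H := by
  intro K hKΩ hK
  have h1 := (hu K hKΩ hK).norm_rpow_div (ENNReal.ofReal (q - 1))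
  rw [← ENNReal.ofReal_div_of_pos hq.sub_one_pos, ENNReal.toReal_ofReal hq.sub_one_pos.le,
    ← hq.conjugate_eq] at h1
  refine (h1.const_mul B).mono hHm.aestronglyMeasurable (ae_of_all _ fun y => ?_)
  exact (hH y).trans (le_abs_self _)

/-- The test functions for the nontangential norm are made to satisfy the constraints of the
supremum: they are multiplied by the sign of `u`, which turns `∫ |u H|` into `|∫ u H|`, and divided
by their norm. A test function of norm zero contributes nothing, by the bound for the pairing. -/
theorem exists_bdryNorm_ntMax_le_iSup (hn : 1 ≤ n) (C : ℝ≥0) {p p' q q' : ℝ}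
    (hp : p.HolderConjugate p') (hq : q.HolderConjugate q') {α : ℝ} (hα : 0 < α) {c₁ c₂ : ℝ}
    (hc₁ : c₁ ∈ Ioc (0 : ℝ) (1 / 2)) (hc₂ : c₂ ∈ Ioc (0 : ℝ) (1 / 2)) :
    ∃ A : ℝ≥0, ∀ Ω : Set (E n), IsRegular C Ω → ∀ u : E n → ℝ, MemLqLoc q Ω u →
      bdryNorm p Ω (ntMax α c₁ q Ω u) ≤
        A * ⨆ (H : E n → ℝ) (_ : MemLqLoc q' Ω H ∧ bdryNorm p' Ω (carleson c₂ q' Ω H) = 1 ∧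
          IntegrableOn (fun x => u x * H x) Ω), ‖∫ x in Ω, u x * H x‖ₑ := by
  obtain ⟨A, hA⟩ := exists_bdryNorm_ntMax_le hn C hp hq hα hc₁ hc₂
  obtain ⟨B, hB⟩ := exists_setLIntegral_mul_le C hp hq hα hc₁ hc₂
  refine ⟨A, fun Ω hΩ u hu => ?_⟩
  have huae := hu.aestronglyMeasurable hΩ
  -- The functionals do not change when `u` is replaced by a Borel representative.
  set v := huae.mk u with hv
  have hvm : Measurable v := huae.stronglyMeasurable_mk.measurable
  have huv : u =ᵐ[volume.restrict Ω] v := huae.ae_eq_mk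
  have hvloc : MemLqLoc q Ω v := hu.congr huv
  rw [ntMax_congr hc₁ q huv]
  refine hA Ω hΩ v hvm hvloc _ ?_
  rintro H hHm hH0 ⟨b, hb⟩ ⟨K, hKΩ, hK, hHK⟩ hHfin
  have hb' : ∀ y, |H y| ≤ b * |v y| ^ (q - 1) := fun y => by
    rw [abs_of_nonneg (hH0 y)]
    exact hb y
  have hHloc : MemLqLoc q' Ω H := memLqLoc_of_le_rpow hq hvloc hHm hb'
  set N := bdryNorm p' Ω (carleson c₂ q' Ω H) with hN
  rcases eq_or_ne N 0 with h0 | h0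
  · refine (hB Ω hΩ v H hvm.aestronglyMeasurable hHm.aestronglyMeasurable).trans ?_
    rw [← hN, h0, mul_zero]
    exact zero_le
  have hfin : ∫⁻ y in Ω, ‖v y * H y‖ₑ < ∞ := by
    rw [← setLIntegral_eq_of_subset_of_eq_zero hK.measurableSet hΩ.isOpen.measurableSet hKΩ
      fun y _ hy => by rw [hHK y hy, mul_zero, enorm_zero]]
    have := hq.ennrealOfReal
    exact ((hvloc K hKΩ hK).integrable_mul (hHloc K hKΩ hK)).2
  have hN' : ENNReal.ofReal N.toReal⁻¹ = N⁻¹ := by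
    rw [ENNReal.ofReal_inv_of_pos (ENNReal.toReal_pos h0 hHfin.ne),
      ENNReal.ofReal_toReal hHfin.ne]
  have ha : 0 ≤ N.toReal⁻¹ := inv_nonneg.2 ENNReal.toReal_nonneg
  obtain ⟨hint, hval⟩ := enorm_integral_mul_smul_unitSign hvm hHm hH0 ha hfin
  set G : E n → ℝ := fun y => unitSign (v y) * H y with hG
  have hGabs : ∀ y, |G y| = |H y| := fun y => by
    simp only [hG, abs_mul, abs_unitSign, one_mul]
  have hGm : Measurable G := (measurable_unitSign.comp hvm).mul hHm
  have hnorm : bdryNorm p' Ω (carleson c₂ q' Ω (N.toReal⁻¹ • G)) = 1 := by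
    rw [funext (carleson_smul hq.symm.lt.le _ G),
      bdryNorm_mul hp.symm.lt Ω _ (measurable_carleson ..), Real.enorm_of_nonneg ha, hN',
      carleson_eq_maximal, localMean_eq_of_abs_eq hGabs, ← carleson_eq_maximal, ← hN,
      ENNReal.inv_mul_cancel h0 hHfin.ne]
  have hpair : (fun x => v x * (N.toReal⁻¹ • G) x) =ᵐ[volume.restrict Ω]
      fun x => u x * (N.toReal⁻¹ • G) x := huv.mono fun x hx => by simp only [hx]
  have hle := le_iSup₂ (f := fun (H : E n → ℝ) (_ : MemLqLoc q' Ω H ∧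
      bdryNorm p' Ω (carleson c₂ q' Ω H) = 1 ∧ IntegrableOn (fun x => u x * H x) Ω volume) =>
      ‖∫ x in Ω, u x * H x‖ₑ) (N.toReal⁻¹ • G)
    ⟨(hHloc.mono hGm fun y => (hGabs y).le).smul _, hnorm, hint.congr hpair⟩
  rw [← integral_congr_ae hpair, hval, hN', ENNReal.inv_mul_le_iff h0 hHfin.ne] at hle
  rwa [mul_comm]

/-- The counterpart of the normalization for the Carleson norm, which is first replaced by the norm
of the area functional. -/
theorem exists_bdryNorm_carleson_le_iSup (hn : 1 ≤ n) (C : ℝ≥0) {p p' q q' : ℝ}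
    (hp : p.HolderConjugate p') (hq : q.HolderConjugate q') {α : ℝ} (hα : 0 < α) {c₁ c₂ : ℝ}
    (hc₁ : c₁ ∈ Ioc (0 : ℝ) (1 / 2)) (hc₂ : c₂ ∈ Ioc (0 : ℝ) (1 / 2)) :
    ∃ A : ℝ≥0, ∀ Ω : Set (E n), IsRegular C Ω → ∀ H : E n → ℝ, MemLqLoc q' Ω H →
      bdryNorm p' Ω (carleson c₂ q' Ω H) ≤
        A * ⨆ (u : E n → ℝ) (_ : MemLqLoc q Ω u ∧ bdryNorm p Ω (ntMax α c₁ q Ω u) = 1 ∧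
          IntegrableOn (fun x => u x * H x) Ω), ‖∫ x in Ω, u x * H x‖ₑ := by
  obtain ⟨A₁, hA₁⟩ := exists_bdryNorm_area_le hn C hp hq hα hc₁ hc₂
  obtain ⟨A₂, hA₂⟩ := exists_bdryNorm_maximal_le_area hn C hα hp.symm.lt
  obtain ⟨B, hB⟩ := exists_setLIntegral_mul_le C hp hq hα hc₁ hc₂
  refine ⟨A₂ * A₁, fun Ω hΩ H hH => ?_⟩
  have hHae := hH.aestronglyMeasurable hΩ
  set K := hHae.mk H with hK
  have hKm : Measurable K := hHae.stronglyMeasurable_mk.measurable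
  have hHK : H =ᵐ[volume.restrict Ω] K := hHae.ae_eq_mk
  have hKloc : MemLqLoc q' Ω K := hH.congr hHK
  rw [carleson_congr hc₂ q' hHK, carleson_eq_maximal, ENNReal.coe_mul, mul_assoc]
  refine (hA₂ Ω hΩ _ (measurable_localMean c₂ q' Ω K)).trans ?_
  gcongr
  refine hA₁ Ω hΩ K hKm hKloc _ fun u hum hu0 huloc hufin hfin => ?_
  set N := bdryNorm p Ω (ntMax α c₁ q Ω u) with hN
  rcases eq_or_ne N 0 with h0 | h0
  · refine (hB Ω hΩ u K hum.aestronglyMeasurable hKm.aestronglyMeasurable).trans ?_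
    rw [← hN, h0, mul_zero, zero_mul]
    exact zero_le
  have hN' : ENNReal.ofReal N.toReal⁻¹ = N⁻¹ := by
    rw [ENNReal.ofReal_inv_of_pos (ENNReal.toReal_pos h0 hufin.ne),
      ENNReal.ofReal_toReal hufin.ne]
  have ha : 0 ≤ N.toReal⁻¹ := inv_nonneg.2 ENNReal.toReal_nonneg
  simp only [mul_comm (u _)] at hfin ⊢
  obtain ⟨hint, hval⟩ := enorm_integral_mul_smul_unitSign hKm hum hu0 ha hfin
  set G : E n → ℝ := fun y => unitSign (K y) * u y with hG
  have hGabs : ∀ y, |G y| = |u y| := fun y => by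
    simp only [hG, abs_mul, abs_unitSign, one_mul]
  have hGm : Measurable G := (measurable_unitSign.comp hKm).mul hum
  have hnorm : bdryNorm p Ω (ntMax α c₁ q Ω (N.toReal⁻¹ • G)) = 1 := by
    have hNG : ntMax α c₁ q Ω G = ntMax α c₁ q Ω u := by
      unfold ntMax
      rw [localMean_eq_of_abs_eq hGabs]
    rw [funext (ntMax_smul hq.lt.le _ G), bdryNorm_mul hp.lt Ω _ (measurable_ntMax ..),
      Real.enorm_of_nonneg ha, hN', hNG, ← hN, ENNReal.inv_mul_cancel h0 hufin.ne]
  have hpair : (fun x => K x * (N.toReal⁻¹ • G) x) =ᵐ[volume.restrict Ω]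
      fun x => (N.toReal⁻¹ • G) x * H x := hHK.mono fun x hx => by simp only [hx, mul_comm]
  have hle := le_iSup₂ (f := fun (u : E n → ℝ) (_ : MemLqLoc q Ω u ∧
      bdryNorm p Ω (ntMax α c₁ q Ω u) = 1 ∧ IntegrableOn (fun x => u x * H x) Ω volume) =>
      ‖∫ x in Ω, u x * H x‖ₑ) (N.toReal⁻¹ • G)
    ⟨(huloc.mono hGm fun y => (hGabs y).le).smul _, hnorm, hint.congr hpair⟩
  rw [← integral_congr_ae hpair, hval, hN', ENNReal.inv_mul_le_iff h0 hufin.ne] at hle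
  rwa [mul_comm (iSup _)]

/-! ### The duality -/

section Duality

variable {C : ℝ≥0} {p p' q q' α c₁ c₂ : ℝ} {Ω : Set (E n)} {hc₁ : c₁ ∈ Ioc (0 : ℝ) (1 / 2)}
  {hc₂ : c₂ ∈ Ioc (0 : ℝ) (1 / 2)} {hq : 1 ≤ q} {hp : 1 < p} {hq' : 1 ≤ q'} {hp' : 1 < p'} {A : ℝ≥0}

lemma enorm_CSpace (H : CSpace Ω hc₂ hq' hp') :
    ‖H‖ₑ = bdryNorm p' Ω (carleson c₂ q' Ω H.1) := by
  rw [← ofReal_norm, CSpace.norm_def, ENNReal.ofReal_toReal H.2.2.ne]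

lemma enorm_NSpace (u : NSpace Ω α hc₁ hq hp) :
    ‖u‖ₑ = bdryNorm p Ω (ntMax α c₁ q Ω u.1) := by
  rw [← ofReal_norm, NSpace.norm_def, ENNReal.ofReal_toReal u.2.2.ne]

/-- The class of a Borel representative. -/
noncomputable def MemCarleson.toCSpace {H : E n → ℝ} (hH : MemCarleson c₂ q' p' Ω H) :
    CSpace Ω hc₂ hq' hp' :=
  ⟨AEEqFun.mk H hH.measurable.aestronglyMeasurable,
    hH.memLqLoc.congr (AEEqFun.coeFn_mk _ _).symm, by
      rw [carleson_congr hc₂ q' (AEEqFun.coeFn_mk _ _)]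
      exact hH.norm_lt_top⟩

lemma memCarleson_coeFn (H : CSpace Ω hc₂ hq' hp') : MemCarleson c₂ q' p' Ω H.1 :=
  ⟨H.1.measurable, H.2.1, H.2.2⟩

lemma toCSpace_memCarleson_coeFn (H : CSpace Ω hc₂ hq' hp') :
    (memCarleson_coeFn H).toCSpace = H := Subtype.ext (AEEqFun.mk_coeFn H.1)

open Classical in
/-- The values of a functional on the Carleson space on Borel representatives, and zero on
functions that represent no element of the space. -/
noncomputable def onRepresentatives (ℓ : StrongDual ℝ (CSpace Ω hc₂ hq' hp')) (H : E n → ℝ) : ℝ :=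
  if h : MemCarleson c₂ q' p' Ω H then ℓ h.toCSpace else 0

lemma MemCarleson.enorm_toCSpace {H : E n → ℝ} (hH : MemCarleson c₂ q' p' Ω H) :
    ‖(hH.toCSpace : CSpace Ω hc₂ hq' hp')‖ₑ = bdryNorm p' Ω (carleson c₂ q' Ω H) :=
  (enorm_CSpace _).trans (congrArg (bdryNorm p' Ω) (carleson_congr hc₂ q' (AEEqFun.coeFn_mk _ _)))

lemma onRepresentatives_of_memCarleson (ℓ : StrongDual ℝ (CSpace Ω hc₂ hq' hp')) {H : E n → ℝ}
    (hH : MemCarleson c₂ q' p' Ω H) : onRepresentatives ℓ H = ℓ hH.toCSpace := dif_pos hH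

lemma isBoundedFunctional_onRepresentatives (ℓ : StrongDual ℝ (CSpace Ω hc₂ hq' hp')) :
    IsBoundedFunctional c₂ q' p' Ω (onRepresentatives ℓ) ‖ℓ‖₊ where
  map_add H K hH hK := by
    have h1 : ((hH.add hp' hq' hc₂ hK).toCSpace : CSpace Ω hc₂ hq' hp') =
      hH.toCSpace + hK.toCSpace := rfl
    rw [onRepresentatives_of_memCarleson ℓ hH, onRepresentatives_of_memCarleson ℓ hK,
      onRepresentatives_of_memCarleson ℓ (hH.add hp' hq' hc₂ hK), h1]
    exact _root_.map_add ℓ _ _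
  map_smul a H hH := by
    have h1 : ((hH.smul hp' hq' a).toCSpace : CSpace Ω hc₂ hq' hp') = a • hH.toCSpace := rfl
    rw [onRepresentatives_of_memCarleson ℓ hH,
      onRepresentatives_of_memCarleson ℓ (hH.smul hp' hq' a), h1]
    exact _root_.map_smul ℓ a _
  bound H hH := by
    rw [onRepresentatives_of_memCarleson ℓ hH]
    have h1 := ℓ.le_opENorm hH.toCSpace
    rwa [hH.enorm_toCSpace] at h1

lemma onRepresentatives_coeFn (ℓ : StrongDual ℝ (CSpace Ω hc₂ hq' hp'))
    (H : CSpace Ω hc₂ hq' hp') : onRepresentatives ℓ H.1 = ℓ H := by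
  rw [onRepresentatives, dif_pos (memCarleson_coeFn H), toCSpace_memCarleson_coeFn]

/-- The bound `∫_Ω |u H| ≤ A ‖u‖_N ‖H‖_C` for the pairing, with constant `A`. -/
def PairingBound (α c₁ c₂ p p' q q' : ℝ) (Ω : Set (E n)) (A : ℝ≥0) : Prop :=
  ∀ u H : E n → ℝ, AEStronglyMeasurable u (volume.restrict Ω) →
    AEStronglyMeasurable H (volume.restrict Ω) → ∫⁻ x in Ω, ‖u x * H x‖ₑ ≤
      A * bdryNorm p Ω (ntMax α c₁ q Ω u) * bdryNorm p' Ω (carleson c₂ q' Ω H)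

lemma integrableOn_pairing (hA : PairingBound α c₁ c₂ p p' q q' Ω A)
    (u : NSpace Ω α hc₁ hq hp) (H : CSpace Ω hc₂ hq' hp') :
    IntegrableOn (fun x => u.1 x * H.1 x) Ω :=
  ⟨u.1.aestronglyMeasurable.mul H.1.aestronglyMeasurable,
    (hA u.1 H.1 u.1.aestronglyMeasurable H.1.aestronglyMeasurable).trans_lt (ENNReal.mul_lt_top
      (ENNReal.mul_lt_top ENNReal.coe_lt_top u.2.2) H.2.2)⟩

lemma norm_integral_pairing_le (hA : PairingBound α c₁ c₂ p p' q q' Ω A)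
    (u : NSpace Ω α hc₁ hq hp) (H : CSpace Ω hc₂ hq' hp') :
    ‖∫ x in Ω, u.1 x * H.1 x‖ ≤ A * ‖u‖ * ‖H‖ := by
  have h1 := (enorm_integral_le_lintegral_enorm fun x => u.1 x * H.1 x).trans
    (hA u.1 H.1 u.1.aestronglyMeasurable H.1.aestronglyMeasurable)
  rw [← enorm_CSpace H, ← enorm_NSpace u] at h1
  have h2 := ENNReal.toReal_mono (by finiteness) h1
  simpa only [ENNReal.toReal_mul, toReal_enorm, ENNReal.coe_toReal] using h2

/-- The pairing `(u, H) ↦ ∫_Ω u H` as a bounded operator into the dual of the Carleson space. -/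
lemma exists_pairing_clm (hA : PairingBound α c₁ c₂ p p' q q' Ω A) :
    ∃ T : NSpace Ω α hc₁ hq hp →L[ℝ] StrongDual ℝ (CSpace Ω hc₂ hq' hp'),
      (∀ u H, T u H = ∫ x in Ω, u.1 x * H.1 x) ∧ ∀ u, ‖T u‖ ≤ A * ‖u‖ := by
  have hint := integrableOn_pairing (hc₁ := hc₁) (hc₂ := hc₂) (hq := hq) (hp := hp) (hq' := hq')
    (hp' := hp') hA
  refine ⟨LinearMap.mkContinuous₂ (LinearMap.mk₂ ℝ (fun (u : NSpace Ω α hc₁ hq hp)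
    (H : CSpace Ω hc₂ hq' hp') => ∫ x in Ω, u.1 x * H.1 x) ?_ ?_ ?_ ?_) A
    (norm_integral_pairing_le hA), fun u H => rfl,
    fun u => ContinuousLinearMap.le_of_opNorm_le _ (LinearMap.mkContinuous₂_norm_le _ A.2 _) u⟩
  · intro u v H
    rw [← integral_add (hint u H) (hint v H)]
    refine integral_congr_ae ?_
    filter_upwards [AEEqFun.coeFn_add u.1 v.1] with x hx
    rw [Submodule.coe_add, hx, Pi.add_apply, add_mul]
  · intro a u H
    rw [smul_eq_mul, ← integral_const_mul]
    refine integral_congr_ae ?_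
    filter_upwards [AEEqFun.coeFn_smul a u.1] with x hx
    rw [Submodule.coe_smul, hx, Pi.smul_apply, smul_eq_mul, mul_assoc]
  · intro u H K
    rw [← integral_add (hint u H) (hint u K)]
    refine integral_congr_ae ?_
    filter_upwards [AEEqFun.coeFn_add H.1 K.1] with x hx
    rw [Submodule.coe_add, hx, Pi.add_apply, mul_add]
  · intro a u H
    rw [smul_eq_mul, ← integral_const_mul]
    refine integral_congr_ae ?_
    filter_upwards [AEEqFun.coeFn_smul a H.1] with x hx
    rw [Submodule.coe_smul, hx, Pi.smul_apply, smul_eq_mul]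
    ring

/-- A function of vanishing nontangential norm is zero: pair it with the constant one, whose
Carleson norm may be infinite, so that `0 * ∞ = 0` is used in the bound for the pairing. -/
lemma NSpace.eq_zero_of_norm_eq_zero (hA : PairingBound α c₁ c₂ p p' q q' Ω A)
    {u : NSpace Ω α hc₁ hq hp} (hu : ‖u‖ = 0) : u = 0 := by
  have h1 := hA u.1 (fun _ => 1) u.1.aestronglyMeasurable aestronglyMeasurable_const
  rw [← enorm_NSpace u, ← ofReal_norm, hu, ENNReal.ofReal_zero, mul_zero, zero_mul,
    nonpos_iff_eq_zero] at h1
  simp only [mul_one] at h1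
  rw [lintegral_eq_zero_iff u.1.measurable.enorm] at h1
  refine Subtype.ext (AEEqFun.ext ?_)
  refine EventuallyEq.trans ?_ AEEqFun.coeFn_zero.symm
  filter_upwards [h1] with x hx
  simpa using hx

/-- The norming inequality for `u` bounds its norm by that of its image in the dual. -/
lemma NSpace.norm_le_of_norming (hΩ : IsRegular C Ω)
    {T : NSpace Ω α hc₁ hq hp →L[ℝ] StrongDual ℝ (CSpace Ω hc₂ hq' hp')}
    (hT : ∀ u H, T u H = ∫ x in Ω, u.1 x * H.1 x) (u : NSpace Ω α hc₁ hq hp)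
    (hA : bdryNorm p Ω (ntMax α c₁ q Ω u.1) ≤
      A * ⨆ (H : E n → ℝ) (_ : MemLqLoc q' Ω H ∧ bdryNorm p' Ω (carleson c₂ q' Ω H) = 1 ∧
        IntegrableOn (fun x => u.1 x * H x) Ω), ‖∫ x in Ω, u.1 x * H x‖ₑ) :
    ‖u‖ ≤ A * ‖T u‖ := by
  have hsup : ⨆ (H : E n → ℝ) (_ : MemLqLoc q' Ω H ∧ bdryNorm p' Ω (carleson c₂ q' Ω H) = 1 ∧
      IntegrableOn (fun x => u.1 x * H x) Ω), ‖∫ x in Ω, u.1 x * H x‖ₑ ≤ ‖T u‖ₑ := by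
    refine iSup₂_le fun H hH => ?_
    obtain ⟨hHloc, hH1, -⟩ := hH
    have hHae := hHloc.aestronglyMeasurable hΩ
    have hHK : AEEqFun.mk H hHae =ᵐ[volume.restrict Ω] H := AEEqFun.coeFn_mk H hHae
    have hK1 : bdryNorm p' Ω (carleson c₂ q' Ω (AEEqFun.mk H hHae)) = 1 := by
      rw [carleson_congr hc₂ q' hHK, hH1]
    let K : CSpace Ω hc₂ hq' hp' :=
      ⟨AEEqFun.mk H hHae, hHloc.congr hHK.symm, hK1.trans_lt ENNReal.one_lt_top⟩
    have hKn : ‖K‖ₑ = 1 := (enorm_CSpace K).trans hK1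
    have hTK : ∫ x in Ω, u.1 x * H x = T u K :=
      (integral_congr_ae (hHK.mono fun x hx => congrArg (u.1 x * ·) hx.symm)).trans (hT u K).symm
    have h1 : ‖T u K‖ₑ ≤ ‖T u‖ₑ * ‖K‖ₑ := (T u).le_opENorm K
    rwa [hKn, mul_one, ← hTK] at h1
  have h1 : ‖u‖ₑ ≤ A * ‖T u‖ₑ := (enorm_NSpace u).trans_le (hA.trans (by gcongr))
  have h2 := ENNReal.toReal_mono (by finiteness) h1
  simpa only [ENNReal.toReal_mul, toReal_enorm, ENNReal.coe_toReal] using h2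

end Duality

/-- A bounded operator between seminormed spaces that is injective, surjective and bounded below is
a homeomorphism. -/
lemma exists_continuousLinearEquiv_of_bounds {F G : Type*} [SeminormedAddCommGroup F]
    [NormedSpace ℝ F] [SeminormedAddCommGroup G] [NormedSpace ℝ G] (T : F →L[ℝ] G)
    (hinj : ∀ u, T u = 0 → u = 0) (hsurj : Function.Surjective T) (A : ℝ)
    (hA : ∀ u, ‖u‖ ≤ A * ‖T u‖) : ∃ e : F ≃L[ℝ] G, ∀ u, e u = T u := by
  let e := LinearEquiv.ofBijective T.toLinearMap
    ⟨(injective_iff_map_eq_zero T).2 hinj, hsurj⟩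
  refine ⟨e.toContinuousLinearEquivOfBounds ‖T‖ A T.le_opNorm fun y => ?_, fun u => rfl⟩
  have h1 := hA (e.symm y)
  have h2 : T (e.symm y) = y := e.apply_symm_apply y
  rwa [h2] at h1

section Duality

variable {C : ℝ≥0} {p p' q q' α c₁ c₂ : ℝ} {Ω : Set (E n)} {hc₁ : c₁ ∈ Ioc (0 : ℝ) (1 / 2)}
  {hc₂ : c₂ ∈ Ioc (0 : ℝ) (1 / 2)} {hq : 1 ≤ q} {hp : 1 < p} {hq' : 1 ≤ q'} {hp' : 1 < p'}

/-- The representation of functionals on Borel representatives gives surjectivity. -/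
lemma surjective_of_representation {A : ℝ≥0}
    {T : NSpace Ω α hc₁ hq hp →L[ℝ] StrongDual ℝ (CSpace Ω hc₂ hq' hp')}
    (hT : ∀ u H, T u H = ∫ x in Ω, u.1 x * H.1 x)
    (hrep : ∀ (L : (E n → ℝ) → ℝ) (S : ℝ≥0), IsBoundedFunctional c₂ q' p' Ω L S →
      ∃ u : E n → ℝ, Measurable u ∧ MemLqLoc q Ω u ∧ bdryNorm p Ω (ntMax α c₁ q Ω u) ≤ A * S ∧
        ∀ H, MemCarleson c₂ q' p' Ω H → L H = ∫ y in Ω, u y * H y) :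
    Function.Surjective T := by
  intro ℓ
  obtain ⟨u, hum, huloc, hunorm, hu⟩ := hrep _ _ (isBoundedFunctional_onRepresentatives ℓ)
  have hae : AEEqFun.mk u hum.aestronglyMeasurable =ᵐ[volume.restrict Ω] u :=
    AEEqFun.coeFn_mk u _
  have hfin : bdryNorm p Ω (ntMax α c₁ q Ω (AEEqFun.mk u hum.aestronglyMeasurable :
      E n →ₘ[volume.restrict Ω] ℝ)) < ∞ := by
    rw [ntMax_congr hc₁ q hae]
    exact hunorm.trans_lt (ENNReal.mul_lt_top ENNReal.coe_lt_top ENNReal.coe_lt_top)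
  refine ⟨⟨AEEqFun.mk u hum.aestronglyMeasurable, huloc.congr hae.symm, hfin⟩, ?_⟩
  refine ContinuousLinearMap.ext fun H => ?_
  refine (hT _ H).trans (Eq.trans ?_ (onRepresentatives_coeFn ℓ H))
  rw [hu _ (memCarleson_coeFn H)]
  exact integral_congr_ae (hae.mono fun x hx => congrArg (· * H.1 x) hx)

/-- The pairing identifies the nontangential space with the dual of the Carleson space: it is
bounded, bounded below by the norming inequality, and onto by the representation theorem. -/
theorem exists_duality_equiv (hΩ : IsRegular C Ω) {A₁ A₂ A₃ : ℝ≥0}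
    (hpair : PairingBound α c₁ c₂ p p' q q' Ω A₁)
    (hnorming : ∀ u : E n → ℝ, MemLqLoc q Ω u → bdryNorm p Ω (ntMax α c₁ q Ω u) ≤
      A₂ * ⨆ (H : E n → ℝ) (_ : MemLqLoc q' Ω H ∧ bdryNorm p' Ω (carleson c₂ q' Ω H) = 1 ∧
        IntegrableOn (fun x => u x * H x) Ω), ‖∫ x in Ω, u x * H x‖ₑ)
    (hrep : ∀ (L : (E n → ℝ) → ℝ) (S : ℝ≥0), IsBoundedFunctional c₂ q' p' Ω L S →
      ∃ u : E n → ℝ, Measurable u ∧ MemLqLoc q Ω u ∧ bdryNorm p Ω (ntMax α c₁ q Ω u) ≤ A₃ * S ∧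
        ∀ H, MemCarleson c₂ q' p' Ω H → L H = ∫ y in Ω, u y * H y) :
    ∃ e : NSpace Ω α hc₁ hq hp ≃L[ℝ] StrongDual ℝ (CSpace Ω hc₂ hq' hp'),
      (∀ (u : NSpace Ω α hc₁ hq hp) (H : CSpace Ω hc₂ hq' hp'),
        IntegrableOn (fun x => u.1 x * H.1 x) Ω ∧ e u H = ∫ x in Ω, u.1 x * H.1 x) ∧
      ∀ u : NSpace Ω α hc₁ hq hp, ‖e u‖ ≤ A₁ * ‖u‖ ∧ ‖u‖ ≤ A₂ * ‖e u‖ := by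
  obtain ⟨T, hT, hTA⟩ := exists_pairing_clm (hc₁ := hc₁) (hc₂ := hc₂) (hq := hq)
    (hp := hp) (hq' := hq') (hp' := hp') hpair
  have hlow : ∀ u, ‖u‖ ≤ A₂ * ‖T u‖ := fun u =>
    NSpace.norm_le_of_norming hΩ hT u (hnorming u.1 u.2.1)
  have hinj : ∀ u, T u = 0 → u = 0 := fun u hu => by
    refine NSpace.eq_zero_of_norm_eq_zero hpair (le_antisymm ?_ (norm_nonneg u))
    exact (hlow u).trans_eq (by rw [hu, norm_zero, mul_zero])
  obtain ⟨e, he⟩ := exists_continuousLinearEquiv_of_bounds T hinj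
    (surjective_of_representation hT hrep) A₂ hlow
  refine ⟨e, fun u H => ⟨integrableOn_pairing hpair u H, ?_⟩, fun u => ?_⟩
  · rw [he]
    exact hT u H
  · rw [he]
    exact ⟨hTA u, hlow u⟩

end Duality

end NTCarleson

theorem mainTheorem9 {n : ℕ} (hn : 1 ≤ n) {p p' q q' : ℝ}
    (hp : p.HolderConjugate p') (hq : q.HolderConjugate q')
    {α : ℝ} (hα : 0 < α)
    {c₁ c₂ : ℝ} (hc₁ : c₁ ∈ Set.Ioc (0 : ℝ) (1 / 2)) (hc₂ : c₂ ∈ Set.Ioc (0 : ℝ) (1 / 2))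
    {κ C₀ : ℝ} (hκ : 0 < κ) (hC₀ : 0 < C₀) :
    ∃ A : ℝ≥0, ∀ Ω : Set (E n), IsOpen Ω → IsConnected Ω →
      IsCorkscrew κ Ω → IsAhlforsRegular C₀ (frontier Ω) →
      (Bornology.IsBounded Ω ∨ ¬ Bornology.IsBounded (frontier Ω)) →
      -- the duality `N_{q,p} = (C_{q',p'})^*` through the pairing `(u, H) ↦ ∫_Ω u H`
      (∃ e : NSpace Ω α hc₁ hq.lt.le hp.lt ≃L[ℝ]
            StrongDual ℝ (CSpace Ω hc₂ hq.symm.lt.le hp.symm.lt),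
        (∀ (u : NSpace Ω α hc₁ hq.lt.le hp.lt) (H : CSpace Ω hc₂ hq.symm.lt.le hp.symm.lt),
          IntegrableOn (fun x => u.1 x * H.1 x) Ω ∧ e u H = ∫ x in Ω, u.1 x * H.1 x) ∧
        (∀ u : NSpace Ω α hc₁ hq.lt.le hp.lt, ‖e u‖ ≤ A * ‖u‖ ∧ ‖u‖ ≤ A * ‖e u‖)) ∧
      -- the bound for the pairing
      (∀ u H : E n → ℝ, MemLqLoc q Ω u → MemLqLoc q' Ω H →
        ∫⁻ x in Ω, ‖u x * H x‖ₑ ≤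
          A * bdryNorm p Ω (ntMax α c₁ q Ω u) * bdryNorm p' Ω (carleson c₂ q' Ω H)) ∧
      -- `C_{q',p'}` is norming for the nontangential maximal functional
      (∀ u : E n → ℝ, MemLqLoc q Ω u →
        bdryNorm p Ω (ntMax α c₁ q Ω u) ≤
          A * ⨆ (H : E n → ℝ) (_ : MemLqLoc q' Ω H ∧ bdryNorm p' Ω (carleson c₂ q' Ω H) = 1 ∧
            IntegrableOn (fun x => u x * H x) Ω), ‖∫ x in Ω, u x * H x‖ₑ) ∧
      -- `N_{q,p}` is norming for the Carleson functional
      (∀ H : E n → ℝ, MemLqLoc q' Ω H →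
        bdryNorm p' Ω (carleson c₂ q' Ω H) ≤
          A * ⨆ (u : E n → ℝ) (_ : MemLqLoc q Ω u ∧ bdryNorm p Ω (ntMax α c₁ q Ω u) = 1 ∧
            IntegrableOn (fun x => u x * H x) Ω), ‖∫ x in Ω, u x * H x‖ₑ) := by
  refine (exists_isRegular (n := n) hC₀).elim fun C hC => ?_
  refine (exists_setLIntegral_mul_le (n := n) C hp hq hα hc₁ hc₂).elim fun A₁ hA₁ => ?_
  refine (exists_bdryNorm_ntMax_le_iSup hn C hp hq hα hc₁ hc₂).elim fun A₂ hA₂ => ?_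
  refine (exists_bdryNorm_carleson_le_iSup hn C hp hq hα hc₁ hc₂).elim fun A₃ hA₃ => ?_
  refine (exists_representation hn C hp hq hα hc₁ hc₂).elim fun A₄ hA₄ => ?_
  refine ⟨max A₁ (max A₂ A₃), fun Ω hopen hconn _ hreg hbdd => ?_⟩
  have hΩ := hC Ω hopen hconn hreg hbdd
  have h1 : A₁ ≤ max A₁ (max A₂ A₃) := le_max_left _ _
  have h2 : A₂ ≤ max A₁ (max A₂ A₃) := (le_max_left _ _).trans (le_max_right _ _)
  have h3 : A₃ ≤ max A₁ (max A₂ A₃) := (le_max_right _ _).trans (le_max_right _ _)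
  refine ⟨?_, fun u H hu hH => ?_, fun u hu => ?_, fun H hH => ?_⟩
  · obtain ⟨e, he, hnorm⟩ := exists_duality_equiv (hc₁ := hc₁) (hc₂ := hc₂) (hq := hq.lt.le)
      (hp := hp.lt) (hq' := hq.symm.lt.le) (hp' := hp.symm.lt) hΩ (hA₁ Ω hΩ) (hA₂ Ω hΩ) (hA₄ Ω hΩ)
    refine ⟨e, he, fun u => ⟨(hnorm u).1.trans ?_, (hnorm u).2.trans ?_⟩⟩
    · exact mul_le_mul_of_nonneg_right (NNReal.coe_le_coe.2 h1) (norm_nonneg u)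
    · exact mul_le_mul_of_nonneg_right (NNReal.coe_le_coe.2 h2) (norm_nonneg (e u))
  · exact (hA₁ Ω hΩ u H (hu.aestronglyMeasurable hΩ) (hH.aestronglyMeasurable hΩ)).trans
      (by gcongr)
  · exact (hA₂ Ω hΩ u hu).trans (by gcongr)
  · exact (hA₃ Ω hΩ H hH).trans (by gcongr)
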